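/- **Setting.** Let $\langle V,E\rangle$ be a finite directed (multi)graph with $n=|E|$ edges, $OD\ne\varnothing$ a set of origin–destination pairs $w=(i,j)$, $i\neq j$, and, for each $w$, let $P_w\ne\varnothing$ be a finite set of directed walks (routes) from $i$ to $j$; $P=\bigcup_w P_w$. Let $\delta_{ep}$ be the number of times $p$ uses $e$ ($0$ or $1$ if no edge repeats), $\Theta=(\delta_{ep})$ with columns $\Theta^{(p)}$, $H=\max_{p\in P}\|\Theta^{(p)}\|_2^2$ (the maximal number of edges of a route, if no route repeats an edge), and $S$ the number of distinct origins. Given are demands $d_w>0$, $d=\sum_w d_w$, free-flow times $\bar t_e>0$, capacities $\bar f_e>0$, and $\gamma\ge 0$. Put $X=\{x\ge0:\sum_{p\in P_w}x_p=d_w\ \forall w\}$. * *Beckmann model* ($\mu,\rho>0$): $\tau_e(f)=\bar t_e(1+\rho(f/\bar f_e)^{1/\mu})$, $\sigma_e(f)=\int_0^f\tau_e$; minimize $\sum_e\sigma_e(f_e)+\gamma\sum_w\sum_{p\in P_w}x_p\ln(x_p/d_w)$ over $f=\Theta x$, $x\in X$. Put $h(t)=\sum_e\sigma_e^*(t_e)$,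 $\sigma_e^*(t)=\sup_{f\ge0}(tf-\sigma_e(f))$. * *Stable dynamics* ($\mu\to0+$): minimize $\sum_e f_e\bar t_e+\gamma\sum_w\sum_{p\in P_w} x_p\ln(x_p/d_w)$ over $f=\Theta x$, $x\in X$, $f\le\bar f$. Put $h(t)=\langle\bar f,t-\bar t\rangle$. The dual problem is $F(t)=\Phi(t)+h(t)\to\min_{t\in Q}$, $Q=\{t\ge\bar t\}$, where, with $g_p(t)=\sum_e\delta_{ep}t_e$, $\Phi(t)=\gamma\sum_w d_w\ln\sum_{p\in P_w}e^{-g_p(t)/\gamma}$ for $\gamma>0$ and $\Phi(t)=-\sum_w d_w\min_{p\in P_w}g_p(t)$ for $\gamma=0$ (the limit $\gamma\to0+$). For stable dynamics it is assumed that the dual has a solution $t_*$ (e.g. the one closest to $\bar t$), and $R^2=\frac12\|t_*-\bar t\|_2^2$. **Method** (universal method of similar triangles). Fix $\varepsilon>0$, $L_0^0>0$. $\nabla\Phi(y)$ is the gradient if $\gamma>0$ and an arbitrarily selected subgradient if $\gamma=0$. Start with $u^{-1}=t^{-1}=y^0=\bar t$, $A_{-1}=0$, $\varphi_{-1}(t)=\frac12\|t-\bar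 t\|_2^2$. In iteration $k=0,1,\dots$ try $L=2^jL_k^0$, $j=0,1,\dots$: put $\alpha_k=\frac1{2L}+\sqrt{\frac1{4L^2}+\frac{A_{k-1}}L}$, $A_k=A_{k-1}+\alpha_k$, $y^k=(\alpha_ku^{k-1}+A_{k-1}t^{k-1})/A_k$, $\varphi_k(t)=\varphi_{k-1}(t)+\alpha_k[\Phi(y^k)+\langle\nabla\Phi(y^k),t-y^k\rangle+h(t)]$, $u^k=\arg\min_Q\varphi_k$, $t^k=(\alpha_ku^k+A_{k-1}t^{k-1})/A_k$, and accept the first $j$ with $\Phi(t^k)\le\Phi(y^k)+\langle\nabla\Phi(y^k),t^k-y^k\rangle+\frac L2\|t^k-y^k\|_2^2+\frac{\alpha_k}{2A_k}\varepsilon$; then $L_{k+1}^0=L/2$. Let $f^k=-\nabla\Phi(y^k)$, let $x^k$ be the Gibbs flows $x^k_p=d_we^{-g_p(y^k)/\gamma}/\sum_{q\in P_w}e^{-g_q(y^k)/\gamma}$, $p\in P_w$ (for $\gamma>0$), $\bar f^N=\frac1{A_N}\sum_{k\le N}\alpha_kf^k$, $\bar x^N=\frac1{A_N}\sum_{k\le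 N}\alpha_kx^k$, and $e_N=\frac{\gamma}{A_N}\sum_{k\le N}\alpha_k\sum_w\sum_{p\in P_w} x_p^k\ln(x_p^k/d_w)$ ($e_N=0$ if $\gamma=0$). The method stops after the first iteration $N$ with $$F(t^N)+\sum_e\sigma_e(\bar f^N_e)+e_N<\varepsilon\ \text{ (Beckmann)},\qquad F(t^N)+\langle\bar f^N,\bar t\rangle+e_N+3R\|(\bar f^N-\bar f)_+\|_2<\varepsilon\ \text{ (stable dynamics)}.$$ Let $\bar R=\sqrt5R$ for stable dynamics. For the Beckmann model let $\bar R=\tilde R$, $\tilde R^2=\frac12\sum_e(\tau_e(\bar f_e^{N-1})-\bar t_e)^2$, taken at the last iteration $N-1$ that did not meet the stopping rule ($\tilde R=0$ if $N=0$). **Cost.** An operation is one of $+,-,\times,/$, power, $\exp$, $\ln$, $\sqrt{\ }$, an assignment or a comparison of real numbers, or the solution $s\ge0$ of a scalar equation $s+as^{\mu}=c$ with $a,c\ge0$ (the one-dimensional subproblem in $\arg\min_Q\varphi_k$ for the Beckmann model). Programs are branching and looping programs over real registers; a program may depend on the network $(V,E,OD,(P_w)_w)$ and the model, but not on the numerical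 data, and bookkeeping on the fixed graph is not counted. **Theorem.** There is an absolute constant $C$ such that, for both models (any $\mu>0$, or $\mu\to0+$), the following holds. 1. *Stochastic case.* Suppose that every directed walk from the origin to the destination of a pair $w\in OD$ with at most as many edges as the longest route in $P$ belongs to $P_w$. If $\gamma>0$, the method stops, and the number of arithmetic operations is at most $$C\,SHn\left(1+\Bigl|\ln\frac{L_0^0\gamma}{Hd}\Bigr|+\sqrt{\frac{Hd\bar R^2}{\gamma\varepsilon}}\right).$$ 2. *Non-stochastic case.* Suppose that $n\ge2$ and that every directed path without repeated vertices from the origin to the destination of a pair $w\in OD$ belongs to $P_w$. If $\gamma=0$, the method stops, and (for a suitable choice of the subgradients) the number of arithmetic operations is at most $$C\,Sn\ln n\left(1+\Bigl|\ln\frac{L_0^0\varepsilon}{Hd^2}\Bigr|+\frac{Hd^2\bar R^2}{\varepsilon^2}\right).$$ 3. *Entropic regularization.* In the situation of 1, let $\sum_wd_w\ln|P_w|>0$, $\gamma_*=\varepsilon/(2\sum_wd_w\ln|P_w|)$, $\omega=\max_w\ln|P_w|$. The method run with $\gamma=\gamma_*$ and accuracy $\varepsilon/2$ stops after at most $$C\,SHn\left(1+\Bigl|\ln\frac{L_0^0\gamma_*}{Hd}\Bigr|+\frac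 d\varepsilon\sqrt{H\bar R^2\omega}\right)$$ operations, and $\bar x^N$ solves the primal problem with $\gamma=0$ up to $\varepsilon$ in the sense below. In each case, for every choice of the subgradients, the number of trials of a value of $L$ in all iterations together is at most $C$ times the expression in the large parentheses. *Accuracy at the stop, in 1 and 2 and for the regularized problem in 3* (there with $\varepsilon/2$ for $\varepsilon$): $F(t^N)\le F(t)+\varepsilon$ for all $t\in Q$; there is $\bar x\in X$ with $\bar f^N=\Theta\bar x$ ($\bar x=\bar x^N$ if $\gamma>0$), whose primal objective exceeds that of no feasible $x$ by more than $\varepsilon$; for stable dynamics also $R\,\|(\bar f^N-\bar f)_+\|_2\le\varepsilon$. The bounds do not depend on $|P|$ (except through $\gamma_*$ and $\omega$ in 3). -/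

import Mathlib

open scoped BigOperators

noncomputable section

namespace Traffic

/-! ### Transport networks -/

/-- `IsWalk src tgt i j p`: the list of edges `p` can be traversed, in this order and respecting
the orientation of the edges, from vertex `i` to vertex `j`. -/
def IsWalk {v n : ℕ} (src tgt : Fin n → Fin v) : Fin v → Fin v → List (Fin n) → Prop
  | i, j, [] => i = j
  | i, j, e :: p => src e = i ∧ IsWalk src tgt (tgt e) j p

/-- A directed (multi)graph with vertices `Fin v` and edges `Fin n`, a set `od` of
origin-destination pairs, and for each pair `w` the finite set `routes w` of its routes. -/
structure Network (v n : ℕ) where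
  src : Fin n → Fin v
  tgt : Fin n → Fin v
  od : Finset (Fin v × Fin v)
  routes : Fin v × Fin v → Finset (List (Fin n))
  od_nonempty : od.Nonempty
  od_ne : ∀ w ∈ od, w.1 ≠ w.2
  routes_nonempty : ∀ w ∈ od, (routes w).Nonempty
  routes_walk : ∀ w ∈ od, ∀ p ∈ routes w, IsWalk src tgt w.1 w.2 p

/-- The entry of the edge-route incidence matrix: the number of times the route `p` uses `e`;
it is `0` or `1` if no edge is repeated. -/
def theta {n : ℕ} (e : Fin n) (p : List (Fin n)) : ℝ := (p.count e : ℝ)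

namespace Network

variable {v n : ℕ} (N : Network v n)

/-- `H = max_p ‖Θ^{(p)}‖₂²`, which is the maximal number of edges of a route when
no route repeats an edge. -/
def H : ℕ := N.od.sup fun w => (N.routes w).sup fun p => ∑ e : Fin n, (p.count e) ^ 2

/-- The number of origins. -/
def S : ℕ := (N.od.image Prod.fst).card

/-- The maximal number of edges of a route. -/
def maxLen : ℕ := N.od.sup fun w => (N.routes w).sup List.length

/-- All movements along the edges are admissible: every walk from the origin to the destination
having no more edges than the longest route is a route. -/
def AllWalks : Prop :=
  ∀ w ∈ N.od, ∀ p : List (Fin n),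
    IsWalk N.src N.tgt w.1 w.2 p → p.length ≤ N.maxLen → p ∈ N.routes w

/-- Every walk from the origin to the destination without repeated vertices is a route. -/
def AllSimplePaths : Prop :=
  ∀ w ∈ N.od, ∀ p : List (Fin n),
    IsWalk N.src N.tgt w.1 w.2 p → (w.1 :: p.map N.tgt).Nodup → p ∈ N.routes w

/-- `ω = max_w ln |P_w|`. -/
def omega : ℝ := N.od.sup' N.od_nonempty fun w => Real.log ((N.routes w).card : ℝ)

end Network

/-! ### The numerical data and the primal problems -/

/-- The Beckmann model (`μ > 0`) or the stable dynamics model (`μ → 0+`). -/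
inductive Model
  | beckmann
  | stable

/-- The numerical data: free-flow times, capacities, demands, the parameters `ρ`, `μ` of the
cost functions (used by the Beckmann model only), the stochasticity parameter `γ` (`γ = 0` is
the non-stochastic case), the accuracy `ε`, the starting value `L₀⁰` of the method, and the
radius `R` (used by the stopping rule of the stable dynamics model only). -/
structure Data (v n : ℕ) where
  tbar : Fin n → ℝ
  fbar : Fin n → ℝ
  dem : Fin v × Fin v → ℝ
  rho : ℝ
  mu : ℝ
  gamma : ℝ
  eps : ℝ
  L0 : ℝ
  R : ℝ

section Problems

variable {v n : ℕ} (N : Network v n) (M : Model) (D : Data v n)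

/-- The total demand `d`. -/
def totalDemand : ℝ := ∑ w ∈ N.od, D.dem w

/-- `τ_e(f) = t̄_e (1 + ρ (f / f̄_e)^{1/μ})`. -/
def tau (e : Fin n) (f : ℝ) : ℝ := D.tbar e * (1 + D.rho * (f / D.fbar e) ^ (1 / D.mu))

/-- `σ_e(f) = ∫₀^f τ_e(z) dz`. -/
def sigma (e : Fin n) (f : ℝ) : ℝ := ∫ z in (0 : ℝ)..f, tau D e z

/-- The conjugate `σ_e^*(t) = sup_{f ≥ 0} (t f - σ_e(f))`. -/
def sigmaStar (e : Fin n) (t : ℝ) : ℝ :=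
  sSup ((fun f : ℝ => t * f - sigma D e f) '' Set.Ici 0)

/-- `f = Θ x` for a vector `x` of route flows. -/
def edgeFlow (x : Fin v × Fin v → List (Fin n) → ℝ) (e : Fin n) : ℝ :=
  ∑ w ∈ N.od, ∑ p ∈ N.routes w, theta e p * x w p

/-- The product of simplices `X`. -/
def FlowSet : Set (Fin v × Fin v → List (Fin n) → ℝ) :=
  {x | ∀ w ∈ N.od, (∀ p ∈ N.routes w, 0 ≤ x w p) ∧ ∑ p ∈ N.routes w, x w p = D.dem w}

/-- `∑_w ∑_p x_p ln (x_p / d_w)`. -/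
def entropy (x : Fin v × Fin v → List (Fin n) → ℝ) : ℝ :=
  ∑ w ∈ N.od, ∑ p ∈ N.routes w, x w p * Real.log (x w p / D.dem w)

/-- The primal objective with stochasticity parameter `g`. -/
def primal (g : ℝ) (x : Fin v × Fin v → List (Fin n) → ℝ) : ℝ :=
  (match M with
    | .beckmann => ∑ e, sigma D e (edgeFlow N x e)
    | .stable => ∑ e, edgeFlow N x e * D.tbar e) + g * entropy N D x

/-- The feasible set of the primal problem; stable dynamics adds the capacities `f ≤ f̄`. -/
def Feasible : Set (Fin v × Fin v → List (Fin n) → ℝ) :=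
  match M with
  | .beckmann => FlowSet N D
  | .stable => {x | x ∈ FlowSet N D ∧ ∀ e, edgeFlow N x e ≤ D.fbar e}

/-! ### The dual problem -/

/-- The cost `g_p(t) = ∑_e δ_{ep} t_e` of a route. -/
def routeCost (t : Fin n → ℝ) (p : List (Fin n)) : ℝ := ∑ e, theta e p * t e

/-- `ψ(t) = ∑_w d_w ln ∑_{p ∈ P_w} exp (-g_p(t))`. -/
def psi (t : Fin n → ℝ) : ℝ :=
  ∑ w ∈ N.od, D.dem w * Real.log (∑ p ∈ N.routes w, Real.exp (-routeCost t p))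

/-- `Φ(t) = γ ψ(t/γ)`, and its limit `-∑_w d_w min_{p ∈ P_w} g_p(t)` for `γ = 0`. -/
def potential (t : Fin n → ℝ) : ℝ :=
  if D.gamma = 0 then -∑ w ∈ N.od, D.dem w * sInf (routeCost t '' (N.routes w : Set (List (Fin n))))
  else D.gamma * psi N D (fun e => t e / D.gamma)

/-- The composite term: `∑_e σ_e^*(t_e)`, or `⟨f̄, t - t̄⟩` for stable dynamics. -/
def composite (t : Fin n → ℝ) : ℝ :=
  match M with
  | .beckmann => ∑ e, sigmaStar D e (t e)
  | .stable => ∑ e, D.fbar e * (t e - D.tbar e)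

/-- The dual feasible set `t ≥ t̄`. -/
def dualSet : Set (Fin n → ℝ) := {t | ∀ e, D.tbar e ≤ t e}

/-- The dual objective `F = Φ + h`. -/
def dual (t : Fin n → ℝ) : ℝ := potential N D t + composite M D t

/-- The logit (Gibbs) route flows at edge costs `t`. -/
def logitFlow (t : Fin n → ℝ) (w : Fin v × Fin v) (p : List (Fin n)) : ℝ :=
  D.dem w * Real.exp (-routeCost t p / D.gamma) /
    ∑ q ∈ N.routes w, Real.exp (-routeCost t q / D.gamma)

/-- `G` selects a subgradient of `Φ` at each dual feasible point; for `γ > 0` the function `Φ` is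
convex and differentiable, so that `G = ∇Φ` there. -/
def IsOracle (G : (Fin n → ℝ) → Fin n → ℝ) : Prop :=
  ∀ t ∈ dualSet D, ∀ s : Fin n → ℝ,
    potential N D t + ∑ e, G t e * (s e - t e) ≤ potential N D s

/-- The standing assumptions on the data. For stable dynamics the dual problem has a solution `t_*`
and `R² = ‖t_* - t̄‖₂² / 2`; `t_*` may be the solution closest to `t̄`, or any other one. -/
structure Valid : Prop where
  tbar_pos : ∀ e, 0 < D.tbar e
  fbar_pos : ∀ e, 0 < D.fbar e
  dem_pos : ∀ w ∈ N.od, 0 < D.dem w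
  gamma_nonneg : 0 ≤ D.gamma
  eps_pos : 0 < D.eps
  L0_pos : 0 < D.L0
  beckmann : M = .beckmann → 0 < D.rho ∧ 0 < D.mu
  stable : M = .stable → ∃ tstar ∈ dualSet D, (∀ s ∈ dualSet D, dual N M D tstar ≤ dual N M D s) ∧
    D.R = Real.sqrt ((1 / 2) * ∑ e, (tstar e - D.tbar e) ^ 2)

end Problems

/-! ### The universal method of similar triangles -/

/-- A composite problem `Φ + h → min` over `Q`, with a (sub)gradient `grad` of `Φ`, a starting
point, an accuracy and a starting value for the constant `L`. -/
structure Composite (n : ℕ) where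
  Phi : (Fin n → ℝ) → ℝ
  grad : (Fin n → ℝ) → Fin n → ℝ
  h : (Fin n → ℝ) → ℝ
  Q : Set (Fin n → ℝ)
  y0 : Fin n → ℝ
  eps : ℝ
  L0 : ℝ

/-- A minimizer of `f` over `Q`. -/
def argminOn {n : ℕ} (Q : Set (Fin n → ℝ)) (f : (Fin n → ℝ) → ℝ) : Fin n → ℝ :=
  Classical.epsilon fun t => t ∈ Q ∧ ∀ s ∈ Q, f t ≤ f s

/-- The state of the method: the accepted pairs `(α_i, y^i)`, latest first, the value of `L` to be
tried next, and `A_k`, `u^k`, `t^k` for the last accepted iteration `k`. -/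
structure State (n : ℕ) where
  hist : List (ℝ × (Fin n → ℝ))
  L : ℝ
  A : ℝ
  u : Fin n → ℝ
  t : Fin n → ℝ

namespace Composite

variable {n : ℕ} (P : Composite n)

/-- `Φ(y) + ⟨∇Φ(y), t - y⟩`. -/
def lin (y t : Fin n → ℝ) : ℝ := P.Phi y + ∑ e, P.grad y e * (t e - y e)

/-- The estimating function `φ` built from the accepted pairs `(α_i, y^i)`. -/
def phi (hist : List (ℝ × (Fin n → ℝ))) (t : Fin n → ℝ) : ℝ :=
  (1 / 2) * ∑ e, (t e - P.y0 e) ^ 2 + (hist.map fun q => q.1 * (P.lin q.2 t + P.h t)).sum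

/-- The trial `α_{k+1}`. -/
def alpha (s : State n) : ℝ := 1 / (2 * s.L) + Real.sqrt (1 / (4 * s.L ^ 2) + s.A / s.L)

/-- The trial `A_{k+1}`. -/
def nextA (s : State n) : ℝ := s.A + alpha s

/-- The trial `y^{k+1}`. -/
def nextY (s : State n) : Fin n → ℝ := fun e => (alpha s * s.u e + s.A * s.t e) / nextA s

/-- The trial `u^{k+1}`. -/
def nextU (s : State n) : Fin n → ℝ := argminOn P.Q (P.phi ((alpha s, nextY s) :: s.hist))

/-- The trial `t^{k+1}`. -/
def nextT (s : State n) : Fin n → ℝ :=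
  fun e => (alpha s * P.nextU s e + s.A * s.t e) / nextA s

/-- The trial is accepted. -/
def Accepts (s : State n) : Prop :=
  P.Phi (P.nextT s) ≤ P.lin (nextY s) (P.nextT s)
    + s.L / 2 * ∑ e, (P.nextT s e - nextY s e) ^ 2 + alpha s / (2 * nextA s) * P.eps

open Classical in
/-- One trial. If it is accepted, the iteration is complete and the next one starts with half of
the current `L`; otherwise `L` is doubled. -/
def step (s : State n) : State n :=
  if P.Accepts s then
    { hist := (alpha s, nextY s) :: s.hist
      L := s.L / 2
      A := nextA s
      u := P.nextU s
      t := P.nextT s }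
  else { s with L := 2 * s.L }

/-- The state before the first trial. With `A = 0` and `u = t = y⁰` the general trial is the one of
iteration `0`: `α_0 = A_0 = 1 / L`, the point `y` is `y⁰`, and `t⁰ = u⁰ = argmin φ_0`. -/
def start : State n := { hist := [], L := P.L0, A := 0, u := P.y0, t := P.y0 }

/-- The state after `m` trials. -/
def state (m : ℕ) : State n := P.step^[m] P.start

end Composite

/-! ### The method on the dual problem, and its stopping rules -/

section Method

variable {v n : ℕ} (N : Network v n) (M : Model) (D : Data v n)
  (G : (Fin n → ℝ) → Fin n → ℝ)

/-- The dual problem as a composite problem with oracle `G`, started at `y⁰ = t̄`. -/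
def dualProblem : Composite n where
  Phi := potential N D
  grad := G
  h := composite M D
  Q := dualSet D
  y0 := D.tbar
  eps := D.eps
  L0 := D.L0

/-- The average `(∑ α_i c(y^i)) / (∑ α_i)` over the accepted pairs (`0` if there are none). -/
def average (hist : List (ℝ × (Fin n → ℝ))) (c : (Fin n → ℝ) → ℝ) : ℝ :=
  (hist.map fun q => q.1 * c q.2).sum / (hist.map Prod.fst).sum

/-- The average edge flow `f̄^N`, where `f^i = -∇Φ(y^i)`. -/
def avgFlow (hist : List (ℝ × (Fin n → ℝ))) (e : Fin n) : ℝ :=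
  average hist fun y => -G y e

/-- The average route flow `x̄^N` (for `γ > 0`). -/
def avgRoute (hist : List (ℝ × (Fin n → ℝ))) (w : Fin v × Fin v) (p : List (Fin n)) : ℝ :=
  average hist fun y => logitFlow N D y w p

/-- The capacity violation `‖(f̄^N - f̄)_+‖₂`. -/
def violation (hist : List (ℝ × (Fin n → ℝ))) : ℝ :=
  Real.sqrt (∑ e, (max (avgFlow G hist e - D.fbar e) 0) ^ 2)

/-- The computable upper bound of the duality gap, with the averaged entropy; for stable dynamics
the term `3 R ‖(f̄^N - f̄)_+‖₂` is added. -/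
def gap (s : State n) : ℝ :=
  dual N M D s.t
    + (match M with
        | .beckmann => ∑ e, sigma D e (avgFlow G s.hist e)
        | .stable => ∑ e, avgFlow G s.hist e * D.tbar e + 3 * D.R * violation D G s.hist)
    + D.gamma * average s.hist fun y => entropy N D (logitFlow N D y)

/-- The stopping rule, checked when at least one iteration is complete. -/
def Stop (s : State n) : Prop := s.hist ≠ [] ∧ gap N M D G s < D.eps

/-- The method stops after exactly `m` trials. -/
def StopsAfter (m : ℕ) : Prop :=
  Stop N M D G ((dualProblem N M D G).state m) ∧
    ∀ k < m, ¬ Stop N M D G ((dualProblem N M D G).state k)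

/-- `R̄`. For stable dynamics it is `√5 R`. For the Beckmann model it is the quantity
`R̃ = (∑_e (τ_e(f̄_e) - t̄_e)² / 2)^{1/2}` at the last iteration whose average flow `f̄` did not meet
the stopping rule: `s` is the final state, and dropping the latest pair from its history gives the
preceding iteration. The value is `0` if the method stops at its first iteration. -/
def Rbar (s : State n) : ℝ :=
  match M with
  | .beckmann =>
      Real.sqrt ((1 / 2) * ∑ e, (tau D e (avgFlow G s.hist.tail e) - D.tbar e) ^ 2)
  | .stable => Real.sqrt 5 * D.R

/-- The recovered average flow `f̄^N` is generated by route flows `x̄ ∈ X` (for `γ > 0`, by `x̄^N`),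
which solve the primal problem with stochasticity parameter `g` up to `ε`; for stable
dynamics the capacity violation times `R` is at most `ε` too. -/
def PrimalAccurate (g ε : ℝ) (s : State n) : Prop :=
  (∃ x ∈ FlowSet N D, (∀ e, edgeFlow N x e = avgFlow G s.hist e) ∧
    (0 < D.gamma → x = avgRoute N D s.hist) ∧
    ∀ z ∈ Feasible N M D, primal N M D g x ≤ primal N M D g z + ε) ∧
  (M = .stable → D.R * violation D G s.hist ≤ ε)

/-- The point `t^N` solves the dual problem up to `ε`. -/
def DualAccurate (ε : ℝ) (s : State n) : Prop :=
  s.t ∈ dualSet D ∧ ∀ z ∈ dualSet D, dual N M D s.t ≤ dual N M D z + ε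

end Method

/-! ### Programs over the reals and their number of operations -/

/-- Registers: the inputs, and countably many work registers. -/
inductive Reg (v n : ℕ)
  | tbar (e : Fin n)
  | fbar (e : Fin n)
  | dem (w : Fin v × Fin v)
  | rho
  | mu
  | gamma
  | eps
  | L0
  | R
  | work (i : ℕ)

/-- The unique `s ≥ 0` with `s + a s^m = c` (for `a, c ≥ 0`, `m > 0`): the optimality condition of
the one-dimensional subproblem of the Beckmann model (of degree four if `m = 1/4`). -/
def powRoot (a m c : ℝ) : ℝ := sSup {s : ℝ | 0 ≤ s ∧ s + a * s ^ m ≤ c}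

/-- Elementary operations of two arguments. -/
inductive BinOp
  | add
  | sub
  | mul
  | div
  | pow

/-- Elementary operations of one argument. -/
inductive UnOp
  | copy
  | exp
  | log
  | sqrt

def BinOp.eval : BinOp → ℝ → ℝ → ℝ
  | .add, x, y => x + y
  | .sub, x, y => x - y
  | .mul, x, y => x * y
  | .div, x, y => x / y
  | .pow, x, y => x ^ y

def UnOp.eval : UnOp → ℝ → ℝ
  | .copy, x => x
  | .exp, x => Real.exp x
  | .log, x => Real.log x
  | .sqrt, x => Real.sqrt x

/-- Programs with real registers, branching on comparisons, and loops. The first register of an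
assignment is its target. A program is written for one network and must work for all numerical
data on it; what is counted is the operations on real numbers and their comparisons. -/
inductive Prog (v n : ℕ)
  | skip
  | const (r : Reg v n) (q : ℚ)
  | unary (o : UnOp) (r a : Reg v n)
  | binary (o : BinOp) (r a b : Reg v n)
  | root (r a m c : Reg v n)
  | seq (p q : Prog v n)
  | ite (a b : Reg v n) (p q : Prog v n)
  | loop (a b : Reg v n) (p : Prog v n)

open Classical in
/-- Writing a value to a register. -/
def write {v n : ℕ} (σ : Reg v n → ℝ) (r : Reg v n) (x : ℝ) : Reg v n → ℝ :=
  Function.update σ r x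

/-- `Exec p σ σ' c`: started in memory `σ`, the program `p` halts in memory `σ'` after `c`
operations. Every assignment and every comparison is one operation. -/
inductive Exec {v n : ℕ} : Prog v n → (Reg v n → ℝ) → (Reg v n → ℝ) → ℕ → Prop
  | skip (σ) : Exec .skip σ σ 0
  | const (r q σ) : Exec (.const r q) σ (write σ r (q : ℝ)) 1
  | unary (o r a σ) : Exec (.unary o r a) σ (write σ r (o.eval (σ a))) 1
  | binary (o r a b σ) : Exec (.binary o r a b) σ (write σ r (o.eval (σ a) (σ b))) 1
  | root (r a m c σ) : Exec (.root r a m c) σ (write σ r (powRoot (σ a) (σ m) (σ c))) 1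
  | seq {p q σ₁ σ₂ σ₃ c₁ c₂} (h₁ : Exec p σ₁ σ₂ c₁) (h₂ : Exec q σ₂ σ₃ c₂) :
      Exec (.seq p q) σ₁ σ₃ (c₁ + c₂)
  | ite_true {a b p q σ σ' c} (h : σ a < σ b) (hp : Exec p σ σ' c) :
      Exec (.ite a b p q) σ σ' (c + 1)
  | ite_false {a b p q σ σ' c} (h : ¬ σ a < σ b) (hq : Exec q σ σ' c) :
      Exec (.ite a b p q) σ σ' (c + 1)
  | loop_true {a b p σ₁ σ₂ σ₃ c₁ c₂} (h : σ₁ a < σ₁ b) (hp : Exec p σ₁ σ₂ c₁)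
      (hl : Exec (.loop a b p) σ₂ σ₃ c₂) : Exec (.loop a b p) σ₁ σ₃ (c₁ + c₂ + 1)
  | loop_false {a b p σ} (h : ¬ σ a < σ b) : Exec (.loop a b p) σ σ 1

/-- The initial memory: the data in the input registers, zeros elsewhere. -/
def input {v n : ℕ} (D : Data v n) : Reg v n → ℝ
  | .tbar e => D.tbar e
  | .fbar e => D.fbar e
  | .dem w => D.dem w
  | .rho => D.rho
  | .mu => D.mu
  | .gamma => D.gamma
  | .eps => D.eps
  | .L0 => D.L0
  | .R => D.R
  | .work _ => 0

/-- The guarantee on the data `D`, where `trialCost` is the cost of one trial and `rate R̄` the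
number of trials, both up to the factor `C`:
for every choice of the (sub)gradients the method stops, with the accuracy `ε` and the stated
number of trials; and `prog` performs the method (for some choice of the (sub)gradients), i.e. it
halts with the final `t^N` and `f̄^N` in the registers `tOut`, `fOut`, within the
stated number of operations. -/
def Guarantee {v n : ℕ} (C : ℝ) (N : Network v n) (M : Model) (D : Data v n)
    (prog : Prog v n) (tOut fOut : Fin n → Reg v n) (trialCost : ℝ) (rate : ℝ → ℝ) : Prop :=
  (∀ G, IsOracle N D G → ∃ m, StopsAfter N M D G m ∧
    (m : ℝ) ≤ C * rate (Rbar M D G ((dualProblem N M D G).state m)) ∧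
    PrimalAccurate N M D G D.gamma D.eps ((dualProblem N M D G).state m) ∧
    DualAccurate N M D D.eps ((dualProblem N M D G).state m)) ∧
  (∃ G, IsOracle N D G ∧ ∃ m, StopsAfter N M D G m ∧ ∃ σ c, Exec prog (input D) σ c ∧
    (c : ℝ) ≤ C * (trialCost * rate (Rbar M D G ((dualProblem N M D G).state m))) ∧
    (∀ e, σ (tOut e) = ((dualProblem N M D G).state m).t e) ∧
    ∀ e, σ (fOut e) = avgFlow G ((dualProblem N M D G).state m).hist e)

end Traffic

end

/-! All estimates live on the dual side. The method keeps the invariant `Inv`: A·F(t) is at most the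
minimum of the estimating function φ plus A·ε/2. Now φ is built from linearizations of Φ, and
entropy duality turns each of them into minus an edge flow (the slope) and minus γ times an entropy
(the intercept), see `lin_eq`. Hence φ(t) is ½‖t − t̄‖² + A·(h(t) − averaged entropy term −
⟨averaged flow, t⟩), which is `phi_dual`. Evaluating it at one well-chosen point produces the primal
objective. In the Beckmann model the point is t = τ(averaged flow), where Fenchel's inequality is an
equality; in stable dynamics it is t̄ shifted by the length 3R along the capacity violation. The
outcome is A·gap ≤ R̄² + A·ε/2 (`weight_mul_gap_le`), so A ≤ 2R̄²/ε while the stopping rule fails,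
and the number of iterations depends only on how fast A grows.

For γ > 0, Hoeffding's bound makes ∇Φ Lipschitz with constant 4Hd/γ (`potential_le_of_pos`). Every L
above this constant is accepted, √A eventually rises by a fixed amount per iteration, and A grows
quadratically. For γ = 0 the subgradients are edge flows of norm at most d√H; the slack αε/(2A) in
the test then admits every α ≤ ε/(4Hd²), the steps α stay bounded below, and A grows linearly.
Rejected trials are controlled by the identity L·4^(accepted) = L₀·2^(trials) of `state_L`. Since R̄
for Beckmann depends on the stopping time, termination is proved separately from a uniform bound on
the flows.

Accuracy at the stop is weak duality (`neg_dual_le_primal`, `edgeObjective_add_dual_ge`) together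
with convexity of the entropy. In stable dynamics the averaged flow may violate the capacities; this
costs at most 2R times the violation, and the weight 3R in the gap leaves R times the violation to
be bounded by ε. In the entropic variant, γ_* is chosen so that the entropy term changes the
objective by at most ε/2.

For the operation count, an explicit program is verified. A trial is O(n) arithmetic plus two calls
of an oracle. For γ > 0 the oracle sums over all walks by forward and backward recursions, at most H
layers of O(n) work per origin (`edgeFlow_logit_eq`). For γ = 0 it is Dijkstra's algorithm with a
sorted queue and binary insertion. The tree and the queue are encoded in the control flow of the
program, so that only arithmetic on keys and comparisons are charged, O(n log n) per origin; the
flows are then collected from the leaves of the tree. -/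

open scoped BigOperators

noncomputable section

namespace Traffic

/-! ### The similar triangles method for an abstract composite problem -/

namespace Composite

variable {n : ℕ} (P : Composite n)

/-- The assumptions on a composite problem under which the method is analysed: besides convexity,
the estimating functions have minimizers with quadratic growth. -/
structure Regular : Prop where
  L0_pos : 0 < P.L0
  eps_pos : 0 < P.eps
  y0_mem : P.y0 ∈ P.Q
  convex_Q : Convex ℝ P.Q
  convex_h : ConvexOn ℝ P.Q P.h
  lin_le : ∀ y ∈ P.Q, ∀ t ∈ P.Q, P.lin y t ≤ P.Phi t
  exists_min : ∀ hist : List (ℝ × (Fin n → ℝ)), hist ≠ [] → (∀ q ∈ hist, 0 < q.1 ∧ q.2 ∈ P.Q) →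
    ∃ u ∈ P.Q, ∀ t ∈ P.Q, P.phi hist u + (1 / 2) * ∑ e, (t e - u e) ^ 2 ≤ P.phi hist t

/-- The invariant of the method. -/
structure Inv (s : State n) : Prop where
  L_pos : 0 < s.L
  A_eq : s.A = (s.hist.map Prod.fst).sum
  hist_pos : ∀ q ∈ s.hist, 0 < q.1 ∧ q.2 ∈ P.Q
  u_mem : s.u ∈ P.Q
  t_mem : s.t ∈ P.Q
  growth : ∀ t ∈ P.Q, P.phi s.hist s.u + (1 / 2) * ∑ e, (t e - s.u e) ^ 2 ≤ P.phi s.hist t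
  estimate : s.A * (P.Phi s.t + P.h s.t) ≤ P.phi s.hist s.u + s.A * (P.eps / 2)

variable {P}

theorem phi_cons (a : ℝ) (y : Fin n → ℝ) (hist : List (ℝ × (Fin n → ℝ))) (t : Fin n → ℝ) :
    P.phi ((a, y) :: hist) t = P.phi hist t + a * (P.lin y t + P.h t) := by
  simp only [phi, List.map_cons, List.sum_cons]; ring

/-- Quadratic growth makes the minimizer unique, so the arbitrary choice inside `argminOn` coincides
with any explicitly known minimizer. -/
theorem argminOn_eq {Q : Set (Fin n → ℝ)} {f : (Fin n → ℝ) → ℝ} {u : Fin n → ℝ} (hu : u ∈ Q)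
    (hg : ∀ t ∈ Q, f u + (1 / 2) * ∑ e, (t e - u e) ^ 2 ≤ f t) : argminOn Q f = u := by
  have hex : ∃ t, t ∈ Q ∧ ∀ s ∈ Q, f t ≤ f s := by
    refine ⟨u, hu, fun s hs => ?_⟩
    have h0 : 0 ≤ ∑ e, (s e - u e) ^ 2 := Finset.sum_nonneg fun e _ => sq_nonneg _
    linarith [hg s hs]
  have hs := Classical.epsilon_spec hex
  change argminOn Q f ∈ Q ∧ ∀ s ∈ Q, f (argminOn Q f) ≤ f s at hs
  have h1 := hg _ hs.1
  have h2 := hs.2 u hu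
  have h0 : ∑ e, (argminOn Q f e - u e) ^ 2 = 0 :=
    le_antisymm (by linarith) (Finset.sum_nonneg fun e _ => sq_nonneg _)
  rw [Finset.sum_eq_zero_iff_of_nonneg fun e _ => sq_nonneg _] at h0
  funext e
  have := h0 e (Finset.mem_univ e)
  exact sub_eq_zero.mp (pow_eq_zero_iff two_ne_zero |>.mp this)

theorem alpha_pos {s : State n} (hL : 0 < s.L) : 0 < alpha s := by
  have : 0 < 1 / (2 * s.L) := by positivity
  exact add_pos_of_pos_of_nonneg this (Real.sqrt_nonneg _)

/-- The trial step is the positive root of L·α² = A + α; this equation is the only property of the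
formula used in the convergence proof. -/
theorem alpha_sq {s : State n} (hL : 0 < s.L) (hA : 0 ≤ s.A) :
    s.L * alpha s ^ 2 = nextA s := by
  have h : Real.sqrt (1 / (4 * s.L ^ 2) + s.A / s.L) ^ 2 = 1 / (4 * s.L ^ 2) + s.A / s.L :=
    Real.sq_sqrt (by positivity)
  unfold nextA alpha
  set r := Real.sqrt (1 / (4 * s.L ^ 2) + s.A / s.L)
  have : s.L * (1 / (2 * s.L) + r) ^ 2 = 1 / (4 * s.L) + r + s.L * r ^ 2 := by
    field_simp; ring
  rw [this, h]; field_simp; ring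

theorem Inv.A_nonneg {s : State n} (hs : P.Inv s) : 0 ≤ s.A := by
  rw [hs.A_eq]
  refine List.sum_nonneg fun x hx => ?_
  obtain ⟨q, hq, rfl⟩ := List.mem_map.mp hx
  exact (hs.hist_pos q hq).1.le

theorem Inv.nextA_pos {s : State n} (hs : P.Inv s) : 0 < nextA s :=
  add_pos_of_nonneg_of_pos hs.A_nonneg (alpha_pos hs.L_pos)

theorem Regular.mix_mem (hP : P.Regular) {s : State n} (hs : P.Inv s) {a b : Fin n → ℝ}
    (ha : a ∈ P.Q) (hb : b ∈ P.Q) :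
    (fun e => (alpha s * a e + s.A * b e) / nextA s) ∈ P.Q := by
  have hN := hs.nextA_pos
  have := hP.convex_Q ha hb (a := alpha s / nextA s) (b := s.A / nextA s)
    (div_nonneg (alpha_pos hs.L_pos).le hN.le) (div_nonneg hs.A_nonneg hN.le)
    (by rw [← add_div, div_eq_one_iff_eq hN.ne', nextA]; ring)
  convert this using 1
  funext e
  simp only [Pi.add_apply, Pi.smul_apply, smul_eq_mul]; ring

theorem Regular.nextY_mem (hP : P.Regular) {s : State n} (hs : P.Inv s) : nextY s ∈ P.Q :=
  hP.mix_mem hs hs.u_mem hs.t_mem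

theorem Regular.nextU_spec (hP : P.Regular) {s : State n} (hs : P.Inv s) :
    P.nextU s ∈ P.Q ∧ ∀ t ∈ P.Q, P.phi ((alpha s, nextY s) :: s.hist) (P.nextU s)
      + (1 / 2) * ∑ e, (t e - P.nextU s e) ^ 2 ≤ P.phi ((alpha s, nextY s) :: s.hist) t := by
  obtain ⟨u, hu, hg⟩ := hP.exists_min ((alpha s, nextY s) :: s.hist) (by simp) (by
    intro q hq
    rcases List.mem_cons.mp hq with rfl | hq
    · exact ⟨alpha_pos hs.L_pos, hP.nextY_mem hs⟩
    · exact hs.hist_pos q hq)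
  have : P.nextU s = u := argminOn_eq hu hg
  rw [this]; exact ⟨hu, hg⟩

theorem Regular.nextT_mem (hP : P.Regular) {s : State n} (hs : P.Inv s) : P.nextT s ∈ P.Q :=
  hP.mix_mem hs (hP.nextU_spec hs).1 hs.t_mem

theorem Regular.inv_start (hP : P.Regular) : P.Inv P.start where
  L_pos := hP.L0_pos
  A_eq := by simp [start]
  hist_pos := by simp [start]
  u_mem := hP.y0_mem
  t_mem := hP.y0_mem
  growth := by intro t _; simp [start, phi]
  estimate := by simp [start, phi]

theorem lin_mix (y a b : Fin n → ℝ) {x z w : ℝ} (hw : w ≠ 0) (h : x + z = w) :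
    w * P.lin y (fun e => (x * a e + z * b e) / w) = x * P.lin y a + z * P.lin y b := by
  have key : ∀ e, w * (P.grad y e * ((x * a e + z * b e) / w - y e))
      = x * (P.grad y e * (a e - y e)) + z * (P.grad y e * (b e - y e)) := by
    intro e; field_simp; rw [← h]; ring
  unfold lin
  rw [mul_add, Finset.mul_sum, Finset.sum_congr rfl fun e _ => key e, Finset.sum_add_distrib,
    ← Finset.mul_sum, ← Finset.mul_sum, ← h]
  ring

/-- The new φ at its minimizer exceeds the old minimum by ½‖u' − u‖² plus α times the new linear
model. The old estimate and the minorant property bound the old minimum below by A·(lin(t) + h(t)) −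
A·ε/2. Affinity of lin and convexity of h merge the two points u' and t into t', and the quadratic
term becomes exactly the one in the acceptance test. -/
theorem Regular.estimate_next (hP : P.Regular) {s : State n} (hs : P.Inv s) (hacc : P.Accepts s) :
    nextA s * (P.Phi (P.nextT s) + P.h (P.nextT s)) ≤
      P.phi ((alpha s, nextY s) :: s.hist) (P.nextU s) + nextA s * (P.eps / 2) := by
  have hN := hs.nextA_pos
  have ha := alpha_pos hs.L_pos
  have hA := hs.A_nonneg
  have hu := (hP.nextU_spec hs).1
  have hy := hP.nextY_mem hs
  have hsq := alpha_sq hs.L_pos hA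
  rw [phi_cons]
  have h1 := hs.growth _ hu
  have h2 := hs.estimate
  have h3 := mul_le_mul_of_nonneg_left (hP.lin_le _ hy _ hs.t_mem) hA
  have h4 : nextA s * P.lin (nextY s) (P.nextT s)
      = alpha s * P.lin (nextY s) (P.nextU s) + s.A * P.lin (nextY s) s.t :=
    lin_mix _ _ _ hN.ne' (by rw [nextA]; ring)
  have h5 : nextA s * P.h (P.nextT s) ≤ alpha s * P.h (P.nextU s) + s.A * P.h s.t := by
    have := hP.convex_h.2 hu hs.t_mem
      (div_nonneg ha.le hN.le : 0 ≤ alpha s / nextA s) (div_nonneg hA hN.le : 0 ≤ s.A / nextA s)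
      (by rw [← add_div, div_eq_one_iff_eq hN.ne', nextA]; ring)
    have he : (alpha s / nextA s) • P.nextU s + (s.A / nextA s) • s.t = P.nextT s := by
      funext e
      simp only [Pi.add_apply, Pi.smul_apply, smul_eq_mul, nextT]; ring
    rw [he] at this
    simp only [smul_eq_mul] at this
    have := mul_le_mul_of_nonneg_left this hN.le
    calc _ ≤ _ := this
      _ = _ := by field_simp
  -- Similar triangles: t' − y = (α/A')·(u' − u), since both points are mixed from the same t with
  -- the same weights. With L·α² = A' the two squared distances match.
  have h6 : nextA s * (s.L / 2 * ∑ e, (P.nextT s e - nextY s e) ^ 2)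
      = (1 / 2) * ∑ e, (P.nextU s e - s.u e) ^ 2 := by
    rw [Finset.mul_sum, Finset.mul_sum, Finset.mul_sum]
    refine Finset.sum_congr rfl fun e _ => ?_
    have : P.nextT s e - nextY s e = alpha s * (P.nextU s e - s.u e) / nextA s := by
      simp only [nextT, nextY]; ring
    rw [this]
    have : nextA s * (s.L / 2 * (alpha s * (P.nextU s e - s.u e) / nextA s) ^ 2)
        = (s.L * alpha s ^ 2) * (P.nextU s e - s.u e) ^ 2 / (2 * nextA s) := by
      field_simp
    rw [this, hsq]; field_simp
  have h7 : nextA s * (alpha s / (2 * nextA s) * P.eps) = alpha s * (P.eps / 2) := by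
    field_simp
  have h8 := mul_le_mul_of_nonneg_left hacc hN.le
  have h9 : nextA s * (P.eps / 2) = s.A * (P.eps / 2) + alpha s * (P.eps / 2) := by
    rw [nextA]; ring
  rw [mul_add, mul_add, h4, h6, h7] at h8
  rw [mul_add] at h2 ⊢
  rw [h9]
  linarith

theorem Regular.inv_step (hP : P.Regular) {s : State n} (hs : P.Inv s) : P.Inv (P.step s) := by
  unfold step
  split_ifs with hacc
  · exact
      { L_pos := half_pos hs.L_pos
        A_eq := by simp [nextA, hs.A_eq, add_comm]
        hist_pos := by
          intro q hq
          rcases List.mem_cons.mp hq with rfl | hq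
          · exact ⟨alpha_pos hs.L_pos, hP.nextY_mem hs⟩
          · exact hs.hist_pos q hq
        u_mem := (hP.nextU_spec hs).1
        t_mem := hP.nextT_mem hs
        growth := (hP.nextU_spec hs).2
        estimate := hP.estimate_next hs hacc }
  · exact
      { L_pos := by have := hs.L_pos; simpa using this
        A_eq := hs.A_eq
        hist_pos := hs.hist_pos
        u_mem := hs.u_mem
        t_mem := hs.t_mem
        growth := hs.growth
        estimate := hs.estimate }

theorem state_succ (m : ℕ) : P.state (m + 1) = P.step (P.state m) :=
  Function.iterate_succ_apply' _ _ _

theorem Regular.inv_state (hP : P.Regular) (m : ℕ) : P.Inv (P.state m) := by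
  induction m with
  | zero => exact hP.inv_start
  | succ m ih => rw [state_succ]; exact hP.inv_step ih

theorem step_of_accepts {s : State n} (h : P.Accepts s) : P.step s =
    { hist := (alpha s, nextY s) :: s.hist, L := s.L / 2, A := nextA s, u := P.nextU s,
      t := P.nextT s } := if_pos h

theorem step_of_not_accepts {s : State n} (h : ¬ P.Accepts s) :
    P.step s = { s with L := 2 * s.L } := if_neg h

/-! ### Counting trials and the growth of the total weight A -/

/-- An acceptance halves L and a rejection doubles it, so both multiply the left side by 2. This is
what bounds the rejected trials by the accepted ones. -/
theorem state_L (m : ℕ) :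
    (P.state m).L * 4 ^ (P.state m).hist.length = P.L0 * 2 ^ m := by
  induction m with
  | zero => simp [state, start]
  | succ m ih =>
    rw [state_succ]
    by_cases h : P.Accepts (P.state m)
    · rw [step_of_accepts h]
      simp only [List.length_cons, pow_succ]
      linarith
    · rw [step_of_not_accepts h]
      simp only [pow_succ]
      linarith

theorem hist_length_succ_le (m : ℕ) :
    (P.state (m + 1)).hist.length ≤ (P.state m).hist.length + 1 := by
  rw [state_succ]
  by_cases h : P.Accepts (P.state m)
  · rw [step_of_accepts h]; simp
  · rw [step_of_not_accepts h]; simp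

theorem Regular.trials_eq (hP : P.Regular) (m : ℕ) :
    (m : ℝ) * Real.log 2 = 2 * (P.state m).hist.length * Real.log 2
      + Real.log ((P.state m).L / P.L0) := by
  have hL := (hP.inv_state m).L_pos
  have h := congrArg Real.log (state_L (P := P) m)
  rw [Real.log_mul hL.ne' (by positivity), Real.log_mul hP.L0_pos.ne' (by positivity),
    Real.log_pow, Real.log_pow, show (4 : ℝ) = 2 ^ 2 by norm_num, Real.log_pow] at h
  rw [Real.log_div hL.ne' hP.L0_pos.ne']
  push_cast at h
  linarith

theorem Regular.trials_le (hP : P.Regular) {m : ℕ} {x : ℝ} (hx : 0 ≤ x)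
    (hL : Real.log ((P.state m).L / P.L0) ≤ x) :
    (m : ℝ) ≤ 2 * (P.state m).hist.length + 2 * x := by
  have h := hP.trials_eq m
  have h2 : (1 / 2 : ℝ) ≤ Real.log 2 := by linarith [Real.log_two_gt_d9]
  have : (m : ℝ) * Real.log 2 ≤ (2 * (P.state m).hist.length + 2 * x) * Real.log 2 := by
    nlinarith
  exact le_of_mul_le_mul_right this (by linarith)

theorem exp_half_le_two_pow (a : ℕ) : Real.exp (a / 2 : ℝ) ≤ 2 ^ a := by
  rw [← Real.le_log_iff_exp_le (by positivity), Real.log_pow]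
  have h2 : (1 / 2 : ℝ) ≤ Real.log 2 := by linarith [Real.log_two_gt_d9]
  nlinarith [(Nat.cast_nonneg a : (0 : ℝ) ≤ a)]

/-- The base 4/3 is the rate at which α grows over accepted trials in `Regular.alpha_ge`. -/
theorem exp_quarter_le_pow (a : ℕ) : Real.exp (a / 4 : ℝ) ≤ (4 / 3 : ℝ) ^ a := by
  rw [← Real.le_log_iff_exp_le (by positivity), Real.log_pow]
  have h2 : (1 / 4 : ℝ) ≤ Real.log (4 / 3) := by
    have := Real.one_sub_inv_le_log_of_pos (show (0 : ℝ) < 4 / 3 by norm_num)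
    norm_num at this ⊢; linarith
  nlinarith [(Nat.cast_nonneg a : (0 : ℝ) ≤ a)]

/-- A rejection needs L < Lip and leaves L < 2·Lip; before the first rejection L is halved by every
trial. Each alternative is preserved by acceptance. -/
theorem Regular.L_le_of_smooth (hP : P.Regular) {Lip : ℝ} (hLip : 0 < Lip)
    (hacc : ∀ s, P.Inv s → Lip ≤ s.L → P.Accepts s) (m : ℕ) :
    (P.state m).L ≤ max (P.L0 / 2 ^ (P.state m).hist.length) (2 * Lip) := by
  induction m with
  | zero => simp [state, start]
  | succ m ih =>
    have hs := hP.inv_state m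
    rw [state_succ]
    by_cases h : P.Accepts (P.state m)
    · rw [step_of_accepts h]
      simp only [List.length_cons, pow_succ]
      rcases le_max_iff.mp ih with h1 | h1
      · refine le_max_of_le_left ?_
        rw [← div_div]; linarith
      · exact le_max_of_le_right (by linarith)
    · rw [step_of_not_accepts h]
      have : (P.state m).L < Lip := by
        by_contra hc; exact h (hacc _ hs (not_lt.mp hc))
      exact le_max_of_le_right (by simpa using this.le)

/-- After about 2|log(L₀/Lip)| accepted trials L is at most 2·Lip. From then on an accepted trial
has A' − A = α = √(A'/L), and A' − A ≤ 2√A'·(√A' − √A), so √A rises by at least 1/(2√L). The summand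
1 pays for the iteration that crosses the threshold. -/
theorem Regular.sqrt_A_ge (hP : P.Regular) {Lip : ℝ} (hLip : 0 < Lip)
    (hacc : ∀ s, P.Inv s → Lip ≤ s.L → P.Accepts s) (m : ℕ) :
    ((P.state m).hist.length - (1 + 2 * |Real.log (P.L0 / Lip)|)) / (2 * Real.sqrt (2 * Lip))
      ≤ Real.sqrt (P.state m).A := by
  have hq : 0 < 2 * Real.sqrt (2 * Lip) := by positivity
  induction m with
  | zero =>
    refine le_trans ?_ (Real.sqrt_nonneg _)
    refine div_nonpos_of_nonpos_of_nonneg ?_ hq.le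
    simp only [state, start, Function.iterate_zero, id, List.length_nil, Nat.cast_zero]
    linarith [abs_nonneg (Real.log (P.L0 / Lip))]
  | succ m ih =>
    have hs := hP.inv_state m
    have hLm := hP.L_le_of_smooth hLip hacc m
    rw [state_succ]
    by_cases h : P.Accepts (P.state m)
    · rw [step_of_accepts h]
      set s := P.state m with hsdef
      simp only [List.length_cons, Nat.cast_add, Nat.cast_one]
      by_cases hc : (s.hist.length : ℝ) < 2 * |Real.log (P.L0 / Lip)|
      · refine le_trans ?_ (Real.sqrt_nonneg _)
        exact div_nonpos_of_nonpos_of_nonneg (by linarith) hq.le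
      · have hL2 : s.L ≤ 2 * Lip := by
          rcases le_max_iff.mp hLm with h1 | h1
          · have h2 : P.L0 / Lip ≤ 2 ^ s.hist.length := by
              refine le_trans ?_ (exp_half_le_two_pow _)
              rw [← Real.log_le_iff_le_exp (div_pos hP.L0_pos hLip)]
              linarith [le_abs_self (Real.log (P.L0 / Lip))]
            rw [div_le_iff₀ hLip] at h2
            have : P.L0 / 2 ^ s.hist.length ≤ Lip := by
              rw [div_le_iff₀ (by positivity)]; linarith
            linarith
          · exact h1
        have ha := alpha_pos hs.L_pos
        have hsq := alpha_sq hs.L_pos hs.A_nonneg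
        have h1 : Real.sqrt (nextA s) = Real.sqrt s.L * alpha s := by
          rw [← hsq, Real.sqrt_mul hs.L_pos.le, Real.sqrt_sq ha.le]
        have h2 : Real.sqrt s.A ≤ Real.sqrt (nextA s) :=
          Real.sqrt_le_sqrt (by rw [nextA]; linarith)
        have h3 : alpha s = (Real.sqrt (nextA s) - Real.sqrt s.A)
            * (Real.sqrt (nextA s) + Real.sqrt s.A) := by
          have e1 := Real.sq_sqrt hs.A_nonneg
          have e2 := Real.sq_sqrt hs.nextA_pos.le
          have e3 : nextA s = s.A + alpha s := rfl
          nlinarith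
        have hsl : 0 < Real.sqrt s.L := Real.sqrt_pos.mpr hs.L_pos
        have h4 : 1 ≤ (Real.sqrt (nextA s) - Real.sqrt s.A) * (2 * Real.sqrt s.L) := by
          have : alpha s * 1 ≤ alpha s * ((Real.sqrt (nextA s) - Real.sqrt s.A)
              * (2 * Real.sqrt s.L)) := by
            calc alpha s * 1 = (Real.sqrt (nextA s) - Real.sqrt s.A)
                  * (Real.sqrt (nextA s) + Real.sqrt s.A) := by rw [mul_one]; exact h3
              _ ≤ (Real.sqrt (nextA s) - Real.sqrt s.A)
                  * (Real.sqrt (nextA s) + Real.sqrt (nextA s)) := by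
                gcongr
              _ = _ := by rw [← two_mul, h1]; ring
          exact le_of_mul_le_mul_left this ha
        have h5 : 1 / (2 * Real.sqrt (2 * Lip)) ≤ Real.sqrt (nextA s) - Real.sqrt s.A := by
          rw [div_le_iff₀ hq]
          refine h4.trans ?_
          have := Real.sqrt_le_sqrt hL2
          gcongr
        have h6 : (s.hist.length + 1 - (1 + 2 * |Real.log (P.L0 / Lip)|))
              / (2 * Real.sqrt (2 * Lip))
            = (s.hist.length - (1 + 2 * |Real.log (P.L0 / Lip)|)) / (2 * Real.sqrt (2 * Lip))
              + 1 / (2 * Real.sqrt (2 * Lip)) := by ring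
        rw [h6]; linarith
    · rw [step_of_not_accepts h]; exact ih

/-- The number of trials if every `L ≥ Lip` is accepted. -/
theorem Regular.trials_le_smooth (hP : P.Regular) {Lip X : ℝ} (hLip : 0 < Lip)
    (hacc : ∀ s, P.Inv s → Lip ≤ s.L → P.Accepts s) {m : ℕ}
    (hX : ∀ k < m, (P.state k).A ≤ X) :
    (m : ℝ) ≤ 16 * (1 + |Real.log (P.L0 / Lip)| + Real.sqrt (Lip * X)) := by
  set l := |Real.log (P.L0 / Lip)| with hl
  have hl0 : 0 ≤ l := abs_nonneg _
  have hr0 := Real.sqrt_nonneg (Lip * X)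
  have hL : Real.log ((P.state m).L / P.L0) ≤ 1 + l := by
    have hp := (hP.inv_state m).L_pos
    have hL0 := hP.L0_pos
    rcases le_max_iff.mp (hP.L_le_of_smooth hLip hacc m) with h | h
    · have : (P.state m).L / P.L0 ≤ 1 := by
        rw [div_le_one hL0]
        exact h.trans (div_le_self hL0.le (one_le_pow₀ (by norm_num)))
      linarith [Real.log_nonpos (div_pos hp hL0).le this]
    · have h1 : (P.state m).L / P.L0 ≤ 2 * (P.L0 / Lip)⁻¹ := by
        rw [inv_div, ← mul_div_assoc]; gcongr
      have h2 := Real.log_le_log (div_pos hp hL0) h1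
      rw [Real.log_mul (by norm_num) (by positivity), Real.log_inv] at h2
      linarith [neg_abs_le (Real.log (P.L0 / Lip)), Real.log_two_lt_d9]
  have h1 := hP.trials_le (by linarith) hL
  cases m with
  | zero => simp only [Nat.cast_zero]; positivity
  | succ m =>
    have h2 : ((P.state (m + 1)).hist.length : ℝ) ≤ (P.state m).hist.length + 1 := by
      exact_mod_cast hist_length_succ_le m
    have h3 := hP.sqrt_A_ge hLip hacc m
    -- The bound on A is only assumed before the last trial; the last trial adds at most one
    -- accepted iteration.
    have hAX := hX m (Nat.lt_succ_self m)
    have hX0 := (hP.inv_state m).A_nonneg.trans hAX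
    have h4 := h3.trans (Real.sqrt_le_sqrt hAX)
    rw [div_le_iff₀ (by positivity), Real.sqrt_mul (by norm_num : (0 : ℝ) ≤ 2)] at h4
    have h5 : Real.sqrt X * (2 * (Real.sqrt 2 * Real.sqrt Lip))
        = 2 * Real.sqrt 2 * Real.sqrt (Lip * X) := by
      rw [Real.sqrt_mul hLip.le]; ring
    have h6 : Real.sqrt 2 ≤ 2 := by
      rw [Real.sqrt_le_left (by norm_num)]; norm_num
    have h7 : 2 * Real.sqrt 2 * Real.sqrt (Lip * X) ≤ 2 * 2 * Real.sqrt (Lip * X) := by gcongr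
    rw [h5] at h4
    push_cast at h1 ⊢
    linarith

/-- An acceptance multiplies α by at least √2 ≥ 4/3, because A'/(L/2) = 2α². A rejection requires α
> ε/K, and doubling L at most halves α. The initial value is α = 1/L₀. -/
theorem Regular.alpha_ge (hP : P.Regular) {K : ℝ} (hK : 0 < K)
    (hacc : ∀ s, P.Inv s → alpha s * K ≤ P.eps → P.Accepts s) (m : ℕ) :
    min ((4 / 3) ^ (P.state m).hist.length / P.L0) (P.eps / (2 * K)) ≤ alpha (P.state m) := by
  induction m with
  | zero =>
    refine min_le_of_left_le ?_
    have hL0 := hP.L0_pos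
    have : Real.sqrt (1 / (4 * P.L0 ^ 2)) = 1 / (2 * P.L0) := by
      rw [show 1 / (4 * P.L0 ^ 2) = (1 / (2 * P.L0)) ^ 2 by field_simp; ring]
      exact Real.sqrt_sq (by positivity)
    simp only [state, start, alpha, Function.iterate_zero, id, List.length_nil, pow_zero,
      zero_div, add_zero, this]
    apply le_of_eq; field_simp; ring
  | succ m ih =>
    have hs := hP.inv_state m
    rw [state_succ]
    set s := P.state m with hsdef
    have hL := hs.L_pos
    have hA := hs.A_nonneg
    have ha := alpha_pos hL
    by_cases h : P.Accepts s
    · have hsq := alpha_sq hL hA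
      have key : 4 / 3 * alpha s ≤ alpha (P.step s) := by
        rw [step_of_accepts h]
        have h2 : (4 / 3 * alpha s) ≤ Real.sqrt (1 / (4 * (s.L / 2) ^ 2) + nextA s / (s.L / 2)) := by
          apply Real.le_sqrt_of_sq_le
          have : nextA s / (s.L / 2) = 2 * alpha s ^ 2 := by rw [← hsq]; field_simp
          rw [this]
          have : 0 ≤ 1 / (4 * (s.L / 2) ^ 2) := by positivity
          nlinarith
        have : 0 ≤ 1 / (2 * (s.L / 2)) := by positivity
        exact h2.trans (le_add_of_nonneg_left this)
      refine le_trans ?_ key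
      have hlen : (P.step s).hist.length = s.hist.length + 1 := by rw [step_of_accepts h]; simp
      rw [hlen]
      rcases min_le_iff.mp ih with h1 | h1
      · refine min_le_of_left_le ?_
        rw [pow_succ]
        calc (4 / 3 : ℝ) ^ s.hist.length * (4 / 3) / P.L0
            = 4 / 3 * ((4 / 3) ^ s.hist.length / P.L0) := by ring
          _ ≤ _ := by gcongr
      · exact min_le_of_right_le (by linarith)
    · have h1 : P.eps / K < alpha s := by
        rw [div_lt_iff₀ hK]
        by_contra hc; exact h (hacc s hs (not_lt.mp hc))
      refine min_le_of_right_le ?_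
      rw [step_of_not_accepts h]
      have h2 : alpha s / 2 ≤ alpha { s with L := 2 * s.L } := by
        unfold alpha
        simp only
        have : Real.sqrt (1 / (4 * s.L ^ 2) + s.A / s.L) / 2
            ≤ Real.sqrt (1 / (4 * (2 * s.L) ^ 2) + s.A / (2 * s.L)) := by
          apply Real.le_sqrt_of_sq_le
          rw [div_pow, Real.sq_sqrt (by positivity)]
          have : 1 / (4 * (2 * s.L) ^ 2) + s.A / (2 * s.L)
              - (1 / (4 * s.L ^ 2) + s.A / s.L) / 2 ^ 2 = s.A / (4 * s.L) := by
            field_simp; ring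
          have h0 : 0 ≤ s.A / (4 * s.L) := by positivity
          linarith
        have e : 1 / (2 * (2 * s.L)) = 1 / (2 * s.L) / 2 := by field_simp
        rw [e]; linarith
      have : P.eps / (2 * K) = P.eps / K / 2 := by field_simp
      rw [this]; linarith

/-- Once (4/3) to the number of accepted trials exceeds L₀·ε/(2K), each further accepted trial adds
at least ε/(2K) to A. The earlier trials are covered by the logarithm. -/
theorem Regular.A_ge (hP : P.Regular) {K : ℝ} (hK : 0 < K)
    (hacc : ∀ s, P.Inv s → alpha s * K ≤ P.eps → P.Accepts s) (m : ℕ) :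
    ((P.state m).hist.length - (1 + 4 * |Real.log (P.L0 * (P.eps / (2 * K)))|))
      * (P.eps / (2 * K)) ≤ (P.state m).A := by
  have he : 0 < P.eps / (2 * K) := div_pos hP.eps_pos (by linarith)
  set l := |Real.log (P.L0 * (P.eps / (2 * K)))| with hl
  have hl0 : 0 ≤ l := abs_nonneg _
  induction m with
  | zero =>
    simp only [state, start, Function.iterate_zero, id, List.length_nil, Nat.cast_zero]
    nlinarith
  | succ m ih =>
    have hs := hP.inv_state m
    have hal := hP.alpha_ge hK hacc m
    rw [state_succ]
    by_cases h : P.Accepts (P.state m)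
    · rw [step_of_accepts h]
      set s := P.state m with hsdef
      simp only [List.length_cons, Nat.cast_add, Nat.cast_one, nextA]
      have ha := alpha_pos hs.L_pos
      by_cases hc : (s.hist.length : ℝ) < 4 * l
      · have := hs.A_nonneg
        nlinarith
      · have : P.eps / (2 * K) ≤ alpha s := by
          rcases min_le_iff.mp hal with h1 | h1
          · refine le_trans ?_ h1
            rw [le_div_iff₀ hP.L0_pos, mul_comm]
            refine le_trans ?_ (exp_quarter_le_pow _)
            rw [← Real.log_le_iff_le_exp (mul_pos hP.L0_pos he)]
            linarith [le_abs_self (Real.log (P.L0 * (P.eps / (2 * K))))]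
          · exact h1
        linarith
    · rw [step_of_not_accepts h]; exact ih

/-- A rejected trial has α > ε/K, while L·α² = A + α expresses L through 1/α and A. So bounded A
bounds L at every rejection. -/
theorem Regular.L_le_of_nonsmooth (hP : P.Regular) {K X : ℝ} (hK : 0 < K)
    (hacc : ∀ s, P.Inv s → alpha s * K ≤ P.eps → P.Accepts s) {m : ℕ}
    (hX : ∀ k < m, (P.state k).A ≤ X) :
    (P.state m).L ≤ max P.L0 (2 * (K / P.eps * (1 + K * X / P.eps))) := by
  induction m with
  | zero => simp [state, start]
  | succ m ih =>
    have hs := hP.inv_state m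
    have ih := ih fun k hk => hX k (hk.trans (Nat.lt_succ_self m))
    rw [state_succ]
    set s := P.state m with hsdef
    have hL := hs.L_pos
    by_cases h : P.Accepts s
    · rw [step_of_accepts h]
      refine le_trans ?_ ih
      simp only; linarith
    · rw [step_of_not_accepts h]
      refine le_max_of_le_right ?_
      have ha := alpha_pos hL
      have h1 : P.eps / K < alpha s := by
        rw [div_lt_iff₀ hK]
        by_contra hc; exact h (hacc s hs (not_lt.mp hc))
      have hsq := alpha_sq hL hs.A_nonneg
      have hAX := hX m (Nat.lt_succ_self m)
      have hi : (alpha s)⁻¹ ≤ K / P.eps := by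
        rw [← inv_div]; exact inv_anti₀ (div_pos hP.eps_pos hK) h1.le
      have h2 : s.L = (alpha s)⁻¹ * (1 + (alpha s)⁻¹ * s.A) := by
        have : s.L = nextA s / alpha s ^ 2 := by rw [← hsq]; field_simp
        rw [this, nextA]; field_simp; ring
      have h3 : s.L ≤ K / P.eps * (1 + K * X / P.eps) := by
        rw [h2]
        have h0 : 0 ≤ (alpha s)⁻¹ := by positivity
        have hA := hs.A_nonneg
        have hKe : 0 ≤ K / P.eps := (div_pos hK hP.eps_pos).le
        have : (alpha s)⁻¹ * s.A ≤ K * X / P.eps := by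
          calc _ ≤ K / P.eps * X := by gcongr
            _ = _ := by ring
        gcongr
      simp only; linarith

/-- The number of trials if every `α ≤ ε / K` is accepted. -/
theorem Regular.trials_le_nonsmooth (hP : P.Regular) {K X : ℝ} (hK : 0 < K) (hX0 : 0 ≤ X)
    (hacc : ∀ s, P.Inv s → alpha s * K ≤ P.eps → P.Accepts s) {m : ℕ}
    (hX : ∀ k < m, (P.state k).A ≤ X) :
    (m : ℝ) ≤ 20 * (1 + |Real.log (P.L0 * P.eps / K)| + K * X / P.eps) := by
  set l := |Real.log (P.L0 * P.eps / K)| with hl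
  have hl0 : 0 ≤ l := abs_nonneg _
  have hL0 := hP.L0_pos
  have he := hP.eps_pos
  have hr0 : 0 ≤ K * X / P.eps := by positivity
  have hll : |Real.log (P.L0 * (P.eps / (2 * K)))| ≤ l + 1 := by
    have : P.L0 * (P.eps / (2 * K)) = (P.L0 * P.eps / K) / 2 := by field_simp
    rw [this, Real.log_div (by positivity) (by norm_num)]
    refine (abs_sub _ _).trans ?_
    rw [abs_of_pos (Real.log_pos one_lt_two)]
    linarith [Real.log_two_lt_d9]
  have hL : Real.log ((P.state m).L / P.L0) ≤ 1 + l + K * X / P.eps := by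
    have hp := (hP.inv_state m).L_pos
    rcases le_max_iff.mp (hP.L_le_of_nonsmooth hK hacc hX) with h | h
    · have : (P.state m).L / P.L0 ≤ 1 := by rwa [div_le_one hL0]
      linarith [Real.log_nonpos (div_pos hp hL0).le this]
    · have h1 : (P.state m).L / P.L0 ≤ 2 * (P.L0 * P.eps / K)⁻¹ * (1 + K * X / P.eps) := by
        rw [div_le_iff₀ hL0, inv_div]
        refine h.trans (le_of_eq ?_)
        field_simp
      have h2 := Real.log_le_log (div_pos hp hL0) h1
      rw [Real.log_mul (by positivity) (by positivity), Real.log_mul (by norm_num) (by positivity),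
        Real.log_inv] at h2
      -- By log(1 + z) ≤ z the final value of L contributes no more than the main term of the rate.
      have h3 := Real.log_le_sub_one_of_pos (show 0 < 1 + K * X / P.eps by linarith)
      linarith [neg_abs_le (Real.log (P.L0 * P.eps / K)), Real.log_two_lt_d9]
  have h1 := hP.trials_le (by linarith) hL
  cases m with
  | zero => simp only [Nat.cast_zero]; linarith
  | succ m =>
    have h2 : ((P.state (m + 1)).hist.length : ℝ) ≤ (P.state m).hist.length + 1 := by
      exact_mod_cast hist_length_succ_le m
    have h3 := (hP.A_ge hK hacc m).trans (hX m (Nat.lt_succ_self m))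
    rw [← le_div_iff₀ (by positivity)] at h3
    have h4 : X / (P.eps / (2 * K)) = 2 * (K * X / P.eps) := by field_simp
    rw [h4] at h3
    push_cast at h1 ⊢
    linarith

end Composite

end Traffic

/-! ### The potential Φ: smoothness, duality with route flows, and its subgradients -/

namespace Traffic

/-- Hoeffding's bound for the exponential moment of a bounded random variable on a finite set. -/
theorem sum_mul_exp_le {ι : Type*} (s : Finset ι) (q X : ι → ℝ) {b : ℝ} (hb : 0 ≤ b)
    (hq : ∀ i ∈ s, 0 ≤ q i) (hq1 : ∑ i ∈ s, q i = 1) (hX : ∀ i ∈ s, |X i| ≤ b) :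
    ∑ i ∈ s, q i * Real.exp (X i) ≤ Real.exp (∑ i ∈ s, q i * X i + 2 * b ^ 2) := by
  set m := ∑ i ∈ s, q i * X i with hm
  have hmb : |m| ≤ b := by
    refine (Finset.abs_sum_le_sum_abs _ _).trans ?_
    calc ∑ i ∈ s, |q i * X i| ≤ ∑ i ∈ s, q i * b := by
          refine Finset.sum_le_sum fun i hi => ?_
          rw [abs_mul, abs_of_nonneg (hq i hi)]
          exact mul_le_mul_of_nonneg_left (hX i hi) (hq i hi)
      _ = b := by rw [← Finset.sum_mul, hq1, one_mul]
  rcases hb.eq_or_lt with rfl | hb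
  · have hX0 : ∀ i ∈ s, X i = 0 := fun i hi => abs_nonpos_iff.mp (hX i hi)
    have hm0 : m = 0 := abs_nonpos_iff.mp hmb
    rw [hm0, Finset.sum_congr rfl fun i hi => by rw [hX0 i hi, Real.exp_zero, mul_one], hq1]
    simp
  -- The deviation from the mean lies in [−2b, 2b], where exp is below its chord. The linear part of
  -- the chord averages to zero and cosh(2b) ≤ exp(2b²) remains. The cruder range 2b around the mean
  -- is the source of the factor 4 in the Lipschitz constant 4Hd/γ.
  · have key : ∀ i ∈ s, q i * Real.exp (X i) ≤
        Real.exp m * (q i * Real.cosh (2 * b)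
          + (q i * X i - q i * m) * (Real.sinh (2 * b) / (2 * b))) := by
      intro i hi
      have h1 : |(X i - m) / (2 * b)| ≤ 1 := by
        rw [abs_div, abs_of_pos (by linarith : 0 < 2 * b), div_le_one (by linarith)]
        have := abs_sub (X i) m
        linarith [hX i hi]
      have h2 := Real.exp_mul_le_cosh_add_mul_sinh h1 (2 * b)
      rw [div_mul_cancel₀ _ (by linarith : (2 * b) ≠ 0)] at h2
      have h3 : Real.exp (X i) = Real.exp m * Real.exp (X i - m) := by
        rw [← Real.exp_add]; ring_nf
      rw [h3]
      calc q i * (Real.exp m * Real.exp (X i - m))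
          = Real.exp m * (q i * Real.exp (X i - m)) := by ring
        _ ≤ Real.exp m * (q i * (Real.cosh (2 * b) + (X i - m) / (2 * b) * Real.sinh (2 * b))) :=
          mul_le_mul_of_nonneg_left (mul_le_mul_of_nonneg_left h2 (hq i hi)) (Real.exp_pos _).le
        _ = _ := by ring
    refine (Finset.sum_le_sum key).trans ?_
    rw [← Finset.mul_sum, Finset.sum_add_distrib, ← Finset.sum_mul, ← Finset.sum_mul,
      Finset.sum_sub_distrib, ← Finset.sum_mul, hq1, ← hm, Real.exp_add]
    have := Real.cosh_le_exp_half_sq (2 * b)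
    have h4 : Real.exp ((2 * b) ^ 2 / 2) = Real.exp (2 * b ^ 2) := by ring_nf
    rw [h4] at this
    have : 1 * Real.cosh (2 * b) + (m - 1 * m) * (Real.sinh (2 * b) / (2 * b))
        ≤ Real.exp (2 * b ^ 2) := by linarith
    exact mul_le_mul_of_nonneg_left this (Real.exp_pos _).le

section Potential

variable {v n : ℕ} (N : Network v n) (D : Data v n)

theorem sum_edgeFlow_mul (x : Fin v × Fin v → List (Fin n) → ℝ) (s : Fin n → ℝ) :
    ∑ e, edgeFlow N x e * s e = ∑ w ∈ N.od, ∑ p ∈ N.routes w, x w p * routeCost s p := by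
  simp only [edgeFlow, Finset.sum_mul, routeCost, Finset.mul_sum]
  rw [Finset.sum_comm]
  refine Finset.sum_congr rfl fun w _ => ?_
  rw [Finset.sum_comm]
  exact Finset.sum_congr rfl fun p _ => Finset.sum_congr rfl fun e _ => by ring

theorem routeCost_sub (s t : Fin n → ℝ) (p : List (Fin n)) :
    routeCost (fun e => s e - t e) p = routeCost s p - routeCost t p := by
  simp only [routeCost, mul_sub, Finset.sum_sub_distrib]

/-- Cauchy–Schwarz with a column of the incidence matrix, whose squared norm is at most H by
definition. -/
theorem abs_routeCost_le {w : Fin v × Fin v} (hw : w ∈ N.od) {p : List (Fin n)}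
    (hp : p ∈ N.routes w) (s : Fin n → ℝ) :
    |routeCost s p| ≤ Real.sqrt N.H * Real.sqrt (∑ e, s e ^ 2) := by
  rw [← Real.sqrt_mul (Nat.cast_nonneg _)]
  refine Real.abs_le_sqrt ?_
  refine (Finset.sum_mul_sq_le_sq_mul_sq _ _ _).trans ?_
  refine mul_le_mul_of_nonneg_right ?_ (Finset.sum_nonneg fun e _ => sq_nonneg _)
  have h1 : ∑ e : Fin n, (p.count e) ^ 2 ≤ N.H :=
    (Finset.le_sup (f := fun p : List (Fin n) => ∑ e : Fin n, (p.count e) ^ 2) hp).trans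
      (Finset.le_sup (f := fun w => (N.routes w).sup
        fun p : List (Fin n) => ∑ e : Fin n, (p.count e) ^ 2) hw)
  have : ((∑ e : Fin n, (p.count e) ^ 2 : ℕ) : ℝ) ≤ N.H := by exact_mod_cast h1
  simpa [theta] using this

variable {N D} in
theorem abs_sum_edgeFlow_le {x : Fin v × Fin v → List (Fin n) → ℝ} (hx : x ∈ FlowSet N D)
    (s : Fin n → ℝ) : |∑ e, edgeFlow N x e * s e| ≤
      totalDemand N D * (Real.sqrt N.H * Real.sqrt (∑ e, s e ^ 2)) := by
  rw [sum_edgeFlow_mul, totalDemand, Finset.sum_mul]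
  refine (Finset.abs_sum_le_sum_abs _ _).trans (Finset.sum_le_sum fun w hw => ?_)
  refine (Finset.abs_sum_le_sum_abs _ _).trans ?_
  rw [← (hx w hw).2, Finset.sum_mul]
  refine Finset.sum_le_sum fun p hp => ?_
  rw [abs_mul, abs_of_nonneg ((hx w hw).1 p hp)]
  exact mul_le_mul_of_nonneg_left (abs_routeCost_le N hw hp s) ((hx w hw).1 p hp)

/-- The normalizing sum `∑_{p ∈ P_w} exp (-g_p(t) / γ)`. -/
def partition (t : Fin n → ℝ) (w : Fin v × Fin v) : ℝ :=
  ∑ q ∈ N.routes w, Real.exp (-routeCost t q / D.gamma)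

theorem partition_pos (t : Fin n → ℝ) {w : Fin v × Fin v} (hw : w ∈ N.od) :
    0 < partition N D t w :=
  Finset.sum_pos (fun _ _ => Real.exp_pos _) (N.routes_nonempty w hw)

variable {D} in
theorem potential_of_pos (hg : 0 < D.gamma) (t : Fin n → ℝ) :
    potential N D t = D.gamma * ∑ w ∈ N.od, D.dem w * Real.log (partition N D t w) := by
  rw [potential, if_neg hg.ne', psi]
  have : ∀ p : List (Fin n), -routeCost (fun e => t e / D.gamma) p = -routeCost t p / D.gamma := by
    intro p
    simp only [routeCost, ← mul_div_assoc, ← Finset.sum_div, neg_div]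
  simp only [this, partition]

variable {D}

theorem logitFlow_pos (hd : ∀ w ∈ N.od, 0 < D.dem w) (t : Fin n → ℝ) {w : Fin v × Fin v}
    (hw : w ∈ N.od) (p : List (Fin n)) : 0 < logitFlow N D t w p :=
  div_pos (mul_pos (hd w hw) (Real.exp_pos _)) (partition_pos N D t hw)

theorem logitFlow_mem (hd : ∀ w ∈ N.od, 0 < D.dem w) (t : Fin n → ℝ) :
    logitFlow N D t ∈ FlowSet N D := by
  intro w hw
  refine ⟨fun p _ => (logitFlow_pos N hd t hw p).le, ?_⟩
  have hZ := partition_pos N D t hw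
  simp only [logitFlow]
  rw [← Finset.sum_div, ← Finset.mul_sum]
  exact mul_div_cancel_right₀ _ hZ.ne'

/-- The entropy duality for the logit flow. -/
theorem potential_add_logit (hg : 0 < D.gamma) (hd : ∀ w ∈ N.od, 0 < D.dem w) (t : Fin n → ℝ) :
    potential N D t + ∑ e, edgeFlow N (logitFlow N D t) e * t e
      = -(D.gamma * entropy N D (logitFlow N D t)) := by
  rw [potential_of_pos N hg, sum_edgeFlow_mul, entropy, Finset.mul_sum, Finset.mul_sum,
    ← Finset.sum_add_distrib, ← Finset.sum_neg_distrib]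
  refine Finset.sum_congr rfl fun w hw => ?_
  have hZ := partition_pos N D t hw
  have hdw := hd w hw
  have hlog : ∀ p, Real.log (logitFlow N D t w p / D.dem w)
      = -routeCost t p / D.gamma - Real.log (partition N D t w) := by
    intro p
    have : logitFlow N D t w p / D.dem w
        = Real.exp (-routeCost t p / D.gamma) / partition N D t w := by
      rw [logitFlow, partition]; field_simp
    rw [this, Real.log_div (Real.exp_pos _).ne' hZ.ne', Real.log_exp]
  have hs := (logitFlow_mem N hd t w hw).2
  simp only [hlog, mul_sub, Finset.sum_sub_distrib]
  rw [← Finset.sum_mul, hs]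
  have : D.gamma * ∑ p ∈ N.routes w, logitFlow N D t w p * (-routeCost t p / D.gamma)
      = -∑ p ∈ N.routes w, logitFlow N D t w p * routeCost t p := by
    rw [Finset.mul_sum, ← Finset.sum_neg_distrib]
    refine Finset.sum_congr rfl fun p _ => ?_
    field_simp
  rw [this]; ring

/-- The Gibbs variational principle: Φ is the maximum of the left side over route flows, and
`potential_add_logit` is the case of equality. -/
theorem neg_edgeFlow_le_potential_of_pos (hg : 0 < D.gamma) (hd : ∀ w ∈ N.od, 0 < D.dem w)
    {x : Fin v × Fin v → List (Fin n) → ℝ} (hx : x ∈ FlowSet N D) (t : Fin n → ℝ) :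
    -∑ e, edgeFlow N x e * t e - D.gamma * entropy N D x ≤ potential N D t := by
  rw [potential_of_pos N hg, sum_edgeFlow_mul, entropy, ← Finset.sum_neg_distrib, Finset.mul_sum,
    Finset.mul_sum, ← Finset.sum_sub_distrib]
  refine Finset.sum_le_sum fun w hw => ?_
  have hZ := partition_pos N D t hw
  have hdw := hd w hw
  -- This is log z ≤ z − 1 at the ratio z of the logit flow to x. The correction terms cancel after
  -- summation, since both flows sum to the demand. Routes with zero flow need a separate case, as
  -- the ratio is undefined there.
  have key : ∀ p ∈ N.routes w, -(x w p * routeCost t p)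
      - D.gamma * (x w p * Real.log (x w p / D.dem w)) ≤
      D.gamma * (x w p * Real.log (partition N D t w)
        + (D.dem w * Real.exp (-routeCost t p / D.gamma) / partition N D t w - x w p)) := by
    intro p hp
    rcases ((hx w hw).1 p hp).eq_or_lt with h0 | hpos
    · rw [← h0]; simp only [zero_mul, neg_zero, mul_zero, sub_zero, zero_add]
      exact mul_nonneg hg.le (div_nonneg (mul_nonneg hdw.le (Real.exp_pos _).le) hZ.le)
    · have h1 := Real.log_le_sub_one_of_pos (show 0 < D.dem w * Real.exp (-routeCost t p / D.gamma)
        / (partition N D t w * x w p) from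
          div_pos (mul_pos hdw (Real.exp_pos _)) (mul_pos hZ hpos))
      rw [Real.log_div (by positivity) (by positivity), Real.log_mul hdw.ne' (Real.exp_pos _).ne',
        Real.log_mul hZ.ne' hpos.ne', Real.log_exp] at h1
      rw [Real.log_div hpos.ne' hdw.ne']
      have h2 := mul_le_mul_of_nonneg_left h1 (mul_pos hg hpos).le
      have h3 : D.gamma * x w p * (-routeCost t p / D.gamma) = -(x w p * routeCost t p) := by
        field_simp
      have h4 : D.gamma * x w p * (D.dem w * Real.exp (-routeCost t p / D.gamma)
            / (partition N D t w * x w p) - 1)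
          = D.gamma * (D.dem w * Real.exp (-routeCost t p / D.gamma) / partition N D t w
            - x w p) := by
        field_simp
      rw [h4] at h2
      nlinarith
  rw [← Finset.sum_neg_distrib, Finset.mul_sum, ← Finset.sum_sub_distrib]
  refine (Finset.sum_le_sum key).trans ?_
  rw [← Finset.mul_sum, Finset.sum_add_distrib, Finset.sum_sub_distrib, ← Finset.sum_mul,
    (hx w hw).2, ← Finset.sum_div, ← Finset.mul_sum]
  change D.gamma * (_ + (D.dem w * partition N D t w / partition N D t w - _)) ≤ _
  rw [mul_div_cancel_right₀ _ hZ.ne', sub_self, add_zero]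

/-- For each pair, the increment of the log-partition function is the logarithm of an exponential
moment under the logit distribution. The exponent is bounded by b = √H·‖s − t‖/γ, and Hoeffding's
term 2b² times γ·d_w sums to the quadratic term. -/
theorem potential_le_of_pos (hg : 0 < D.gamma) (hd : ∀ w ∈ N.od, 0 < D.dem w)
    (t s : Fin n → ℝ) :
    potential N D s ≤ potential N D t - ∑ e, edgeFlow N (logitFlow N D t) e * (s e - t e)
      + 4 * N.H * totalDemand N D / D.gamma / 2 * ∑ e, (s e - t e) ^ 2 := by
  rw [sum_edgeFlow_mul, potential_of_pos N hg, potential_of_pos N hg, totalDemand]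
  set r := ∑ e, (s e - t e) ^ 2 with hr
  have hr0 : 0 ≤ r := Finset.sum_nonneg fun e _ => sq_nonneg _
  have key : ∀ w ∈ N.od, D.gamma * (D.dem w * Real.log (partition N D s w)) ≤
      D.gamma * (D.dem w * Real.log (partition N D t w))
        - ∑ p ∈ N.routes w, logitFlow N D t w p * routeCost (fun e => s e - t e) p
        + D.dem w * (2 * N.H * r / D.gamma) := by
    intro w hw
    have hZ := partition_pos N D t hw
    have hZs := partition_pos N D s hw
    have hdw := hd w hw
    set q : List (Fin n) → ℝ := fun p => Real.exp (-routeCost t p / D.gamma) / partition N D t w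
    set X : List (Fin n) → ℝ := fun p => -routeCost (fun e => s e - t e) p / D.gamma
    have hb : ∀ p ∈ N.routes w, |X p| ≤ Real.sqrt N.H * Real.sqrt r / D.gamma := by
      intro p hp
      simp only [X]
      rw [abs_div, abs_neg, abs_of_pos hg]
      gcongr
      exact abs_routeCost_le N hw hp _
    have hq1 : ∑ p ∈ N.routes w, q p = 1 := by
      simp only [q]
      rw [← Finset.sum_div]; exact div_self hZ.ne'
    have h := sum_mul_exp_le (N.routes w) q X
      (div_nonneg (mul_nonneg (Real.sqrt_nonneg _) (Real.sqrt_nonneg _)) hg.le)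
      (fun p _ => div_nonneg (Real.exp_pos _).le hZ.le) hq1 hb
    have h1 : ∑ p ∈ N.routes w, q p * Real.exp (X p)
        = partition N D s w / partition N D t w := by
      rw [partition, Finset.sum_div]
      refine Finset.sum_congr rfl fun p _ => ?_
      simp only [q, X]
      rw [div_mul_eq_mul_div, ← Real.exp_add, routeCost_sub]
      congr 2; ring
    have h2 : (Real.sqrt N.H * Real.sqrt r / D.gamma) ^ 2 = N.H * r / D.gamma ^ 2 := by
      rw [div_pow, mul_pow, Real.sq_sqrt (Nat.cast_nonneg _), Real.sq_sqrt hr0]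
    have h3 : D.gamma * D.dem w * ∑ p ∈ N.routes w, q p * X p
        = -∑ p ∈ N.routes w, logitFlow N D t w p * routeCost (fun e => s e - t e) p := by
      rw [Finset.mul_sum, ← Finset.sum_neg_distrib]
      refine Finset.sum_congr rfl fun p _ => ?_
      simp only [q, X, logitFlow]
      rw [← partition]; field_simp
    rw [h1, h2] at h
    have h4 := (Real.log_le_iff_le_exp (div_pos hZs hZ)).mpr h
    rw [Real.log_div hZs.ne' hZ.ne'] at h4
    have h5 := mul_le_mul_of_nonneg_left h4 (mul_pos hg hdw).le
    rw [mul_add, h3] at h5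
    have h6 : D.gamma * D.dem w * (2 * (N.H * r / D.gamma ^ 2))
        = D.dem w * (2 * N.H * r / D.gamma) := by field_simp
    rw [h6] at h5
    linarith
  rw [Finset.mul_sum, Finset.mul_sum]
  refine (Finset.sum_le_sum key).trans (le_of_eq ?_)
  rw [Finset.sum_add_distrib, Finset.sum_sub_distrib, ← Finset.sum_mul]
  ring

/-- The cost of a cheapest route. -/
def minCost (t : Fin n → ℝ) (w : Fin v × Fin v) : ℝ :=
  sInf (routeCost t '' (N.routes w : Set (List (Fin n))))

theorem potential_of_zero (hg : D.gamma = 0) (t : Fin n → ℝ) :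
    potential N D t = -∑ w ∈ N.od, D.dem w * minCost N t w := if_pos hg

theorem minCost_le (t : Fin n → ℝ) {w : Fin v × Fin v} {p : List (Fin n)}
    (hp : p ∈ N.routes w) : minCost N t w ≤ routeCost t p :=
  csInf_le (((N.routes w).finite_toSet.image _).bddBelow) ⟨p, hp, rfl⟩

theorem exists_minCost (t : Fin n → ℝ) {w : Fin v × Fin v} (hw : w ∈ N.od) :
    ∃ p ∈ N.routes w, routeCost t p = minCost N t w := by
  have hne : (routeCost t '' (N.routes w : Set (List (Fin n)))).Nonempty :=
    (N.routes_nonempty w hw).to_set.image _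
  exact hne.csInf_mem ((N.routes w).finite_toSet.image _)

theorem neg_edgeFlow_le_potential_of_zero (hg : D.gamma = 0)
    {x : Fin v × Fin v → List (Fin n) → ℝ} (hx : x ∈ FlowSet N D) (t : Fin n → ℝ) :
    -∑ e, edgeFlow N x e * t e ≤ potential N D t := by
  rw [potential_of_zero N hg, sum_edgeFlow_mul, neg_le_neg_iff]
  refine Finset.sum_le_sum fun w hw => ?_
  rw [← (hx w hw).2, Finset.sum_mul]
  exact Finset.sum_le_sum fun p hp =>
    mul_le_mul_of_nonneg_left (minCost_le N t hp) ((hx w hw).1 p hp)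

/-- Weak duality between route flows and the potential. -/
theorem neg_edgeFlow_le_potential (hg : 0 ≤ D.gamma) (hd : ∀ w ∈ N.od, 0 < D.dem w)
    {x : Fin v × Fin v → List (Fin n) → ℝ} (hx : x ∈ FlowSet N D) (t : Fin n → ℝ) :
    -∑ e, edgeFlow N x e * t e - D.gamma * entropy N D x ≤ potential N D t := by
  rcases hg.eq_or_lt with h | h
  · have := neg_edgeFlow_le_potential_of_zero N h.symm hx t
    rw [← h, zero_mul, sub_zero]; exact this
  · exact neg_edgeFlow_le_potential_of_pos N h hd hx t

/-- All the demand of each pair `w` is sent along the route `c w`. -/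
def choiceFlow (D : Data v n) (c : Fin v × Fin v → List (Fin n)) (w : Fin v × Fin v)
    (p : List (Fin n)) : ℝ := if p = c w then D.dem w else 0

theorem choiceFlow_mem (hd : ∀ w ∈ N.od, 0 < D.dem w) {c : Fin v × Fin v → List (Fin n)}
    (hc : ∀ w ∈ N.od, c w ∈ N.routes w) : choiceFlow D c ∈ FlowSet N D := by
  intro w hw
  refine ⟨fun p _ => ?_, ?_⟩
  · unfold choiceFlow; split_ifs
    · exact (hd w hw).le
    · exact le_rfl
  · simp [choiceFlow, hc w hw]

theorem edgeFlow_choiceFlow {c : Fin v × Fin v → List (Fin n)}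
    (hc : ∀ w ∈ N.od, c w ∈ N.routes w) (e : Fin n) :
    edgeFlow N (choiceFlow D c) e = ∑ w ∈ N.od, D.dem w * theta e (c w) := by
  unfold edgeFlow choiceFlow
  refine Finset.sum_congr rfl fun w hw => ?_
  simp [hc w hw, mul_comm]

theorem sum_choiceFlow_mul {c : Fin v × Fin v → List (Fin n)}
    (hc : ∀ w ∈ N.od, c w ∈ N.routes w) (s : Fin n → ℝ) :
    ∑ e, edgeFlow N (choiceFlow D c) e * s e = ∑ w ∈ N.od, D.dem w * routeCost s (c w) := by
  rw [sum_edgeFlow_mul]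
  unfold choiceFlow
  refine Finset.sum_congr rfl fun w hw => ?_
  simp [hc w hw]

theorem FlowSet.mix {x y : Fin v × Fin v → List (Fin n) → ℝ} (hx : x ∈ FlowSet N D)
    (hy : y ∈ FlowSet N D) {a b : ℝ} (ha : 0 ≤ a) (hb : 0 ≤ b) (hab : a + b = 1) :
    (fun w p => a * x w p + b * y w p) ∈ FlowSet N D := by
  intro w hw
  refine ⟨fun p hp => add_nonneg (mul_nonneg ha ((hx w hw).1 p hp))
    (mul_nonneg hb ((hy w hw).1 p hp)), ?_⟩
  simp only [Finset.sum_add_distrib, ← Finset.mul_sum, (hx w hw).2, (hy w hw).2]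
  rw [← add_mul, hab, one_mul]

theorem edgeFlow_mix (x y : Fin v × Fin v → List (Fin n) → ℝ) (a b : ℝ) (e : Fin n) :
    edgeFlow N (fun w p => a * x w p + b * y w p) e = a * edgeFlow N x e + b * edgeFlow N y e := by
  simp only [edgeFlow, mul_add, Finset.sum_add_distrib, Finset.mul_sum]
  congr 1 <;> exact Finset.sum_congr rfl fun w _ => Finset.sum_congr rfl fun p _ => by ring

/-- Minus a linear minorant of the potential (`γ = 0`) is an edge flow of route flows in `X`. -/
theorem exists_flow_of_minorant (hg : D.gamma = 0) (hd : ∀ w ∈ N.od, 0 < D.dem w)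
    {f : Fin n → ℝ} (hf : ∀ s, -∑ e, f e * s e ≤ potential N D s) :
    ∃ x ∈ FlowSet N D, ∀ e, edgeFlow N x e = f e := by
  classical
  set K : Set (Fin n → ℝ) := {g | ∃ x ∈ FlowSet N D, ∀ e, edgeFlow N x e = g e}
  -- All choices of one route per pair. Outside `od` the choice is pinned to the empty list, which
  -- keeps this set finite without affecting any flow.
  set T : Finset (Fin v × Fin v → List (Fin n)) :=
    Fintype.piFinset fun w => if w ∈ N.od then N.routes w else {[]} with hT
  have hTmem : ∀ c, c ∈ T → ∀ w ∈ N.od, c w ∈ N.routes w := by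
    intro c hc w hw
    have := Fintype.mem_piFinset.mp hc w
    rwa [if_pos hw] at this
  set Vs : Set (Fin n → ℝ) := (fun c => edgeFlow N (choiceFlow D c)) '' (T : Set _)
  have hconv : Convex ℝ K := by
    rintro g ⟨x, hx, hxg⟩ g' ⟨y, hy, hyg⟩ a b ha hb hab
    refine ⟨_, FlowSet.mix N hx hy ha hb hab, fun e => ?_⟩
    rw [edgeFlow_mix, hxg, hyg]; rfl
  have hsub : convexHull ℝ Vs ⊆ K := by
    refine convexHull_min ?_ hconv
    rintro _ ⟨c, hc, rfl⟩
    exact ⟨_, choiceFlow_mem N hd (hTmem c hc), fun e => rfl⟩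
  suffices h : f ∈ convexHull ℝ Vs from hsub h
  by_contra hnot
  -- Separate f strictly from the hull of the all-or-nothing flows and read the functional as edge
  -- costs s. The cheapest routes for s give a vertex of the hull with value −Φ(s), which
  -- contradicts the minorant property at s.
  obtain ⟨l, u, hlu, hl⟩ := geometric_hahn_banach_point_closed (convex_convexHull ℝ Vs)
    ((T.finite_toSet.image _).isClosed_convexHull (𝕜 := ℝ)) hnot
  set s : Fin n → ℝ := fun e => l fun j => if e = j then 1 else 0
  have hls : ∀ g : Fin n → ℝ, l g = ∑ e, g e * s e := fun g => by
    have := LinearMap.pi_apply_eq_sum_univ (l : (Fin n → ℝ) →ₗ[ℝ] ℝ) g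
    simpa using this
  have hex : ∀ w, ∃ p, (w ∈ N.od → p ∈ N.routes w ∧ routeCost s p = minCost N s w) ∧
      (w ∉ N.od → p = []) := by
    intro w
    by_cases hw : w ∈ N.od
    · obtain ⟨p, hp, h⟩ := exists_minCost N s hw
      exact ⟨p, fun _ => ⟨hp, h⟩, fun h => absurd hw h⟩
    · exact ⟨[], fun h => absurd h hw, fun _ => rfl⟩
  choose c hc hc' using hex
  have hcT : c ∈ T := by
    rw [hT, Fintype.mem_piFinset]
    intro w
    by_cases hw : w ∈ N.od
    · rw [if_pos hw]; exact (hc w hw).1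
    · rw [if_neg hw, hc' w hw]; simp
  have h1 := hl _ (subset_convexHull ℝ Vs ⟨c, hcT, rfl⟩)
  simp only at h1
  rw [hls, sum_choiceFlow_mul N (hTmem c hcT)] at h1
  rw [hls] at hlu
  have h2 := hf s
  rw [potential_of_zero N hg] at h2
  have h3 : ∑ w ∈ N.od, D.dem w * routeCost s (c w) = ∑ w ∈ N.od, D.dem w * minCost N s w :=
    Finset.sum_congr rfl fun w hw => by rw [(hc w hw).2]
  linarith

theorem minCost_smul {a : ℝ} (ha : 0 ≤ a) (t : Fin n → ℝ) {w : Fin v × Fin v} (hw : w ∈ N.od) :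
    minCost N (fun e => a * t e) w = a * minCost N t w := by
  have hr : ∀ p : List (Fin n), routeCost (fun e => a * t e) p = a * routeCost t p := by
    intro p; simp only [routeCost, Finset.mul_sum]
    exact Finset.sum_congr rfl fun e _ => by ring
  obtain ⟨p, hp, h⟩ := exists_minCost N t hw
  obtain ⟨q, hq, h'⟩ := exists_minCost N (fun e => a * t e) hw
  apply le_antisymm
  · rw [← h, ← hr]; exact minCost_le N _ hp
  · rw [← h', hr]; exact mul_le_mul_of_nonneg_left (minCost_le N t hq) ha

/-- The values of an oracle are, up to the sign, edge flows that solve the inner problem. -/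
theorem IsOracle.exists_flow {G : (Fin n → ℝ) → Fin n → ℝ} (hG : IsOracle N D G)
    (hg : 0 ≤ D.gamma) (hd : ∀ w ∈ N.od, 0 < D.dem w) {y : Fin n → ℝ} (hy : y ∈ dualSet D) :
    ∃ x ∈ FlowSet N D, (∀ e, edgeFlow N x e = -G y e) ∧
      potential N D y + ∑ e, edgeFlow N x e * y e = -(D.gamma * entropy N D x) ∧
      (0 < D.gamma → x = logitFlow N D y) := by
  rcases hg.eq_or_lt with h | h
  · have h := h.symm
    have hpot : ∀ a : ℝ, 0 ≤ a → potential N D (fun e => a * y e) = a * potential N D y := by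
      intro a ha
      rw [potential_of_zero N h, potential_of_zero N h, mul_neg, Finset.mul_sum]
      congr 1
      refine Finset.sum_congr rfl fun w hw => ?_
      rw [minCost_smul N ha y hw]; ring
    -- For γ = 0 the potential is positively homogeneous. The subgradient inequality holds at all
    -- points, also outside the dual set, so testing it at 2y and at 0 gives Φ(y) = ⟨G y, y⟩; hence
    -- the linear function of slope G y is a minorant of Φ.
    have h2 := hG y hy (fun e => 2 * y e)
    have h0 := hG y hy (fun e => 0 * y e)
    rw [hpot 2 (by norm_num)] at h2
    rw [hpot 0 le_rfl] at h0
    have e2 : ∑ e, G y e * (2 * y e - y e) = ∑ e, G y e * y e :=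
      Finset.sum_congr rfl fun e _ => by ring
    have e0 : ∑ e, G y e * (0 * y e - y e) = -∑ e, G y e * y e := by
      rw [← Finset.sum_neg_distrib]; exact Finset.sum_congr rfl fun e _ => by ring
    rw [e2] at h2
    rw [e0] at h0
    have heq : potential N D y = ∑ e, G y e * y e := by linarith
    obtain ⟨x, hx, hxe⟩ := exists_flow_of_minorant N h hd (f := fun e => -G y e) (by
      intro s
      have := hG y hy s
      simp only [mul_sub, Finset.sum_sub_distrib] at this
      simp only [neg_mul, Finset.sum_neg_distrib, neg_neg]
      linarith)
    refine ⟨x, hx, hxe, ?_, fun h' => absurd h h'.ne'⟩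
    simp only [hxe, neg_mul, Finset.sum_neg_distrib, h, zero_mul, neg_zero]
    linarith
  · refine ⟨logitFlow N D y, logitFlow_mem N hd y, ?_, potential_add_logit N h hd y, fun _ => rfl⟩
    set f := edgeFlow N (logitFlow N D y) with hf
    set c := 4 * N.H * totalDemand N D / D.gamma / 2 with hcdef
    have hc : 0 ≤ c := by
      have : 0 ≤ totalDemand N D := Finset.sum_nonneg fun w hw => (hd w hw).le
      positivity
    -- For γ > 0, Φ lies between the affine minorant of slope G y and a quadratic majorant of slope
    -- −f at y. A short step along G y + f forces this vector to vanish; c + 1 in place of c keeps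
    -- the step length meaningful when c = 0.
    have h1 := hG y hy (fun e => y e + (1 / (c + 1)) * (G y e + f e))
    have h2 := potential_le_of_pos N h hd y (fun e => y e + (1 / (c + 1)) * (G y e + f e))
    rw [← hf, ← hcdef] at h2
    have h3 : ∑ e, G y e * (y e + 1 / (c + 1) * (G y e + f e) - y e)
        + ∑ e, f e * (y e + 1 / (c + 1) * (G y e + f e) - y e)
        = 1 / (c + 1) * ∑ e, (G y e + f e) ^ 2 := by
      rw [← Finset.sum_add_distrib, Finset.mul_sum]
      exact Finset.sum_congr rfl fun e _ => by ring
    have h4 : ∑ e, (y e + 1 / (c + 1) * (G y e + f e) - y e) ^ 2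
        = (1 / (c + 1)) ^ 2 * ∑ e, (G y e + f e) ^ 2 := by
      rw [Finset.mul_sum]
      exact Finset.sum_congr rfl fun e _ => by ring
    rw [h4] at h2
    set r := ∑ e, (G y e + f e) ^ 2 with hr
    have h5 : 1 / (c + 1) * r ≤ c * ((1 / (c + 1)) ^ 2 * r) := by linarith
    have h6 : (1 / (c + 1)) * r - c * ((1 / (c + 1)) ^ 2 * r) = (1 / (c + 1)) ^ 2 * r := by
      field_simp; ring
    have h7 : r ≤ 0 := by
      have : 0 < (1 / (c + 1)) ^ 2 := by positivity
      nlinarith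
    have h8 : r = 0 := le_antisymm h7 (Finset.sum_nonneg fun e _ => sq_nonneg _)
    rw [hr, Finset.sum_eq_zero_iff_of_nonneg fun e _ => sq_nonneg _] at h8
    intro e
    have := pow_eq_zero_iff two_ne_zero |>.mp (h8 e (Finset.mem_univ e))
    linarith

theorem isOracle_logit (hg : 0 < D.gamma) (hd : ∀ w ∈ N.od, 0 < D.dem w) :
    IsOracle N D fun t e => -edgeFlow N (logitFlow N D t) e := by
  intro t _ s
  have h1 := potential_add_logit N hg hd t
  have h2 := neg_edgeFlow_le_potential_of_pos N hg hd (logitFlow_mem N hd t) s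
  simp only [neg_mul, mul_sub, Finset.sum_sub_distrib, Finset.sum_neg_distrib]
  linarith

/-- A potential with `γ = 0` has bounded subgradients. -/
theorem IsOracle.potential_le_of_zero {G : (Fin n → ℝ) → Fin n → ℝ} (hG : IsOracle N D G)
    (hg : 0 ≤ D.gamma) (hd : ∀ w ∈ N.od, 0 < D.dem w) {y t : Fin n → ℝ} (hy : y ∈ dualSet D)
    (ht : t ∈ dualSet D) :
    potential N D t ≤ potential N D y + ∑ e, G y e * (t e - y e)
      + 2 * totalDemand N D * Real.sqrt N.H * Real.sqrt (∑ e, (t e - y e) ^ 2) := by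
  obtain ⟨x, hx, hxe, -, -⟩ := IsOracle.exists_flow N hG hg hd hy
  obtain ⟨x', hx', hxe', -, -⟩ := IsOracle.exists_flow N hG hg hd ht
  -- The increase of Φ is bounded by the subgradient at t, and the linear term by the subgradient at
  -- y. Both are flows of norm at most d√H, whence the factor 2.
  have h1 := hG t ht y
  have h2 := abs_sum_edgeFlow_le hx (fun e => t e - y e)
  have h3 := abs_sum_edgeFlow_le hx' (fun e => t e - y e)
  simp only [hxe, hxe', neg_mul, Finset.sum_neg_distrib, abs_neg] at h2 h3
  have h4 : ∑ e, G t e * (y e - t e) = -∑ e, G t e * (t e - y e) := by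
    rw [← Finset.sum_neg_distrib]; exact Finset.sum_congr rfl fun e _ => by ring
  rw [h4] at h1
  linarith [neg_abs_le (∑ e, G y e * (t e - y e)), le_abs_self (∑ e, G t e * (t e - y e))]

end Potential

end Traffic

namespace Traffic

/-! ### The scalar equation -/

/-- The left side is continuous and strictly increasing in s. It runs from 0 to at least c on [0,
c], so the supremum in the definition is attained at a solution. -/
theorem powRoot_spec {a m c : ℝ} (ha : 0 ≤ a) (hm : 0 < m) (hc : 0 ≤ c) :
    0 ≤ powRoot a m c ∧ powRoot a m c + a * powRoot a m c ^ m = c := by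
  have hcont : ContinuousOn (fun s : ℝ => s + a * s ^ m) (Set.Icc 0 c) :=
    (continuous_id.add (continuous_const.mul
      (Real.continuous_rpow_const hm.le))).continuousOn
  have hmem : c ∈ Set.Icc ((fun s : ℝ => s + a * s ^ m) 0) ((fun s : ℝ => s + a * s ^ m) c) := by
    simp only [Real.zero_rpow hm.ne', mul_zero, add_zero]
    exact ⟨hc, le_add_of_nonneg_right (mul_nonneg ha (Real.rpow_nonneg hc m))⟩
  obtain ⟨s, hs, hsc⟩ := intermediate_value_Icc hc hcont hmem
  simp only at hsc
  have hgr : IsGreatest {s : ℝ | 0 ≤ s ∧ s + a * s ^ m ≤ c} s := by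
    refine ⟨⟨hs.1, hsc.le⟩, fun r hr => ?_⟩
    by_contra hlt
    have hlt := not_le.mp hlt
    have := Real.rpow_le_rpow hs.1 hlt.le hm.le
    have := mul_le_mul_of_nonneg_left this ha
    linarith [hr.2]
  rw [powRoot, hgr.csSup_eq]
  exact ⟨hs.1, hsc⟩

/-! ### Edge costs and their conjugates -/

section Costs

variable {v n : ℕ} {D : Data v n} {e : Fin n}

theorem continuous_tau (hm : 0 < D.mu) : Continuous (tau D e) := by
  unfold tau
  have h : Continuous fun f : ℝ => (f / D.fbar e) ^ (1 / D.mu) :=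
    (continuous_id.div_const _).rpow_const fun _ => Or.inr (by positivity)
  exact continuous_const.mul (continuous_const.add (continuous_const.mul h))

theorem tau_mono (ht : 0 < D.tbar e) (hf : 0 < D.fbar e) (hr : 0 < D.rho) (hm : 0 < D.mu)
    {a b : ℝ} (ha : 0 ≤ a) (hab : a ≤ b) : tau D e a ≤ tau D e b := by
  unfold tau
  have : (a / D.fbar e) ^ (1 / D.mu) ≤ (b / D.fbar e) ^ (1 / D.mu) :=
    Real.rpow_le_rpow (by positivity) (by gcongr) (by positivity)
  gcongr

theorem tau_zero (hm : 0 < D.mu) : tau D e 0 = D.tbar e := by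
  unfold tau
  rw [zero_div, Real.zero_rpow (by positivity)]; ring

/-- Convexity of σ in the form of a tangent inequality: its derivative τ is monotone on the
nonnegative half-line. -/
theorem sigma_tangent (ht : 0 < D.tbar e) (hf : 0 < D.fbar e) (hr : 0 < D.rho) (hm : 0 < D.mu)
    {a b : ℝ} (ha : 0 ≤ a) (hb : 0 ≤ b) :
    sigma D e a + tau D e a * (b - a) ≤ sigma D e b := by
  have hc := continuous_tau (D := D) (e := e) hm
  have hi : ∀ x y : ℝ, IntervalIntegrable (tau D e) MeasureTheory.volume x y :=
    fun x y => hc.intervalIntegrable x y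
  have hab : sigma D e a + ∫ z in a..b, tau D e z = sigma D e b :=
    intervalIntegral.integral_add_adjacent_intervals (hi _ _) (hi _ _)
  rw [← hab]
  have : (∫ _ in a..b, tau D e a) = tau D e a * (b - a) := by
    rw [intervalIntegral.integral_const, smul_eq_mul, mul_comm]
  rw [← this]
  refine add_le_add_right ?_ _
  rcases le_total a b with h | h
  · exact intervalIntegral.integral_mono_on h (by simp) (hi _ _)
      fun z hz => tau_mono ht hf hr hm ha hz.1
  · rw [intervalIntegral.integral_symm, intervalIntegral.integral_symm b a, neg_le_neg_iff]
    exact intervalIntegral.integral_mono_on h (hi _ _) (by simp)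
      fun z hz => tau_mono ht hf hr hm (hb.trans hz.1) hz.2

/-- The closed form is needed because a program has to evaluate σ by arithmetic operations. -/
theorem sigma_eq (hf : 0 < D.fbar e) (hm : 0 < D.mu) (f : ℝ) :
    sigma D e f = D.tbar e * f
      + D.tbar e * D.rho * (D.fbar e * ((f / D.fbar e) ^ (1 / D.mu + 1) / (1 / D.mu + 1))) := by
  have hp : 0 < 1 / D.mu := by positivity
  have hc : Continuous fun f : ℝ => (f / D.fbar e) ^ (1 / D.mu) :=
    (continuous_id.div_const _).rpow_const fun _ => Or.inr hp.le
  have hc' : Continuous fun f : ℝ => D.rho * (f / D.fbar e) ^ (1 / D.mu) :=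
    continuous_const.mul hc
  unfold sigma tau
  rw [intervalIntegral.integral_const_mul, intervalIntegral.integral_add (by simp)
    (hc'.intervalIntegrable _ _), intervalIntegral.integral_const_mul,
    intervalIntegral.integral_const,
    intervalIntegral.integral_comp_div (fun z : ℝ => z ^ (1 / D.mu)) hf.ne',
    integral_rpow (Or.inl (by linarith)), zero_div, Real.zero_rpow (by linarith)]
  simp only [sub_zero, smul_eq_mul]
  ring

/-- The flow at which the travel time of the edge is `t̄_e + s`. -/
def flowAt (D : Data v n) (e : Fin n) (s : ℝ) : ℝ :=
  D.fbar e * (s / (D.tbar e * D.rho)) ^ D.mu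

theorem flowAt_nonneg (ht : 0 < D.tbar e) (hf : 0 < D.fbar e) (hr : 0 < D.rho)
    {s : ℝ} (hs : 0 ≤ s) : 0 ≤ flowAt D e s := by
  unfold flowAt; positivity

theorem tau_flowAt (ht : 0 < D.tbar e) (hf : 0 < D.fbar e) (hr : 0 < D.rho) (hm : 0 < D.mu)
    {s : ℝ} (hs : 0 ≤ s) : tau D e (flowAt D e s) = D.tbar e + s := by
  unfold tau flowAt
  rw [mul_div_cancel_left₀ _ hf.ne', ← Real.rpow_mul (by positivity), mul_one_div,
    div_self hm.ne', Real.rpow_one]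
  field_simp

theorem isGreatest_conjugate (ht : 0 < D.tbar e) (hf : 0 < D.fbar e) (hr : 0 < D.rho)
    (hm : 0 < D.mu) {f : ℝ} (h0 : 0 ≤ f) :
    IsGreatest ((fun g : ℝ => tau D e f * g - sigma D e g) '' Set.Ici 0)
      (tau D e f * f - sigma D e f) := by
  refine ⟨⟨f, h0, rfl⟩, ?_⟩
  rintro _ ⟨g, hg, rfl⟩
  have := sigma_tangent ht hf hr hm h0 hg
  simp only
  linarith

theorem sigmaStar_tau (ht : 0 < D.tbar e) (hf : 0 < D.fbar e) (hr : 0 < D.rho) (hm : 0 < D.mu)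
    {f : ℝ} (h0 : 0 ≤ f) : sigmaStar D e (tau D e f) = tau D e f * f - sigma D e f :=
  (isGreatest_conjugate ht hf hr hm h0).csSup_eq

theorem sigmaStar_eq (ht : 0 < D.tbar e) (hf : 0 < D.fbar e) (hr : 0 < D.rho) (hm : 0 < D.mu)
    {t : ℝ} (h : D.tbar e ≤ t) : sigmaStar D e t
      = t * flowAt D e (t - D.tbar e) - sigma D e (flowAt D e (t - D.tbar e)) := by
  have hs : 0 ≤ t - D.tbar e := sub_nonneg.mpr h
  have h1 := tau_flowAt ht hf hr hm hs
  have h2 := sigmaStar_tau ht hf hr hm (flowAt_nonneg ht hf hr hs)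
  rwa [h1, add_sub_cancel] at h2

theorem le_sigmaStar (ht : 0 < D.tbar e) (hf : 0 < D.fbar e) (hr : 0 < D.rho) (hm : 0 < D.mu)
    {t f : ℝ} (h : D.tbar e ≤ t) (h0 : 0 ≤ f) : t * f - sigma D e f ≤ sigmaStar D e t := by
  have hs : 0 ≤ t - D.tbar e := sub_nonneg.mpr h
  have h1 := isGreatest_conjugate ht hf hr hm (flowAt_nonneg ht hf hr hs)
  rw [tau_flowAt ht hf hr hm hs, add_sub_cancel] at h1
  exact le_csSup h1.bddAbove ⟨f, h0, rfl⟩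

/-- The term of the composite function for the edge `e`. -/
def edgeComposite (M : Model) (D : Data v n) (e : Fin n) (t : ℝ) : ℝ :=
  match M with
  | .beckmann => sigmaStar D e t
  | .stable => D.fbar e * (t - D.tbar e)

theorem composite_eq_sum (M : Model) (t : Fin n → ℝ) :
    composite M D t = ∑ e, edgeComposite M D e (t e) := by
  cases M <;> rfl

/-- The solution `s = t_e - t̄_e` of the one-dimensional subproblem. -/
def shift (M : Model) (D : Data v n) (e : Fin n) (A F : ℝ) : ℝ :=
  match M with
  | .beckmann => powRoot (A * D.fbar e / (D.tbar e * D.rho) ^ D.mu) D.mu F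
  | .stable => max (F - A * D.fbar e) 0

/-- The one-dimensional subproblem is 1-strongly convex because of its quadratic term, so the
first-order condition implies quadratic growth. In the Beckmann case σ* is bounded below by its
tangent, whose slope is the flow at the solution, and the scalar equation says that A times this
flow equals F − s. -/
theorem shift_spec {M : Model} (ht : 0 < D.tbar e) (hf : 0 < D.fbar e)
    (hB : M = .beckmann → 0 < D.rho ∧ 0 < D.mu) {A F : ℝ} (hA : 0 < A) (hF : 0 ≤ F) :
    0 ≤ shift M D e A F ∧ ∀ r, 0 ≤ r →
      (1 / 2) * shift M D e A F ^ 2 - F * shift M D e A F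
        + A * edgeComposite M D e (D.tbar e + shift M D e A F) + (1 / 2) * (r - shift M D e A F) ^ 2
      ≤ (1 / 2) * r ^ 2 - F * r + A * edgeComposite M D e (D.tbar e + r) := by
  cases M with
  | beckmann =>
    obtain ⟨hr, hm⟩ := hB rfl
    have ha : 0 ≤ A * D.fbar e / (D.tbar e * D.rho) ^ D.mu := by positivity
    obtain ⟨h0, hroot⟩ := powRoot_spec ha hm hF
    set s := powRoot (A * D.fbar e / (D.tbar e * D.rho) ^ D.mu) D.mu F with hs
    have hshift : shift .beckmann D e A F = s := rfl
    rw [hshift]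
    refine ⟨h0, fun r hr0 => ?_⟩
    simp only [edgeComposite]
    have hfl := flowAt_nonneg ht hf hr h0
    have h1 := sigmaStar_tau ht hf hr hm hfl
    rw [tau_flowAt ht hf hr hm h0] at h1
    have h2 := le_sigmaStar ht hf hr hm (show D.tbar e ≤ D.tbar e + r by linarith) hfl
    have h3 : A * flowAt D e s = F - s := by
      have : A * flowAt D e s = A * D.fbar e / (D.tbar e * D.rho) ^ D.mu * s ^ D.mu := by
        unfold flowAt
        rw [Real.div_rpow h0 (by positivity)]; ring
      rw [this]; linarith
    have h4 := mul_le_mul_of_nonneg_left h2 hA.le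
    have h5 : A * ((D.tbar e + r) * flowAt D e s - sigma D e (flowAt D e s))
        = A * ((D.tbar e + s) * flowAt D e s - sigma D e (flowAt D e s))
          + (r - s) * (A * flowAt D e s) := by ring
    rw [h5, h3] at h4
    rw [h1]
    nlinarith
  | stable =>
    simp only [shift, edgeComposite]
    refine ⟨le_max_right _ _, fun r hr0 => ?_⟩
    rcases le_total (F - A * D.fbar e) 0 with h | h
    · rw [max_eq_right h]; nlinarith
    · rw [max_eq_left h]
      apply le_of_eq; ring

/-- A conjugate is a supremum of affine functions. It is enough to take the flow that attains it at
the mixed point and to use it as a competitor at both end points. -/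
theorem convexOn_edgeComposite {M : Model} (ht : 0 < D.tbar e) (hf : 0 < D.fbar e)
    (hB : M = .beckmann → 0 < D.rho ∧ 0 < D.mu) {x y a b : ℝ} (hx : D.tbar e ≤ x)
    (hy : D.tbar e ≤ y) (ha : 0 ≤ a) (hb : 0 ≤ b) (hab : a + b = 1) :
    edgeComposite M D e (a * x + b * y)
      ≤ a * edgeComposite M D e x + b * edgeComposite M D e y := by
  cases M with
  | beckmann =>
    obtain ⟨hr, hm⟩ := hB rfl
    have hxy : D.tbar e ≤ a * x + b * y := by
      calc D.tbar e = a * D.tbar e + b * D.tbar e := by rw [← add_mul, hab, one_mul]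
        _ ≤ _ := by gcongr
    simp only [edgeComposite]
    rw [sigmaStar_eq ht hf hr hm hxy]
    have h0 := flowAt_nonneg ht hf hr (sub_nonneg.mpr hxy)
    set f := flowAt D e (a * x + b * y - D.tbar e)
    have h1 := mul_le_mul_of_nonneg_left (le_sigmaStar ht hf hr hm hx h0) ha
    have h2 := mul_le_mul_of_nonneg_left (le_sigmaStar ht hf hr hm hy h0) hb
    have h3 : sigma D e f = a * sigma D e f + b * sigma D e f := by rw [← add_mul, hab, one_mul]
    linarith
  | stable =>
    simp only [edgeComposite]
    have h3 : D.fbar e * D.tbar e = a * (D.fbar e * D.tbar e) + b * (D.fbar e * D.tbar e) := by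
      rw [← add_mul, hab, one_mul]
    linarith

end Costs

/-! ### Weighted sums over the history -/

section Weighted

variable {n : ℕ}

/-- `∑ α_i c(y^i)`. -/
def wsum (hist : List (ℝ × (Fin n → ℝ))) (c : (Fin n → ℝ) → ℝ) : ℝ :=
  (hist.map fun q => q.1 * c q.2).sum

/-- `∑ α_i`. -/
def weight (hist : List (ℝ × (Fin n → ℝ))) : ℝ := (hist.map Prod.fst).sum

@[simp] theorem wsum_nil (c : (Fin n → ℝ) → ℝ) : wsum [] c = 0 := rfl

@[simp] theorem wsum_cons (q : ℝ × (Fin n → ℝ)) (hist) (c : (Fin n → ℝ) → ℝ) :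
    wsum (q :: hist) c = q.1 * c q.2 + wsum hist c := by simp [wsum]

@[simp] theorem weight_nil : weight ([] : List (ℝ × (Fin n → ℝ))) = 0 := rfl

@[simp] theorem weight_cons (q : ℝ × (Fin n → ℝ)) (hist) :
    weight (q :: hist) = q.1 + weight hist := by simp [weight]

theorem average_eq (hist : List (ℝ × (Fin n → ℝ))) (c : (Fin n → ℝ) → ℝ) :
    average hist c = wsum hist c / weight hist := rfl

theorem wsum_sum {ι : Type*} (hist : List (ℝ × (Fin n → ℝ))) (s : Finset ι)
    (c : ι → (Fin n → ℝ) → ℝ) :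
    wsum hist (fun y => ∑ i ∈ s, c i y) = ∑ i ∈ s, wsum hist (c i) := by
  induction hist with
  | nil => simp
  | cons q l ih => simp only [wsum_cons, ih, Finset.mul_sum, Finset.sum_add_distrib]

theorem wsum_add (hist : List (ℝ × (Fin n → ℝ))) (c c' : (Fin n → ℝ) → ℝ) :
    wsum hist (fun y => c y + c' y) = wsum hist c + wsum hist c' := by
  induction hist with
  | nil => simp
  | cons q l ih => simp only [wsum_cons, ih]; ring

theorem wsum_mul (hist : List (ℝ × (Fin n → ℝ))) (a : ℝ) (c : (Fin n → ℝ) → ℝ) :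
    wsum hist (fun y => a * c y) = a * wsum hist c := by
  induction hist with
  | nil => simp
  | cons q l ih => simp only [wsum_cons, ih]; ring

theorem wsum_const (hist : List (ℝ × (Fin n → ℝ))) (a : ℝ) :
    wsum hist (fun _ => a) = weight hist * a := by
  induction hist with
  | nil => simp
  | cons q l ih => simp only [wsum_cons, weight_cons, ih]; ring

theorem wsum_congr {hist : List (ℝ × (Fin n → ℝ))} {c c' : (Fin n → ℝ) → ℝ}
    (h : ∀ q ∈ hist, c q.2 = c' q.2) : wsum hist c = wsum hist c' := by
  unfold wsum
  congr 1
  exact List.map_congr_left fun q hq => by rw [h q hq]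

theorem wsum_mono {hist : List (ℝ × (Fin n → ℝ))} {c c' : (Fin n → ℝ) → ℝ}
    (h0 : ∀ q ∈ hist, 0 < q.1) (h : ∀ q ∈ hist, c q.2 ≤ c' q.2) :
    wsum hist c ≤ wsum hist c' :=
  List.sum_le_sum fun q hq => mul_le_mul_of_nonneg_left (h q hq) (h0 q hq).le

theorem wsum_nonneg {hist : List (ℝ × (Fin n → ℝ))} {c : (Fin n → ℝ) → ℝ}
    (h0 : ∀ q ∈ hist, 0 < q.1) (h : ∀ q ∈ hist, 0 ≤ c q.2) : 0 ≤ wsum hist c := by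
  have := wsum_mono (c := fun _ => 0) h0 h
  rwa [wsum_const, mul_zero] at this

theorem weight_pos {hist : List (ℝ × (Fin n → ℝ))} (h0 : ∀ q ∈ hist, 0 < q.1)
    (hne : hist ≠ []) : 0 < weight hist := by
  cases hist with
  | nil => exact absurd rfl hne
  | cons q l =>
    rw [weight_cons]
    refine add_pos_of_pos_of_nonneg (h0 q (by simp)) (List.sum_nonneg fun x hx => ?_)
    obtain ⟨r, hr, rfl⟩ := List.mem_map.mp hx
    exact (h0 r (by simp [hr])).le

end Weighted

end Traffic

/-! ### The dual problem satisfies the assumptions of the method -/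

namespace Traffic

variable {v n : ℕ} {N : Network v n} {M : Model} {D : Data v n} {G : (Fin n → ℝ) → Fin n → ℝ}

theorem Network.H_pos (N : Network v n) : 0 < N.H := by
  obtain ⟨w, hw⟩ := N.od_nonempty
  obtain ⟨p, hp⟩ := N.routes_nonempty w hw
  have hwalk := N.routes_walk w hw p hp
  have hne := N.od_ne w hw
  cases p with
  | nil => exact absurd hwalk hne
  | cons e p =>
    have h1 : ∑ a : Fin n, ((e :: p).count a) ^ 2 ≤ N.H :=
      (Finset.le_sup (f := fun p : List (Fin n) => ∑ e : Fin n, (p.count e) ^ 2) hp).trans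
        (Finset.le_sup (f := fun w => (N.routes w).sup
          fun p : List (Fin n) => ∑ e : Fin n, (p.count e) ^ 2) hw)
    refine lt_of_lt_of_le ?_ h1
    refine lt_of_lt_of_le ?_ (Finset.single_le_sum (fun _ _ => Nat.zero_le _) (Finset.mem_univ e))
    exact pow_pos (List.count_pos_iff.mpr (by simp)) 2

theorem Valid.demand_pos (hD : Valid N M D) : 0 < totalDemand N D :=
  Finset.sum_pos hD.dem_pos N.od_nonempty

theorem theta_nonneg (e : Fin n) (p : List (Fin n)) : 0 ≤ theta e p := Nat.cast_nonneg _

theorem edgeFlow_nonneg {x : Fin v × Fin v → List (Fin n) → ℝ} (hx : x ∈ FlowSet N D)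
    (e : Fin n) : 0 ≤ edgeFlow N x e :=
  Finset.sum_nonneg fun w hw => Finset.sum_nonneg fun p hp =>
    mul_nonneg (theta_nonneg e p) ((hx w hw).1 p hp)

theorem edgeFlow_le {x : Fin v × Fin v → List (Fin n) → ℝ} (hx : x ∈ FlowSet N D)
    (e : Fin n) : edgeFlow N x e ≤ totalDemand N D * Real.sqrt N.H := by
  have h := abs_sum_edgeFlow_le hx (fun i => if i = e then 1 else 0)
  simp only [mul_ite, mul_one, mul_zero, Finset.sum_ite_eq', Finset.mem_univ, if_true, ite_pow,
    one_pow, ne_eq, OfNat.ofNat_ne_zero, not_false_eq_true, zero_pow, Real.sqrt_one] at h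
  exact (le_abs_self _).trans h

/-- Rewriting every linearization relative to t̄ leaves a quadratic, a constant, one accumulated
linear form and a multiple of h. Hence minimization over Q splits into one scalar problem per edge,
and only the accumulated gradient needs to be stored. -/
theorem phi_eq (P : Composite n) (hist : List (ℝ × (Fin n → ℝ))) (t : Fin n → ℝ) :
    P.phi hist t = (1 / 2) * ∑ e, (t e - P.y0 e) ^ 2 + wsum hist (fun y => P.lin y P.y0)
      + ∑ e, wsum hist (fun y => P.grad y e) * (t e - P.y0 e) + weight hist * P.h t := by
  induction hist with
  | nil => simp [Composite.phi]
  | cons q l ih =>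
    have h1 : P.lin q.2 t = P.lin q.2 P.y0 + ∑ e, P.grad q.2 e * (t e - P.y0 e) := by
      unfold Composite.lin
      rw [add_assoc, ← Finset.sum_add_distrib]
      congr 1
      exact Finset.sum_congr rfl fun e _ => by ring
    have h2 : ∑ e, wsum (q :: l) (fun y => P.grad y e) * (t e - P.y0 e)
        = q.1 * ∑ e, P.grad q.2 e * (t e - P.y0 e)
          + ∑ e, wsum l (fun y => P.grad y e) * (t e - P.y0 e) := by
      rw [Finset.mul_sum, ← Finset.sum_add_distrib]
      exact Finset.sum_congr rfl fun e _ => by rw [wsum_cons]; ring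
    rw [Composite.phi_cons, ih, h1, h2, wsum_cons, weight_cons]
    ring

theorem convex_dualSet : Convex ℝ (dualSet D) := by
  intro x hx y hy a b ha hb hab e
  have : D.tbar e = a * D.tbar e + b * D.tbar e := by rw [← add_mul, hab, one_mul]
  rw [this]
  exact add_le_add (mul_le_mul_of_nonneg_left (hx e) ha) (mul_le_mul_of_nonneg_left (hy e) hb)

theorem convexOn_composite (hD : Valid N M D) : ConvexOn ℝ (dualSet D) (composite M D) := by
  refine ⟨convex_dualSet, fun x hx y hy a b ha hb hab => ?_⟩
  simp only [composite_eq_sum, smul_eq_mul, Finset.mul_sum]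
  rw [← Finset.sum_add_distrib]
  exact Finset.sum_le_sum fun e _ => convexOn_edgeComposite (hD.tbar_pos e) (hD.fbar_pos e)
    hD.beckmann (hx e) (hy e) ha hb hab

/-- The explicit minimizer of the estimating function. -/
def dualMin (M : Model) (D : Data v n) (G : (Fin n → ℝ) → Fin n → ℝ)
    (hist : List (ℝ × (Fin n → ℝ))) (e : Fin n) : ℝ :=
  D.tbar e + shift M D e (weight hist) (-wsum hist fun y => G y e)

theorem neg_wsum_nonneg (hD : Valid N M D) (hG : IsOracle N D G)
    {hist : List (ℝ × (Fin n → ℝ))} (hpos : ∀ q ∈ hist, 0 < q.1 ∧ q.2 ∈ dualSet D) (e : Fin n) :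
    0 ≤ -wsum hist fun y => G y e := by
  have : -wsum hist (fun y => G y e) = wsum hist fun y => -G y e := by
    have := wsum_mul hist (-1) fun y => G y e
    simp only [neg_mul, one_mul] at this
    exact this.symm
  rw [this]
  refine wsum_nonneg (fun q hq => (hpos q hq).1) fun q hq => ?_
  obtain ⟨x, hx, hxe, -⟩ :=
    IsOracle.exists_flow N hG hD.gamma_nonneg hD.dem_pos (hpos q hq).2
  rw [← hxe]; exact edgeFlow_nonneg hx e

/-- The scalar growth inequalities of `shift_spec` are summed over the edges; the accumulated flow
is nonnegative because each −G y is a flow of routes. -/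
theorem dualMin_spec (hD : Valid N M D) (hG : IsOracle N D G)
    {hist : List (ℝ × (Fin n → ℝ))} (hne : hist ≠ [])
    (hpos : ∀ q ∈ hist, 0 < q.1 ∧ q.2 ∈ dualSet D) :
    dualMin M D G hist ∈ dualSet D ∧ ∀ t ∈ dualSet D,
      (dualProblem N M D G).phi hist (dualMin M D G hist)
        + (1 / 2) * ∑ e, (t e - dualMin M D G hist e) ^ 2 ≤ (dualProblem N M D G).phi hist t := by
  have hA := weight_pos (fun q hq => (hpos q hq).1) hne
  have hs := fun e => shift_spec (M := M) (hD.tbar_pos e) (hD.fbar_pos e) hD.beckmann hA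
    (neg_wsum_nonneg hD hG hpos e)
  refine ⟨fun e => ?_, fun t ht => ?_⟩
  · exact le_add_of_nonneg_right (hs e).1
  · have key : ∀ t : Fin n → ℝ, (dualProblem N M D G).phi hist t
        = wsum hist (fun y => (dualProblem N M D G).lin y D.tbar)
          + ∑ e, ((1 / 2) * (t e - D.tbar e) ^ 2
            - (-wsum hist fun y => G y e) * (t e - D.tbar e)
            + weight hist * edgeComposite M D e (t e)) := by
      intro t
      rw [phi_eq]
      simp only [dualProblem, composite_eq_sum, Finset.sum_add_distrib, Finset.sum_sub_distrib,
        Finset.mul_sum, neg_mul, Finset.sum_neg_distrib]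
      ring
    rw [key, key, add_assoc, Finset.mul_sum, ← Finset.sum_add_distrib]
    refine add_le_add_right (Finset.sum_le_sum fun e _ => ?_) _
    have h := (hs e).2 (t e - D.tbar e) (sub_nonneg.mpr (ht e))
    have e1 : dualMin M D G hist e - D.tbar e
        = shift M D e (weight hist) (-wsum hist fun y => G y e) := by
      unfold dualMin; ring
    have e2 : t e - dualMin M D G hist e
        = t e - D.tbar e - shift M D e (weight hist) (-wsum hist fun y => G y e) := by
      unfold dualMin; ring
    rw [e1, e2]
    rw [add_sub_cancel] at h
    exact h

theorem regular_dualProblem (hD : Valid N M D) (hG : IsOracle N D G) :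
    (dualProblem N M D G).Regular where
  L0_pos := hD.L0_pos
  eps_pos := hD.eps_pos
  y0_mem := fun _ => le_rfl
  convex_Q := convex_dualSet
  convex_h := convexOn_composite hD
  lin_le := fun y hy t _ => hG y hy t
  exists_min := fun hist hne hpos => ⟨dualMin M D G hist, dualMin_spec hD hG hne hpos⟩

theorem nextU_eq (hD : Valid N M D) (hG : IsOracle N D G) {s : State n}
    (hs : (dualProblem N M D G).Inv s) : (dualProblem N M D G).nextU s
      = dualMin M D G ((Composite.alpha s, Composite.nextY s) :: s.hist) := by
  have hspec := dualMin_spec (N := N) (M := M) hD hG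
    (hist := (Composite.alpha s, Composite.nextY s) :: s.hist) (by simp) (by
      intro q hq
      rcases List.mem_cons.mp hq with rfl | hq
      · exact ⟨Composite.alpha_pos hs.L_pos, (regular_dualProblem hD hG).nextY_mem hs⟩
      · exact hs.hist_pos q hq)
  exact Composite.argminOn_eq hspec.1 hspec.2

/-! ### The duality gap -/

/-- Equality in the entropy duality fixes the intercept of the linearization. For γ = 0 the product
with the entropy vanishes, so the meaningless logit flow does no harm. -/
theorem lin_eq (hD : Valid N M D) (hG : IsOracle N D G) {y : Fin n → ℝ} (hy : y ∈ dualSet D)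
    (t : Fin n → ℝ) : (dualProblem N M D G).lin y t
      = -(D.gamma * entropy N D (logitFlow N D y)) + ∑ e, G y e * t e := by
  obtain ⟨x, -, hxe, hpot, hlog⟩ :=
    IsOracle.exists_flow N hG hD.gamma_nonneg hD.dem_pos hy
  have hent : D.gamma * entropy N D x = D.gamma * entropy N D (logitFlow N D y) := by
    rcases hD.gamma_nonneg.eq_or_lt with h | h
    · rw [← h, zero_mul, zero_mul]
    · rw [hlog h]
  rw [← hent, ← hpot]
  simp only [hxe, neg_mul, Finset.sum_neg_distrib, Composite.lin, dualProblem, mul_sub,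
    Finset.sum_sub_distrib]
  ring

/-- The averaged entropy term of the gap. -/
def avgEntropy (N : Network v n) (D : Data v n) (hist : List (ℝ × (Fin n → ℝ))) : ℝ :=
  D.gamma * average hist fun y => entropy N D (logitFlow N D y)

theorem wsum_lin (hD : Valid N M D) (hG : IsOracle N D G) {hist : List (ℝ × (Fin n → ℝ))}
    (hne : hist ≠ []) (hpos : ∀ q ∈ hist, 0 < q.1 ∧ q.2 ∈ dualSet D) (t : Fin n → ℝ) :
    wsum hist (fun y => (dualProblem N M D G).lin y t)
      = weight hist * (-avgEntropy N D hist - ∑ e, avgFlow G hist e * t e) := by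
  have hA := (weight_pos (fun q hq => (hpos q hq).1) hne).ne'
  rw [wsum_congr (c' := fun y => -(D.gamma * entropy N D (logitFlow N D y)) + ∑ e, G y e * t e)
    fun q hq => lin_eq hD hG (hpos q hq).2 t]
  have h1 : wsum hist (fun y => -(D.gamma * entropy N D (logitFlow N D y)))
      = -(weight hist * avgEntropy N D hist) := by
    have := wsum_mul hist (-D.gamma) fun y => entropy N D (logitFlow N D y)
    simp only [neg_mul] at this
    rw [this, avgEntropy, average_eq]
    field_simp
  rw [wsum_add, wsum_sum, h1, mul_sub, mul_neg, Finset.mul_sum, sub_eq_add_neg,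
    ← Finset.sum_neg_distrib]
  congr 1
  refine Finset.sum_congr rfl fun e _ => ?_
  have h2 : wsum hist (fun y => G y e * t e) = t e * wsum hist fun y => G y e := by
    rw [← wsum_mul]; congr 1; funext y; ring
  have h3 : wsum hist (fun y => -G y e) = -wsum hist fun y => G y e := by
    have := wsum_mul hist (-1) fun y => G y e
    simpa using this
  rw [h2, avgFlow, average_eq, h3]
  field_simp

theorem phi_dual (hD : Valid N M D) (hG : IsOracle N D G) {hist : List (ℝ × (Fin n → ℝ))}
    (hne : hist ≠ []) (hpos : ∀ q ∈ hist, 0 < q.1 ∧ q.2 ∈ dualSet D) (t : Fin n → ℝ) :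
    (dualProblem N M D G).phi hist t = (1 / 2) * ∑ e, (t e - D.tbar e) ^ 2
      + weight hist * (composite M D t - avgEntropy N D hist - ∑ e, avgFlow G hist e * t e) := by
  have h := wsum_lin hD hG hne hpos t
  have h1 : (dualProblem N M D G).phi hist t = (1 / 2) * ∑ e, (t e - D.tbar e) ^ 2
      + wsum hist (fun y => (dualProblem N M D G).lin y t) + weight hist * composite M D t := by
    have h2 := wsum_const hist (composite M D t)
    rw [← h2, add_assoc, ← wsum_add]
    rfl
  rw [h1, h]; ring

/-- The radius that controls the gap of the average over `hist`. -/
def radius (M : Model) (D : Data v n) (G : (Fin n → ℝ) → Fin n → ℝ)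
    (hist : List (ℝ × (Fin n → ℝ))) : ℝ :=
  match M with
  | .beckmann => Real.sqrt ((1 / 2) * ∑ e, (tau D e (avgFlow G hist e) - D.tbar e) ^ 2)
  | .stable => Real.sqrt 5 * D.R

theorem Rbar_eq (s : State n) : Rbar M D G s = radius M D G s.hist.tail := by
  cases M <;> rfl

/-- Route flows generating the individual gradients are averaged with the same weights; X is convex
and Θ is linear. For γ > 0 each of them is the logit flow, so that the average is the recovered one.
-/
theorem exists_avg (hD : Valid N M D) (hG : IsOracle N D G) {hist : List (ℝ × (Fin n → ℝ))}
    (hne : hist ≠ []) (hpos : ∀ q ∈ hist, 0 < q.1 ∧ q.2 ∈ dualSet D) :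
    ∃ x ∈ FlowSet N D, (∀ e, edgeFlow N x e = avgFlow G hist e) ∧
      (0 < D.gamma → x = avgRoute N D hist) := by
  have hw := weight_pos (fun q hq => (hpos q hq).1) hne
  have hex : ∀ y, ∃ x, y ∈ dualSet D → x ∈ FlowSet N D ∧ (∀ e, edgeFlow N x e = -G y e) ∧
      (0 < D.gamma → x = logitFlow N D y) := by
    intro y
    by_cases hy : y ∈ dualSet D
    · obtain ⟨x, hx, hxe, -, hl⟩ :=
        IsOracle.exists_flow N hG hD.gamma_nonneg hD.dem_pos hy
      exact ⟨x, fun _ => ⟨hx, hxe, hl⟩⟩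
    · exact ⟨0, fun h => absurd h hy⟩
  choose x hx using hex
  refine ⟨fun w p => average hist fun y => x y w p, fun w hwod => ⟨fun p hp => ?_, ?_⟩,
    fun e => ?_, fun hg => ?_⟩
  · exact div_nonneg (wsum_nonneg (c := fun y => x y w p) (fun q hq => (hpos q hq).1)
      fun q hq => ((hx q.2 (hpos q hq).2).1 w hwod).1 p hp) hw.le
  · simp only [average_eq]
    rw [← Finset.sum_div, ← wsum_sum, wsum_congr (c' := fun _ => D.dem w)
      fun q hq => ((hx q.2 (hpos q hq).2).1 w hwod).2, wsum_const, mul_div_cancel_left₀ _ hw.ne']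
  · rw [avgFlow, average_eq, wsum_congr (c' := fun y => edgeFlow N (x y) e)
      fun q hq => ((hx q.2 (hpos q hq).2).2.1 e).symm]
    simp only [edgeFlow, wsum_sum, wsum_mul, average_eq, Finset.sum_div, mul_div_assoc]
  · funext w p
    simp only [avgRoute, average_eq]
    rw [wsum_congr (c' := fun y => logitFlow N D y w p)
      fun q hq => by rw [(hx q.2 (hpos q hq).2).2.2 hg]]

theorem avgFlow_nil (e : Fin n) : avgFlow G [] e = 0 := by simp [avgFlow, average]

theorem avgFlow_bounds (hD : Valid N M D) (hG : IsOracle N D G)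
    {hist : List (ℝ × (Fin n → ℝ))} (hpos : ∀ q ∈ hist, 0 < q.1 ∧ q.2 ∈ dualSet D) (e : Fin n) :
    0 ≤ avgFlow G hist e ∧ avgFlow G hist e ≤ totalDemand N D * Real.sqrt N.H := by
  by_cases hne : hist = []
  · rw [hne, avgFlow_nil]
    exact ⟨le_rfl, mul_nonneg hD.demand_pos.le (Real.sqrt_nonneg _)⟩
  · obtain ⟨x, hx, hxe, -⟩ := exists_avg hD hG hne hpos
    rw [← hxe]
    exact ⟨edgeFlow_nonneg hx e, edgeFlow_le hx e⟩

theorem Valid.R_nonneg (hD : Valid N .stable D) : 0 ≤ D.R := by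
  obtain ⟨t, -, -, h⟩ := hD.stable rfl
  rw [h]; exact Real.sqrt_nonneg _

theorem violation_sq (hist : List (ℝ × (Fin n → ℝ))) :
    violation D G hist ^ 2 = ∑ e, (max (avgFlow G hist e - D.fbar e) 0) ^ 2 :=
  Real.sq_sqrt (Finset.sum_nonneg fun _ _ => sq_nonneg _)

/-- The primal part of the gap. -/
def primalTerm (M : Model) (D : Data v n) (G : (Fin n → ℝ) → Fin n → ℝ)
    (hist : List (ℝ × (Fin n → ℝ))) : ℝ :=
  match M with
  | .beckmann => ∑ e, sigma D e (avgFlow G hist e)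
  | .stable => ∑ e, avgFlow G hist e * D.tbar e + 3 * D.R * violation D G hist

theorem gap_eq (s : State n) : gap N M D G s
    = dual N M D s.t + primalTerm M D G s.hist + avgEntropy N D s.hist := by
  cases M <;> rfl

/-- The point that converts the minimum of φ into a bound on the gap. For Beckmann it is τ(averaged
flow), at which the conjugate is attained. For stable dynamics a shift of length 3R along the
violation produces exactly the penalty in the gap. -/
theorem exists_test_point (hD : Valid N M D) (hG : IsOracle N D G)
    {hist : List (ℝ × (Fin n → ℝ))} (hpos : ∀ q ∈ hist, 0 < q.1 ∧ q.2 ∈ dualSet D) :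
    ∃ t ∈ dualSet D, (1 / 2) * ∑ e, (t e - D.tbar e) ^ 2 ≤ radius M D G hist ^ 2 ∧
      composite M D t - ∑ e, avgFlow G hist e * t e ≤ -primalTerm M D G hist := by
  have hb := avgFlow_bounds hD hG hpos
  cases M with
  | beckmann =>
    obtain ⟨hr, hm⟩ := hD.beckmann rfl
    refine ⟨fun e => tau D e (avgFlow G hist e), fun e => ?_, ?_, ?_⟩
    · rw [← tau_zero (D := D) (e := e) hm]
      exact tau_mono (hD.tbar_pos e) (hD.fbar_pos e) hr hm le_rfl (hb e).1
    · rw [radius, Real.sq_sqrt]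
      exact mul_nonneg (by norm_num) (Finset.sum_nonneg fun _ _ => sq_nonneg _)
    · simp only [composite, primalTerm]
      rw [← Finset.sum_sub_distrib, ← Finset.sum_neg_distrib]
      refine Finset.sum_le_sum fun e _ => ?_
      rw [sigmaStar_tau (hD.tbar_pos e) (hD.fbar_pos e) hr hm (hb e).1]
      linarith
  | stable =>
    have hR := hD.R_nonneg
    set V := violation D G hist with hV
    have hV0 : 0 ≤ V := Real.sqrt_nonneg _
    set p : Fin n → ℝ := fun e => max (avgFlow G hist e - D.fbar e) 0 with hp
    have hpV : ∑ e, p e ^ 2 = V ^ 2 := (violation_sq hist).symm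
    have hp0 : ∀ e, 0 ≤ p e := fun e => le_max_right _ _
    -- If V = 0 the quotient is 0 by convention and the test point is t̄. Otherwise half the squared
    -- shift is 9R²/2 ≤ 5R², which explains √5 in R̄.
    set c := 3 * D.R / V with hc
    have hc0 : 0 ≤ c := by positivity
    have hcV : c * V ^ 2 = 3 * D.R * V := by
      rcases hV0.eq_or_lt with h | h
      · rw [← h]; ring
      · rw [hc]; field_simp
    have hcV2 : c * V ≤ 3 * D.R := by
      rcases hV0.eq_or_lt with h | h
      · rw [← h, mul_zero]; linarith
      · rw [hc, div_mul_cancel₀ _ h.ne']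
    refine ⟨fun e => D.tbar e + c * p e, fun e => ?_, ?_, ?_⟩
    · exact le_add_of_nonneg_right (mul_nonneg hc0 (hp0 e))
    · simp only [add_sub_cancel_left, mul_pow, radius]
      rw [← Finset.mul_sum, hpV, Real.sq_sqrt (by norm_num)]
      have : (c * V) ^ 2 ≤ (3 * D.R) ^ 2 := by gcongr
      nlinarith [sq_nonneg D.R]
    · simp only [composite, primalTerm]
      have : ∑ e, D.fbar e * (D.tbar e + c * p e - D.tbar e)
          - ∑ e, avgFlow G hist e * (D.tbar e + c * p e)
          = -∑ e, avgFlow G hist e * D.tbar e - c * ∑ e, p e ^ 2 := by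
        rw [← Finset.sum_sub_distrib, Finset.mul_sum, ← Finset.sum_neg_distrib,
          ← Finset.sum_sub_distrib]
        refine Finset.sum_congr rfl fun e _ => ?_
        have : p e * (avgFlow G hist e - D.fbar e) = p e ^ 2 := by
          simp only [hp]
          rcases le_total (avgFlow G hist e - D.fbar e) 0 with h | h
          · rw [max_eq_right h]; ring
          · rw [max_eq_left h]; ring
        linear_combination -c * this
      rw [this, hpV, hcV]
      linarith

/-- The invariant puts A·F(t) below φ at its minimizer, hence below φ at the test point, which
contains minus the primal and entropy parts of the gap. -/
theorem weight_mul_gap_le (hD : Valid N M D) (hG : IsOracle N D G) {s : State n}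
    (hs : (dualProblem N M D G).Inv s) (hne : s.hist ≠ []) :
    s.A * gap N M D G s ≤ radius M D G s.hist ^ 2 + s.A * (D.eps / 2) := by
  obtain ⟨t, ht, h1, h2⟩ := exists_test_point hD hG hs.hist_pos
  have h3 := hs.growth t ht
  have h4 := hs.estimate
  have h5 : 0 ≤ ∑ e, (t e - s.u e) ^ 2 := Finset.sum_nonneg fun _ _ => sq_nonneg _
  rw [phi_dual hD hG hne hs.hist_pos t] at h3
  have hA : s.A = weight s.hist := hs.A_eq
  rw [← hA] at h3
  have h6 := mul_le_mul_of_nonneg_left h2 hs.A_nonneg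
  rw [gap_eq]
  change s.A * dual N M D s.t ≤ _ + s.A * (D.eps / 2) at h4
  rw [mul_add, mul_add]
  have h7 : s.A * (composite M D t - avgEntropy N D s.hist - ∑ e, avgFlow G s.hist e * t e)
      = s.A * (composite M D t - ∑ e, avgFlow G s.hist e * t e)
        - s.A * avgEntropy N D s.hist := by ring
  rw [h7] at h3
  linarith

/-- If the stopping rule is not met, the total weight is bounded. -/
theorem weight_le_of_not_stop (hD : Valid N M D) (hG : IsOracle N D G) {s : State n}
    (hs : (dualProblem N M D G).Inv s) (hterm : ¬ Stop N M D G s) :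
    s.A ≤ 2 * radius M D G s.hist ^ 2 / D.eps := by
  by_cases hne : s.hist = []
  · have : s.A = 0 := by rw [hs.A_eq, hne]; rfl
    rw [this]
    have := hD.eps_pos
    positivity
  · have h1 : D.eps ≤ gap N M D G s := by
      by_contra h
      exact hterm ⟨hne, not_le.mp h⟩
    have h2 := weight_mul_gap_le hD hG hs hne
    have h3 := mul_le_mul_of_nonneg_left h1 hs.A_nonneg
    rw [le_div_iff₀ hD.eps_pos]
    linarith

/-- R̃ is defined through the stopping time and cannot be used to prove termination. Averaged flows
never exceed d√H, which gives a bound independent of the history. -/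
theorem exists_radius_bound (hD : Valid N M D) (hG : IsOracle N D G) :
    ∃ B, ∀ hist : List (ℝ × (Fin n → ℝ)), (∀ q ∈ hist, 0 < q.1 ∧ q.2 ∈ dualSet D) →
      radius M D G hist ^ 2 ≤ B := by
  cases M with
  | beckmann =>
    obtain ⟨hr, hm⟩ := hD.beckmann rfl
    refine ⟨(1 / 2) * ∑ e, (tau D e (totalDemand N D * Real.sqrt N.H) - D.tbar e) ^ 2,
      fun hist hpos => ?_⟩
    rw [radius, Real.sq_sqrt
      (mul_nonneg (by norm_num) (Finset.sum_nonneg fun _ _ => sq_nonneg _))]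
    refine mul_le_mul_of_nonneg_left (Finset.sum_le_sum fun e _ => ?_) (by norm_num)
    have hb := avgFlow_bounds hD hG hpos e
    have h1 : D.tbar e ≤ tau D e (avgFlow G hist e) := by
      rw [← tau_zero (D := D) (e := e) hm]
      exact tau_mono (hD.tbar_pos e) (hD.fbar_pos e) hr hm le_rfl hb.1
    have h2 := tau_mono (hD.tbar_pos e) (hD.fbar_pos e) hr hm hb.1 hb.2
    exact pow_le_pow_left₀ (by linarith) (by linarith) 2
  | stable => exact ⟨(Real.sqrt 5 * D.R) ^ 2, fun hist _ => le_rfl⟩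

/-! ### Accuracy at the stop -/

/-- Jensen's inequality for x·ln x. It is applied termwise through the tangent at the average, which
is positive because logit flows are. -/
theorem entropy_avgRoute_le (hD : Valid N M D) (hg : 0 < D.gamma)
    {hist : List (ℝ × (Fin n → ℝ))} (hne : hist ≠ [])
    (hpos : ∀ q ∈ hist, 0 < q.1 ∧ q.2 ∈ dualSet D) :
    D.gamma * entropy N D (avgRoute N D hist) ≤ avgEntropy N D hist := by
  have hw := weight_pos (fun q hq => (hpos q hq).1) hne
  refine mul_le_mul_of_nonneg_left ?_ hg.le
  unfold entropy
  simp only [average_eq, wsum_sum, Finset.sum_div]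
  refine Finset.sum_le_sum fun w hwod => Finset.sum_le_sum fun p _ => ?_
  have hd := hD.dem_pos w hwod
  have hxpos : ∀ y, 0 < logitFlow N D y w p := fun y => logitFlow_pos N hD.dem_pos y hwod p
  set c : (Fin n → ℝ) → ℝ := fun y => logitFlow N D y w p with hc
  have havg : avgRoute N D hist w p = wsum hist c / weight hist := rfl
  have hA : wsum hist c = weight hist * avgRoute N D hist w p := by
    rw [havg]; field_simp
  set a := avgRoute N D hist w p with ha
  have ha0 : 0 < a := by
    have h1 : 0 < wsum hist c := by
      cases hist with
      | nil => exact absurd rfl hne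
      | cons q l =>
        rw [wsum_cons]
        exact add_pos_of_pos_of_nonneg (mul_pos (hpos q (by simp)).1 (hxpos q.2))
          (wsum_nonneg (fun r hr => (hpos r (by simp [hr])).1) fun r _ => (hxpos r.2).le)
    rw [havg]; exact div_pos h1 hw
  rw [le_div_iff₀ hw]
  have htan : ∀ y, a * Real.log (a / D.dem w) + (Real.log (a / D.dem w) + 1) * (c y - a)
      ≤ c y * Real.log (c y / D.dem w) := by
    intro y
    have hcy := hxpos y
    change 0 < c y at hcy
    have h1 := Real.log_le_sub_one_of_pos (div_pos ha0 hcy)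
    rw [Real.log_div ha0.ne' hcy.ne'] at h1
    rw [Real.log_div ha0.ne' hd.ne', Real.log_div hcy.ne' hd.ne']
    have h2 := mul_le_mul_of_nonneg_left h1 hcy.le
    have h3 : c y * (a / c y - 1) = a - c y := by field_simp
    rw [h3] at h2
    nlinarith
  have h := wsum_mono
    (c := fun y => a * Real.log (a / D.dem w) + (Real.log (a / D.dem w) + 1) * (c y - a))
    (c' := fun y => c y * Real.log (c y / D.dem w)) (fun q hq => (hpos q hq).1)
    fun q _ => htan q.2
  rw [wsum_add, wsum_const, wsum_mul] at h
  have h2 : wsum hist (fun y => c y - a) = 0 := by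
    have h3 := wsum_add hist c fun _ => -a
    rw [wsum_const, hA] at h3
    simp only [← sub_eq_add_neg] at h3
    rw [h3]; ring
  rw [h2] at h
  linarith

/-- The primal objective without the entropy. -/
def edgeObjective (M : Model) (D : Data v n) (f : Fin n → ℝ) : ℝ :=
  match M with
  | .beckmann => ∑ e, sigma D e (f e)
  | .stable => ∑ e, f e * D.tbar e

theorem primal_eq (g : ℝ) (x : Fin v × Fin v → List (Fin n) → ℝ) :
    primal N M D g x = edgeObjective M D (edgeFlow N x) + g * entropy N D x := by
  cases M <;> rfl

theorem feasible_mem {z : Fin v × Fin v → List (Fin n) → ℝ} (hz : z ∈ Feasible N M D) :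
    z ∈ FlowSet N D := by
  cases M with
  | beckmann => exact hz
  | stable => exact hz.1

/-- Weak duality, from the Gibbs inequality for Φ and Fenchel's inequality for h. In stable dynamics
the latter uses the capacity constraint and t ≥ t̄. -/
theorem neg_dual_le_primal (hD : Valid N M D) {z : Fin v × Fin v → List (Fin n) → ℝ}
    (hz : z ∈ Feasible N M D) {t : Fin n → ℝ} (ht : t ∈ dualSet D) :
    -dual N M D t ≤ primal N M D D.gamma z := by
  have hzF := feasible_mem hz
  have h1 := neg_edgeFlow_le_potential N hD.gamma_nonneg hD.dem_pos hzF t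
  have h2 : ∑ e, edgeFlow N z e * t e - composite M D t
      ≤ edgeObjective M D (edgeFlow N z) := by
    cases M with
    | beckmann =>
      obtain ⟨hr, hm⟩ := hD.beckmann rfl
      simp only [composite, edgeObjective]
      rw [← Finset.sum_sub_distrib]
      refine Finset.sum_le_sum fun e _ => ?_
      have := le_sigmaStar (hD.tbar_pos e) (hD.fbar_pos e) hr hm (ht e) (edgeFlow_nonneg hzF e)
      linarith
    | stable =>
      simp only [composite, edgeObjective]
      rw [← Finset.sum_sub_distrib]
      refine Finset.sum_le_sum fun e _ => ?_
      have h3 := mul_nonneg (sub_nonneg.mpr (hz.2 e)) (sub_nonneg.mpr (ht e))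
      nlinarith
  rw [primal_eq, dual]
  linarith

theorem avg_le_dual (hD : Valid N M D) (hG : IsOracle N D G) {hist : List (ℝ × (Fin n → ℝ))}
    (hne : hist ≠ []) (hpos : ∀ q ∈ hist, 0 < q.1 ∧ q.2 ∈ dualSet D) (t : Fin n → ℝ) :
    -avgEntropy N D hist - ∑ e, avgFlow G hist e * t e + composite M D t ≤ dual N M D t := by
  have hw := weight_pos (fun q hq => (hpos q hq).1) hne
  have h1 := wsum_lin hD hG hne hpos t
  have h2 : wsum hist (fun y => (dualProblem N M D G).lin y t)
      ≤ wsum hist fun _ => potential N D t :=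
    wsum_mono (fun q hq => (hpos q hq).1) fun q hq => hG q.2 (hpos q hq).2 t
  rw [h1, wsum_const] at h2
  have := le_of_mul_le_mul_left h2 hw
  rw [dual]; linarith

/-- A lower bound for F by the recovered flow. For Beckmann this is Fenchel's inequality at any t.
For stable dynamics the averaged flow may be infeasible, and the bound is taken at the dual
solution: the violation costs at most 2R times its norm by Cauchy–Schwarz, out of the 3R contained
in `primalTerm`. -/
theorem edgeObjective_add_dual_ge (hD : Valid N M D) (hG : IsOracle N D G)
    {hist : List (ℝ × (Fin n → ℝ))} (hne : hist ≠ [])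
    (hpos : ∀ q ∈ hist, 0 < q.1 ∧ q.2 ∈ dualSet D) {t : Fin n → ℝ} (ht : t ∈ dualSet D) :
    (M = .beckmann → -(primalTerm M D G hist + avgEntropy N D hist) ≤ dual N M D t) ∧
    (M = .stable → -(primalTerm M D G hist + avgEntropy N D hist)
      + D.R * violation D G hist ≤ dual N M D t) := by
  refine ⟨?_, ?_⟩ <;> rintro rfl
  · obtain ⟨hr, hm⟩ := hD.beckmann rfl
    have h1 := avg_le_dual hD hG hne hpos t
    have h2 : ∑ e, avgFlow G hist e * t e - composite .beckmann D t
        ≤ primalTerm .beckmann D G hist := by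
      simp only [composite, primalTerm]
      rw [← Finset.sum_sub_distrib]
      refine Finset.sum_le_sum fun e _ => ?_
      have := le_sigmaStar (hD.tbar_pos e) (hD.fbar_pos e) hr hm (ht e)
        (avgFlow_bounds hD hG hpos e).1
      linarith
    linarith
  · obtain ⟨ts, hts, hopt, hR⟩ := hD.stable rfl
    refine le_trans ?_ (hopt t ht)
    refine le_trans ?_ (avg_le_dual hD hG hne hpos ts)
    have hR0 := hD.R_nonneg
    have hV0 : 0 ≤ violation D G hist := Real.sqrt_nonneg _
    -- By the definition of R the distance of the dual solution from t̄ is √2·R.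
    have hnorm : Real.sqrt (∑ e, (ts e - D.tbar e) ^ 2) ≤ 2 * D.R := by
      have h0 : 0 ≤ ∑ e, (ts e - D.tbar e) ^ 2 := Finset.sum_nonneg fun _ _ => sq_nonneg _
      have hsq : D.R ^ 2 = 1 / 2 * ∑ e, (ts e - D.tbar e) ^ 2 := by
        rw [hR, Real.sq_sqrt (by linarith)]
      rw [Real.sqrt_le_left (by linarith)]
      nlinarith
    have hcs : ∑ e, max (avgFlow G hist e - D.fbar e) 0 * (ts e - D.tbar e)
        ≤ violation D G hist * (2 * D.R) := by
      refine (Real.sum_mul_le_sqrt_mul_sqrt _ _ _).trans ?_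
      exact mul_le_mul_of_nonneg_left hnorm hV0
    have h2 : ∑ e, avgFlow G hist e * ts e - composite .stable D ts
        ≤ ∑ e, avgFlow G hist e * D.tbar e
          + ∑ e, max (avgFlow G hist e - D.fbar e) 0 * (ts e - D.tbar e) := by
      simp only [composite]
      rw [← Finset.sum_sub_distrib, ← Finset.sum_add_distrib]
      refine Finset.sum_le_sum fun e _ => ?_
      have := mul_le_mul_of_nonneg_right (le_max_left (avgFlow G hist e - D.fbar e) 0)
        (sub_nonneg.mpr (hts e))
      nlinarith
    simp only [primalTerm]
    linarith

/-- The dual value plus the primal and entropy terms is below ε. Bounding one side by weak duality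
yields the accuracy of the other; in stable dynamics the surplus in the lower bound of F also yields
the bound on the violation. -/
theorem accurate_of_stop (hD : Valid N M D) (hG : IsOracle N D G) {s : State n}
    (hs : (dualProblem N M D G).Inv s) (hterm : Stop N M D G s) :
    PrimalAccurate N M D G D.gamma D.eps s ∧ DualAccurate N M D D.eps s := by
  obtain ⟨hne, hgap⟩ := hterm
  have hpos : ∀ q ∈ s.hist, 0 < q.1 ∧ q.2 ∈ dualSet D := hs.hist_pos
  have ht : s.t ∈ dualSet D := hs.t_mem
  have hlow := fun {t} ht => edgeObjective_add_dual_ge (t := t) hD hG hne hpos ht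
  rw [gap_eq] at hgap
  obtain ⟨x, hx, hxe, hxa⟩ := exists_avg hD hG hne hpos
  have hent : D.gamma * entropy N D x ≤ avgEntropy N D s.hist := by
    rcases hD.gamma_nonneg.eq_or_lt with h | h
    · rw [avgEntropy, ← h, zero_mul, zero_mul]
    · rw [hxa h]; exact entropy_avgRoute_le hD h hne hpos
  have hobj : edgeObjective M D (edgeFlow N x) ≤ primalTerm M D G s.hist := by
    rw [show edgeFlow N x = avgFlow G s.hist from funext hxe]
    cases M with
    | beckmann => exact le_rfl
    | stable =>
      have hR0 := hD.R_nonneg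
      have hV0 : 0 ≤ violation D G s.hist := Real.sqrt_nonneg _
      simp only [edgeObjective, primalTerm]
      have : 0 ≤ 3 * D.R * violation D G s.hist := by positivity
      linarith
  have hviol : M = .stable → 0 ≤ D.R * violation D G s.hist := by
    rintro rfl
    exact mul_nonneg hD.R_nonneg (Real.sqrt_nonneg _)
  refine ⟨⟨⟨x, hx, hxe, hxa, fun z hz => ?_⟩, fun hM => ?_⟩, ht, fun z hz => ?_⟩
  · have h1 := neg_dual_le_primal hD hz ht
    rw [primal_eq]
    linarith
  · have h1 := (hlow ht).2 hM
    linarith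
  · cases hM : M with
    | beckmann =>
      subst hM
      have h1 := (hlow hz).1 rfl
      linarith
    | stable =>
      subst hM
      have h1 := (hlow hz).2 rfl
      have := hviol rfl
      linarith

end Traffic

/-! ### Acceptance thresholds, termination and the number of trials -/

namespace Traffic

variable {v n : ℕ} {N : Network v n} {M : Model} {D : Data v n} {G : (Fin n → ℝ) → Fin n → ℝ}

/-- The quadratic majorant of Φ suffices for the test; the slack involving ε is not needed here. -/
theorem accepts_of_pos (hD : Valid N M D) (hg : 0 < D.gamma) (hG : IsOracle N D G) {s : State n}
    (hs : (dualProblem N M D G).Inv s) (hL : 4 * N.H * totalDemand N D / D.gamma ≤ s.L) :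
    (dualProblem N M D G).Accepts s := by
  have hy := (regular_dualProblem hD hG).nextY_mem hs
  obtain ⟨x, -, hxe, -, hlog⟩ := IsOracle.exists_flow N hG hD.gamma_nonneg hD.dem_pos hy
  have h := potential_le_of_pos N hg hD.dem_pos (Composite.nextY s)
    ((dualProblem N M D G).nextT s)
  rw [← hlog hg] at h
  simp only [hxe, neg_mul, Finset.sum_neg_distrib, sub_neg_eq_add] at h
  have h1 : 0 ≤ Composite.alpha s / (2 * Composite.nextA s) * D.eps := by
    have := Composite.alpha_pos hs.L_pos
    have := hs.nextA_pos
    have := hD.eps_pos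
    positivity
  have h2 : 4 * N.H * totalDemand N D / D.gamma / 2
        * ∑ e, ((dualProblem N M D G).nextT s e - Composite.nextY s e) ^ 2
      ≤ s.L / 2 * ∑ e, ((dualProblem N M D G).nextT s e - Composite.nextY s e) ^ 2 :=
    mul_le_mul_of_nonneg_right (by linarith) (Finset.sum_nonneg fun _ _ => sq_nonneg _)
  refine h.trans ?_
  refine le_trans ?_ (le_add_of_nonneg_right h1)
  exact add_le_add_right h2 _

/-- With m = 2d√H, Young's inequality gives m·r ≤ (L/2)·r² + m²/(2L). By L·α² = A' the slack of the
test is ε/(2Lα), and it covers the last term as soon as α·m² ≤ ε. -/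
theorem accepts_of_nonneg (hD : Valid N M D) (hG : IsOracle N D G) {s : State n}
    (hs : (dualProblem N M D G).Inv s)
    (hL : Composite.alpha s * (4 * N.H * totalDemand N D ^ 2) ≤ D.eps) :
    (dualProblem N M D G).Accepts s := by
  have hreg := regular_dualProblem hD hG
  have h := IsOracle.potential_le_of_zero N hG hD.gamma_nonneg hD.dem_pos (hreg.nextY_mem hs)
    (hreg.nextT_mem hs)
  refine h.trans ?_
  have hLp := hs.L_pos
  have ha := Composite.alpha_pos hLp
  have hd := hD.demand_pos
  set r := Real.sqrt (∑ e, ((dualProblem N M D G).nextT s e - Composite.nextY s e) ^ 2) with hr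
  have hr2 : r ^ 2 = ∑ e, ((dualProblem N M D G).nextT s e - Composite.nextY s e) ^ 2 :=
    Real.sq_sqrt (Finset.sum_nonneg fun _ _ => sq_nonneg _)
  have hm : (2 * totalDemand N D * Real.sqrt N.H) ^ 2 = 4 * N.H * totalDemand N D ^ 2 := by
    rw [mul_pow, Real.sq_sqrt (Nat.cast_nonneg _)]; ring
  set m := 2 * totalDemand N D * Real.sqrt N.H with hmdef
  have h1 : Composite.alpha s / (2 * Composite.nextA s) * D.eps
      = D.eps / (2 * s.L * Composite.alpha s) := by
    rw [← Composite.alpha_sq hLp hs.A_nonneg]; field_simp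
  have h2 : m ^ 2 / (2 * s.L) ≤ D.eps / (2 * s.L * Composite.alpha s) := by
    rw [hm, div_le_div_iff₀ (by positivity) (by positivity)]
    nlinarith
  have h3 : m * r ≤ s.L / 2 * r ^ 2 + m ^ 2 / (2 * s.L) := by
    have : s.L / 2 * r ^ 2 + m ^ 2 / (2 * s.L) - m * r = (s.L * r - m) ^ 2 / (2 * s.L) := by
      field_simp; ring
    have h0 : 0 ≤ (s.L * r - m) ^ 2 / (2 * s.L) := by positivity
    linarith
  have h4 : m * r ≤ s.L / 2 * ∑ e, ((dualProblem N M D G).nextT s e - Composite.nextY s e) ^ 2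
      + Composite.alpha s / (2 * Composite.nextA s) * D.eps := by
    rw [h1, ← hr2]; linarith
  have h5 := add_le_add_right h4 ((dualProblem N M D G).lin (Composite.nextY s)
    ((dualProblem N M D G).nextT s))
  rw [← add_assoc] at h5
  exact h5

theorem stop_step_iff_of_not_accepts {s : State n} (h : ¬ (dualProblem N M D G).Accepts s) :
    Stop N M D G ((dualProblem N M D G).step s) ↔ Stop N M D G s := by
  rw [Composite.step_of_not_accepts h]; rfl

/-- A rejected trial changes only L, so it cannot cause the stop. -/
theorem StopsAfter.accepts {m : ℕ} (h : StopsAfter N M D G (m + 1)) :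
    (dualProblem N M D G).Accepts ((dualProblem N M D G).state m) := by
  by_contra hacc
  have h1 := h.1
  rw [Composite.state_succ, stop_step_iff_of_not_accepts hacc] at h1
  exact h.2 m (Nat.lt_succ_self m) h1

theorem not_stop_zero : ¬ Stop N M D G ((dualProblem N M D G).state 0) := fun h => h.1 rfl

theorem StopsAfter.exists_succ {m : ℕ} (h : StopsAfter N M D G m) : ∃ k, m = k + 1 := by
  cases m with
  | zero => exact absurd h.1 not_stop_zero
  | succ k => exact ⟨k, rfl⟩

theorem A_mono (hD : Valid N M D) (hG : IsOracle N D G) :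
    Monotone fun k => ((dualProblem N M D G).state k).A := by
  refine monotone_nat_of_le_succ fun k => ?_
  have hs := (regular_dualProblem hD hG).inv_state (n := n) k
  rw [Composite.state_succ]
  by_cases h : (dualProblem N M D G).Accepts ((dualProblem N M D G).state k)
  · rw [Composite.step_of_accepts h]
    exact le_add_of_nonneg_right (Composite.alpha_pos hs.L_pos).le
  · rw [Composite.step_of_not_accepts h]

theorem StopsAfter.A_le (hD : Valid N M D) (hG : IsOracle N D G) {m : ℕ}
    (h : StopsAfter N M D G m) {k : ℕ} (hk : k < m) : ((dualProblem N M D G).state k).A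
      ≤ 2 * Rbar M D G ((dualProblem N M D G).state m) ^ 2 / D.eps := by
  obtain ⟨m, rfl⟩ := h.exists_succ
  refine (A_mono hD hG (Nat.lt_succ_iff.mp hk)).trans ?_
  have h1 := weight_le_of_not_stop hD hG ((regular_dualProblem hD hG).inv_state m)
    (h.2 m (Nat.lt_succ_self m))
  -- The last trial is accepted. Dropping the latest pair of the final history therefore returns the
  -- history at which the stopping rule still failed.
  rw [Rbar_eq, Composite.state_succ, Composite.step_of_accepts h.accepts]
  exact h1

/-- A bound for the number of trials in terms of the total weight implies that the method stops. -/
theorem exists_stopsAfter (hD : Valid N M D) (hG : IsOracle N D G) {f : ℝ → ℝ}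
    (hf : ∀ X, 0 ≤ X → ∀ m, (∀ k < m, ((dualProblem N M D G).state k).A ≤ X) → (m : ℝ) ≤ f X) :
    ∃ m, StopsAfter N M D G m := by
  classical
  obtain ⟨B, hB⟩ := exists_radius_bound (N := N) (M := M) hD hG
  have hB0 : 0 ≤ B := (sq_nonneg _).trans (hB [] (by simp))
  have hex : ∃ m, Stop N M D G ((dualProblem N M D G).state m) := by
    by_contra hno
    push Not at hno
    have hbound : ∀ k, ((dualProblem N M D G).state k).A ≤ 2 * B / D.eps := by
      intro k
      have hs := (regular_dualProblem hD hG).inv_state (n := n) k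
      refine (weight_le_of_not_stop hD hG hs (hno k)).trans ?_
      have := hB _ hs.hist_pos
      have := hD.eps_pos
      gcongr
    obtain ⟨m, hm⟩ := exists_nat_gt (f (2 * B / D.eps))
    have := hf (2 * B / D.eps) (div_nonneg (by linarith) hD.eps_pos.le) m fun k _ => hbound k
    linarith
  exact ⟨Nat.find hex, Nat.find_spec hex, fun k hk => Nat.find_min hex hk⟩

theorem trials_le_of_pos (hD : Valid N M D) (hg : 0 < D.gamma) (hG : IsOracle N D G) {X : ℝ}
    {m : ℕ} (hX : ∀ k < m, ((dualProblem N M D G).state k).A ≤ X) :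
    (m : ℝ) ≤ 16 * (1 + |Real.log (D.L0 / (4 * N.H * totalDemand N D / D.gamma))|
      + Real.sqrt (4 * N.H * totalDemand N D / D.gamma * X)) := by
  have hH : (0 : ℝ) < N.H := by exact_mod_cast N.H_pos
  have hd := hD.demand_pos
  exact (regular_dualProblem hD hG).trials_le_smooth (by positivity)
    (fun s hs hL => accepts_of_pos hD hg hG hs hL) hX

theorem trials_le_of_nonneg (hD : Valid N M D) (hG : IsOracle N D G) {X : ℝ} (hX0 : 0 ≤ X)
    {m : ℕ} (hX : ∀ k < m, ((dualProblem N M D G).state k).A ≤ X) :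
    (m : ℝ) ≤ 20 * (1 + |Real.log (D.L0 * D.eps / (4 * N.H * totalDemand N D ^ 2))|
      + 4 * N.H * totalDemand N D ^ 2 * X / D.eps) := by
  have hH : (0 : ℝ) < N.H := by exact_mod_cast N.H_pos
  have hd := hD.demand_pos
  exact (regular_dualProblem hD hG).trials_le_nonsmooth (by positivity) hX0
    (fun s hs hL => accepts_of_nonneg hD hG hs hL) hX

theorem abs_log_div_four_le {x : ℝ} (hx : 0 < x) : |Real.log (x / 4)| ≤ |Real.log x| + 2 := by
  rw [Real.log_div hx.ne' (by norm_num)]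
  refine (abs_sub _ _).trans ?_
  have h4 : Real.log 4 = 2 * Real.log 2 := by
    rw [show (4 : ℝ) = 2 ^ 2 by norm_num, Real.log_pow]; norm_num
  have h0 : 0 < 2 * Real.log 2 := by linarith [Real.log_two_gt_d9]
  rw [h4, abs_of_pos h0]
  linarith [Real.log_two_lt_d9]

theorem StopsAfter.trials_le_smooth (hD : Valid N M D) (hg : 0 < D.gamma) (hG : IsOracle N D G)
    {m : ℕ} (h : StopsAfter N M D G m) :
    (m : ℝ) ≤ 160 * (1 + |Real.log (D.L0 * D.gamma / (N.H * totalDemand N D))|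
      + Real.sqrt (N.H * totalDemand N D
          * Rbar M D G ((dualProblem N M D G).state m) ^ 2 / (D.gamma * D.eps))) := by
  have hH : (0 : ℝ) < N.H := by exact_mod_cast N.H_pos
  have hd := hD.demand_pos
  have hL0 := hD.L0_pos
  have he := hD.eps_pos
  have h1 := trials_le_of_pos hD hg hG fun k hk => h.A_le hD hG hk
  set Rb := Rbar M D G ((dualProblem N M D G).state m)
  have h2 : 4 * N.H * totalDemand N D / D.gamma * (2 * Rb ^ 2 / D.eps)
      = 8 * (N.H * totalDemand N D * Rb ^ 2 / (D.gamma * D.eps)) := by field_simp; ring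
  have h3 : D.L0 / (4 * N.H * totalDemand N D / D.gamma)
      = D.L0 * D.gamma / (N.H * totalDemand N D) / 4 := by field_simp
  -- The 8 is the factor 4 in the Lipschitz constant times the 2 in A ≤ 2R̄²/ε. In the non-smooth
  -- bound it enters without a root, and 160 = 20·8.
  have h4 : Real.sqrt 8 ≤ 3 := by rw [Real.sqrt_le_left (by norm_num)]; norm_num
  rw [h2, h3, Real.sqrt_mul (by norm_num)] at h1
  have h5 := abs_log_div_four_le (x := D.L0 * D.gamma / (N.H * totalDemand N D)) (by positivity)
  have h6 := mul_le_mul_of_nonneg_right h4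
    (Real.sqrt_nonneg (N.H * totalDemand N D * Rb ^ 2 / (D.gamma * D.eps)))
  have h7 := Real.sqrt_nonneg (N.H * totalDemand N D * Rb ^ 2 / (D.gamma * D.eps))
  have h8 := abs_nonneg (Real.log (D.L0 * D.gamma / (N.H * totalDemand N D)))
  linarith

theorem StopsAfter.trials_le_nonsmooth (hD : Valid N M D) (hG : IsOracle N D G)
    {m : ℕ} (h : StopsAfter N M D G m) :
    (m : ℝ) ≤ 160 * (1 + |Real.log (D.L0 * D.eps / (N.H * totalDemand N D ^ 2))|
      + N.H * totalDemand N D ^ 2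
          * Rbar M D G ((dualProblem N M D G).state m) ^ 2 / D.eps ^ 2) := by
  have hH : (0 : ℝ) < N.H := by exact_mod_cast N.H_pos
  have hd := hD.demand_pos
  have hL0 := hD.L0_pos
  have he := hD.eps_pos
  have h1 := trials_le_of_nonneg hD hG (by positivity) fun k hk => h.A_le hD hG hk
  set Rb := Rbar M D G ((dualProblem N M D G).state m)
  have h2 : 4 * N.H * totalDemand N D ^ 2 * (2 * Rb ^ 2 / D.eps) / D.eps
      = 8 * (N.H * totalDemand N D ^ 2 * Rb ^ 2 / D.eps ^ 2) := by field_simp; ring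
  have h3 : D.L0 * D.eps / (4 * N.H * totalDemand N D ^ 2)
      = D.L0 * D.eps / (N.H * totalDemand N D ^ 2) / 4 := by field_simp
  rw [h2, h3] at h1
  have h5 := abs_log_div_four_le (x := D.L0 * D.eps / (N.H * totalDemand N D ^ 2)) (by positivity)
  have h8 := abs_nonneg (Real.log (D.L0 * D.eps / (N.H * totalDemand N D ^ 2)))
  linarith

theorem exists_stopsAfter_of_pos (hD : Valid N M D) (hg : 0 < D.gamma) (hG : IsOracle N D G) :
    ∃ m, StopsAfter N M D G m :=
  exists_stopsAfter hD hG fun _ _ _ hX => trials_le_of_pos hD hg hG hX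

theorem exists_stopsAfter_of_zero (hD : Valid N M D) (hG : IsOracle N D G) :
    ∃ m, StopsAfter N M D G m :=
  exists_stopsAfter hD hG fun _ hX0 _ hX => trials_le_of_nonneg hD hG hX0 hX

/-! ### Entropic regularization -/

theorem entropy_nonpos {x : Fin v × Fin v → List (Fin n) → ℝ} (hd : ∀ w ∈ N.od, 0 < D.dem w)
    (hx : x ∈ FlowSet N D) : entropy N D x ≤ 0 := by
  refine Finset.sum_nonpos fun w hw => Finset.sum_nonpos fun p hp => ?_
  have h0 := (hx w hw).1 p hp
  have h1 : x w p ≤ D.dem w := by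
    rw [← (hx w hw).2]
    exact Finset.single_le_sum (fun q hq => (hx w hw).1 q hq) hp
  exact mul_nonpos_of_nonneg_of_nonpos h0
    (Real.log_nonpos (div_nonneg h0 (hd w hw).le) ((div_le_one (hd w hw)).mpr h1))

/-- The entropy is maximal for the uniform distribution over the routes of each pair, by log z ≤ z −
1. -/
theorem neg_entropy_le {x : Fin v × Fin v → List (Fin n) → ℝ} (hd : ∀ w ∈ N.od, 0 < D.dem w)
    (hx : x ∈ FlowSet N D) :
    -entropy N D x ≤ ∑ w ∈ N.od, D.dem w * Real.log ((N.routes w).card : ℝ) := by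
  unfold entropy
  rw [← Finset.sum_neg_distrib]
  refine Finset.sum_le_sum fun w hw => ?_
  rw [← Finset.sum_neg_distrib]
  have hdw := hd w hw
  have hk : (0 : ℝ) < (N.routes w).card := by
    exact_mod_cast Finset.card_pos.mpr (N.routes_nonempty w hw)
  have key : ∀ p ∈ N.routes w, -(x w p * Real.log (x w p / D.dem w)) ≤
      x w p * Real.log ((N.routes w).card : ℝ) + (D.dem w / (N.routes w).card - x w p) := by
    intro p hp
    rcases ((hx w hw).1 p hp).eq_or_lt with h0 | h0
    · rw [← h0]; simp only [zero_mul, neg_zero, zero_add, sub_zero]; positivity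
    · have h1 := Real.log_le_sub_one_of_pos (div_pos hdw (mul_pos hk h0))
      rw [Real.log_div hdw.ne' (by positivity), Real.log_mul hk.ne' h0.ne'] at h1
      rw [Real.log_div h0.ne' hdw.ne']
      have h2 := mul_le_mul_of_nonneg_left h1 h0.le
      have h3 : x w p * (D.dem w / ((N.routes w).card * x w p) - 1)
          = D.dem w / (N.routes w).card - x w p := by field_simp
      rw [h3] at h2
      nlinarith
  refine (Finset.sum_le_sum key).trans (le_of_eq ?_)
  rw [Finset.sum_add_distrib, Finset.sum_sub_distrib, ← Finset.sum_mul, (hx w hw).2,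
    Finset.sum_const, nsmul_eq_mul]
  field_simp
  ring

theorem sum_log_card_le (hD : Valid N M D) :
    ∑ w ∈ N.od, D.dem w * Real.log ((N.routes w).card : ℝ) ≤ totalDemand N D * N.omega := by
  rw [totalDemand, Finset.sum_mul]
  refine Finset.sum_le_sum fun w hw => mul_le_mul_of_nonneg_left ?_ (hD.dem_pos w hw).le
  exact Finset.le_sup' (fun w => Real.log ((N.routes w).card : ℝ)) hw

/-- With E = ∑ d_w ln|P_w|, the product of γ_* and the accuracy ε/2 is ε²/(4E), and E ≤ d·ω. -/
theorem entropic_rate_le (hD : Valid N M D) {ε : ℝ} (he : D.eps = ε / 2)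
    (hE : 0 < ∑ w ∈ N.od, D.dem w * Real.log ((N.routes w).card : ℝ))
    (hg : D.gamma = ε / (2 * ∑ w ∈ N.od, D.dem w * Real.log ((N.routes w).card : ℝ))) (Rb : ℝ) :
    Real.sqrt (N.H * totalDemand N D * Rb ^ 2 / (D.gamma * D.eps))
      ≤ 2 * (totalDemand N D / ε * Real.sqrt (N.H * Rb ^ 2 * N.omega)) := by
  have hd := hD.demand_pos
  have hε : 0 < ε := by have := hD.eps_pos; linarith
  have hle := sum_log_card_le hD
  set E := ∑ w ∈ N.od, D.dem w * Real.log ((N.routes w).card : ℝ) with hEdef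
  have h1 : N.H * totalDemand N D * Rb ^ 2 / (D.gamma * D.eps)
      = (2 / ε) ^ 2 * (N.H * totalDemand N D * Rb ^ 2 * E) := by
    rw [hg, he]; field_simp
  have h2 : N.H * totalDemand N D * Rb ^ 2 * E
      ≤ totalDemand N D ^ 2 * (N.H * Rb ^ 2 * N.omega) := by
    calc _ ≤ N.H * totalDemand N D * Rb ^ 2 * (totalDemand N D * N.omega) := by gcongr
      _ = _ := by ring
  rw [h1, Real.sqrt_mul (sq_nonneg _), Real.sqrt_sq (by positivity)]
  have h3 := Real.sqrt_le_sqrt h2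
  rw [Real.sqrt_mul (sq_nonneg _), Real.sqrt_sq hd.le] at h3
  calc _ ≤ 2 / ε * (totalDemand N D * Real.sqrt (N.H * Rb ^ 2 * N.omega)) := by gcongr
    _ = _ := by ring

/-- On X the entropy lies between −E and 0 and γ_*·E = ε/2, so dropping it costs at most ε/2 beyond
the accuracy ε/2 of the regularized problem. -/
theorem primalAccurate_zero (hD : Valid N M D) {ε : ℝ} (he : D.eps = ε / 2)
    (hE : 0 < ∑ w ∈ N.od, D.dem w * Real.log ((N.routes w).card : ℝ))
    (hg : D.gamma = ε / (2 * ∑ w ∈ N.od, D.dem w * Real.log ((N.routes w).card : ℝ)))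
    {s : State n} (h : PrimalAccurate N M D G D.gamma D.eps s) : PrimalAccurate N M D G 0 ε s := by
  have hε : 0 < ε := by have := hD.eps_pos; linarith
  obtain ⟨⟨x, hx, hxe, hxa, hopt⟩, hviol⟩ := h
  refine ⟨⟨x, hx, hxe, hxa, fun z hz => ?_⟩, fun hM => (hviol hM).trans (by linarith)⟩
  have h1 := hopt z hz
  rw [primal_eq, primal_eq] at h1 ⊢
  have hg0 := hD.gamma_nonneg
  have h2 := mul_nonpos_of_nonneg_of_nonpos hg0 (entropy_nonpos hD.dem_pos (feasible_mem hz))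
  have h3 := mul_le_mul_of_nonneg_left (neg_entropy_le hD.dem_pos hx) hg0
  have h4 : D.gamma * ∑ w ∈ N.od, D.dem w * Real.log ((N.routes w).card : ℝ) = ε / 2 := by
    rw [hg]; field_simp
  rw [h4] at h3
  linarith

end Traffic

namespace Traffic

variable {v n : ℕ}

/-! ### Registers, expressions and their compilation -/

/-- The block of a register; the input registers form block `0`. -/
def blk : Reg v n → ℕ
  | .work i => i.unpair.1
  | _ => 0

/-- A work register of block `b` with two indices. -/
def cell (b l j : ℕ) : Reg v n := .work (Nat.pair b (Nat.pair l j))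

@[simp] theorem blk_cell (b l j : ℕ) : blk (cell b l j : Reg v n) = b := by simp [blk, cell]

@[simp] theorem cell_inj {b l j b' l' j' : ℕ} :
    (cell b l j : Reg v n) = cell b' l' j' ↔ b = b' ∧ l = l' ∧ j = j' := by
  simp [cell, Nat.pair_eq_pair]

@[simp] theorem blk_tbar (e : Fin n) : blk (.tbar e : Reg v n) = 0 := rfl
@[simp] theorem blk_fbar (e : Fin n) : blk (.fbar e : Reg v n) = 0 := rfl
@[simp] theorem blk_dem (w : Fin v × Fin v) : blk (.dem w : Reg v n) = 0 := rfl
@[simp] theorem blk_rho : blk (.rho : Reg v n) = 0 := rfl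
@[simp] theorem blk_mu : blk (.mu : Reg v n) = 0 := rfl
@[simp] theorem blk_gamma : blk (.gamma : Reg v n) = 0 := rfl
@[simp] theorem blk_eps : blk (.eps : Reg v n) = 0 := rfl
@[simp] theorem blk_L0 : blk (.L0 : Reg v n) = 0 := rfl
@[simp] theorem blk_R : blk (.R : Reg v n) = 0 := rfl

/-- Arithmetic expressions. -/
inductive Ex (v n : ℕ)
  | reg (r : Reg v n)
  | num (q : ℚ)
  | un (o : UnOp) (a : Ex v n)
  | bin (o : BinOp) (a b : Ex v n)
  | root (a m c : Ex v n)

namespace Ex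

instance : Add (Ex v n) := ⟨.bin .add⟩
instance : Sub (Ex v n) := ⟨.bin .sub⟩
instance : Mul (Ex v n) := ⟨.bin .mul⟩
instance : Div (Ex v n) := ⟨.bin .div⟩

/-- The power of two expressions. -/
def pow (a b : Ex v n) : Ex v n := .bin .pow a b

/-- The square root of an expression. -/
def sqrt (a : Ex v n) : Ex v n := .un .sqrt a

/-- The exponential of an expression. -/
def exp (a : Ex v n) : Ex v n := .un .exp a

/-- The logarithm of an expression. -/
def log (a : Ex v n) : Ex v n := .un .log a

/-- The value of an expression. -/
def eval (σ : Reg v n → ℝ) : Ex v n → ℝ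
  | reg r => σ r
  | num q => q
  | un o a => o.eval (a.eval σ)
  | bin o a b => o.eval (a.eval σ) (b.eval σ)
  | root a m c => powRoot (a.eval σ) (m.eval σ) (c.eval σ)

/-- The number of operations of an expression. -/
def size : Ex v n → ℕ
  | reg _ => 1
  | num _ => 1
  | un _ a => a.size + 1
  | bin _ a b => a.size + b.size + 1
  | root a m c => a.size + m.size + c.size + 1

/-- All registers of the expression satisfy `p`. -/
def All (p : Reg v n → Prop) : Ex v n → Prop
  | reg r => p r
  | num _ => True
  | un _ a => a.All p
  | bin _ a b => a.All p ∧ b.All p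
  | root a m c => a.All p ∧ m.All p ∧ c.All p

section simps

variable (σ : Reg v n → ℝ) (p : Reg v n → Prop) (a b c : Ex v n) (r : Reg v n) (q : ℚ)

@[simp] theorem eval_reg : (reg r).eval σ = σ r := rfl
@[simp] theorem eval_num : (num q : Ex v n).eval σ = q := rfl
@[simp] theorem eval_add : (a + b).eval σ = a.eval σ + b.eval σ := rfl
@[simp] theorem eval_sub : (a - b).eval σ = a.eval σ - b.eval σ := rfl
@[simp] theorem eval_mul : (a * b).eval σ = a.eval σ * b.eval σ := rfl
@[simp] theorem eval_div : (a / b).eval σ = a.eval σ / b.eval σ := rfl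
@[simp] theorem eval_pow : (a.pow b).eval σ = a.eval σ ^ b.eval σ := rfl
@[simp] theorem eval_sqrt : a.sqrt.eval σ = Real.sqrt (a.eval σ) := rfl
@[simp] theorem eval_exp : a.exp.eval σ = Real.exp (a.eval σ) := rfl
@[simp] theorem eval_log : a.log.eval σ = Real.log (a.eval σ) := rfl
@[simp] theorem eval_root :
    (root a b c).eval σ = powRoot (a.eval σ) (b.eval σ) (c.eval σ) := rfl

@[simp] theorem size_reg : (reg r).size = 1 := rfl
@[simp] theorem size_num : (num q : Ex v n).size = 1 := rfl
@[simp] theorem size_add : (a + b).size = a.size + b.size + 1 := rfl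
@[simp] theorem size_sub : (a - b).size = a.size + b.size + 1 := rfl
@[simp] theorem size_mul : (a * b).size = a.size + b.size + 1 := rfl
@[simp] theorem size_div : (a / b).size = a.size + b.size + 1 := rfl
@[simp] theorem size_pow : (a.pow b).size = a.size + b.size + 1 := rfl
@[simp] theorem size_sqrt : a.sqrt.size = a.size + 1 := rfl
@[simp] theorem size_exp : a.exp.size = a.size + 1 := rfl
@[simp] theorem size_log : a.log.size = a.size + 1 := rfl
@[simp] theorem size_root : (root a b c).size = a.size + b.size + c.size + 1 := rfl

@[simp] theorem all_reg : (reg r).All p ↔ p r := Iff.rfl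
@[simp] theorem all_num : (num q : Ex v n).All p ↔ True := Iff.rfl
@[simp] theorem all_add : (a + b).All p ↔ a.All p ∧ b.All p := Iff.rfl
@[simp] theorem all_sub : (a - b).All p ↔ a.All p ∧ b.All p := Iff.rfl
@[simp] theorem all_mul : (a * b).All p ↔ a.All p ∧ b.All p := Iff.rfl
@[simp] theorem all_div : (a / b).All p ↔ a.All p ∧ b.All p := Iff.rfl
@[simp] theorem all_pow : (a.pow b).All p ↔ a.All p ∧ b.All p := Iff.rfl
@[simp] theorem all_sqrt : a.sqrt.All p ↔ a.All p := Iff.rfl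
@[simp] theorem all_exp : a.exp.All p ↔ a.All p := Iff.rfl
@[simp] theorem all_log : a.log.All p ↔ a.All p := Iff.rfl
@[simp] theorem all_root : (root a b c).All p ↔ a.All p ∧ b.All p ∧ c.All p := Iff.rfl

end simps

/-- The sum of a family of expressions. -/
def sum {ι : Type*} (s : Finset ι) (f : ι → Ex v n) : Ex v n :=
  s.toList.foldr (fun i acc => f i + acc) (num 0)

variable {ι : Type*} (s : Finset ι) (f : ι → Ex v n)

@[simp] theorem eval_sum (σ : Reg v n → ℝ) : (sum s f).eval σ = ∑ i ∈ s, (f i).eval σ := by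
  rw [← Finset.sum_map_toList, sum]
  induction s.toList with
  | nil => simp
  | cons i l ih => simp [ih]

@[simp] theorem size_sum : (sum s f).size = ∑ i ∈ s, ((f i).size + 1) + 1 := by
  rw [← Finset.sum_map_toList, sum]
  induction s.toList with
  | nil => simp
  | cons i l ih => simp only [List.foldr_cons, size_add, ih, List.map_cons, List.sum_cons]; ring

@[simp] theorem all_sum (p : Reg v n → Prop) : (sum s f).All p ↔ ∀ i ∈ s, (f i).All p := by
  have : ∀ l : List ι, (l.foldr (fun i acc => f i + acc) (num 0)).All p
      ↔ ∀ i ∈ l, (f i).All p := by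
    intro l
    induction l with
    | nil => simp
    | cons i l ih => simp [ih]
  rw [sum, this]; simp

theorem All.eval_congr {p : Reg v n → Prop} {σ σ' : Reg v n → ℝ}
    (h : ∀ x, p x → σ' x = σ x) : ∀ {e : Ex v n}, e.All p → e.eval σ' = e.eval σ
  | reg r, he => h r he
  | num _, _ => rfl
  | un o a, he => by simp only [eval]; rw [eval_congr h (e := a) he]
  | bin o a b, he => by
    simp only [eval]; rw [eval_congr h (e := a) he.1, eval_congr h (e := b) he.2]
  | root a m c, he => by
    simp only [eval]
    rw [eval_congr h (e := a) he.1, eval_congr h (e := m) he.2.1, eval_congr h (e := c) he.2.2]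

theorem All.mono {p q : Reg v n → Prop} (h : ∀ x, p x → q x) :
    ∀ {e : Ex v n}, e.All p → e.All q
  | reg r, he => h r he
  | num _, _ => trivial
  | un _ a, he => All.mono (e := a) h he
  | bin _ a b, he => ⟨All.mono (e := a) h he.1, All.mono (e := b) h he.2⟩
  | root a m c, he =>
    ⟨All.mono (e := a) h he.1, All.mono (e := m) h he.2.1, All.mono (e := c) h he.2.2⟩

/-- The registers for intermediate results. -/
def tmp (k : ℕ) : Reg v n := cell 99 k 0

/-- The program that computes the expression into the register `d`, with the registers
`tmp j`, `j ≥ k`, for intermediate results. -/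
def code : Ex v n → Reg v n → ℕ → Prog v n
  | reg r, d, _ => .unary .copy d r
  | num q, d, _ => .const d q
  | un o a, d, k => .seq (a.code (tmp k) (k + 1)) (.unary o d (tmp k))
  | bin o a b, d, k => .seq (a.code (tmp k) (k + 1))
      (.seq (b.code (tmp (k + 1)) (k + 2)) (.binary o d (tmp k) (tmp (k + 1))))
  | root a m c, d, k => .seq (a.code (tmp k) (k + 1))
      (.seq (m.code (tmp (k + 1)) (k + 2))
        (.seq (c.code (tmp (k + 2)) (k + 3))
          (.root d (tmp k) (tmp (k + 1)) (tmp (k + 2)))))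

theorem write_self (σ : Reg v n → ℝ) (r : Reg v n) (x : ℝ) : write σ r x r = x := by
  simp [write]

theorem write_ne (σ : Reg v n → ℝ) {r s : Reg v n} (x : ℝ) (h : s ≠ r) :
    write σ r x s = σ s := by simp [write, h]

/-- Stack discipline: each later operand works only with temporaries above those that hold earlier
results. Source registers lie outside block 99, so evaluating one operand does not disturb the
inputs of the next. -/
theorem code_spec (e : Ex v n) : ∀ (d : Reg v n) (k : ℕ) (σ : Reg v n → ℝ),
    e.All (fun x => blk x ≠ 99) →
    ∃ σ', Exec (e.code d k) σ σ' e.size ∧ σ' d = e.eval σ ∧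
      ∀ x, x ≠ d → (∀ j, k ≤ j → x ≠ tmp j) → σ' x = σ x := by
  have htmp : ∀ (k : ℕ) (x : Reg v n), blk x ≠ 99 → x ≠ tmp k := by
    rintro k x hx rfl; exact hx (blk_cell _ _ _)
  have hne : ∀ i j : ℕ, i ≠ j → (tmp i : Reg v n) ≠ tmp j := by
    intro i j hij h; exact hij (by simpa [tmp] using h)
  induction e with
  | reg r =>
    intro d k σ _
    exact ⟨_, .unary _ _ _ _, write_self _ _ _, fun x hx _ => write_ne _ _ hx⟩
  | num q =>
    intro d k σ _
    exact ⟨_, .const _ _ _, write_self _ _ _, fun x hx _ => write_ne _ _ hx⟩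
  | un o a iha =>
    intro d k σ h
    obtain ⟨σ₁, h₁, v₁, f₁⟩ := iha (tmp k) (k + 1) σ h
    refine ⟨_, .seq h₁ (.unary _ _ _ _), ?_, fun x hx hj => ?_⟩
    · rw [write_self, v₁]; rfl
    · rw [write_ne _ _ hx]
      exact f₁ x (hj k le_rfl) fun j hkj => hj j (by omega)
  | bin o a b iha ihb =>
    intro d k σ h
    obtain ⟨σ₁, h₁, v₁, f₁⟩ := iha (tmp k) (k + 1) σ h.1
    obtain ⟨σ₂, h₂, v₂, f₂⟩ := ihb (tmp (k + 1)) (k + 2) σ₁ h.2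
    have e₂ : b.eval σ₁ = b.eval σ := All.eval_congr (p := fun x => blk x ≠ 99)
      (fun x hx => f₁ x (htmp _ x hx) fun j _ => htmp _ x hx) h.2
    have w₁ : σ₂ (tmp k) = a.eval σ := by
      rw [f₂ _ (hne _ _ (by omega)) fun j hj => hne _ _ (by omega), v₁]
    have hs : (bin o a b).size = a.size + (b.size + 1) := by simp only [size]; omega
    rw [hs]
    refine ⟨_, .seq h₁ (.seq h₂ (.binary _ _ _ _ _)), ?_, fun x hx hj => ?_⟩
    · rw [write_self, w₁, v₂, e₂]; rfl
    · rw [write_ne _ _ hx, f₂ x (hj _ (by omega)) fun j hkj => hj j (by omega)]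
      exact f₁ x (hj k le_rfl) fun j hkj => hj j (by omega)
  | root a m c iha ihm ihc =>
    intro d k σ h
    obtain ⟨σ₁, h₁, v₁, f₁⟩ := iha (tmp k) (k + 1) σ h.1
    obtain ⟨σ₂, h₂, v₂, f₂⟩ := ihm (tmp (k + 1)) (k + 2) σ₁ h.2.1
    obtain ⟨σ₃, h₃, v₃, f₃⟩ := ihc (tmp (k + 2)) (k + 3) σ₂ h.2.2
    have g₁ : ∀ x, blk x ≠ 99 → σ₁ x = σ x := fun x hx =>
      f₁ x (htmp _ x hx) fun j _ => htmp _ x hx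
    have g₂ : ∀ x, blk x ≠ 99 → σ₂ x = σ x := fun x hx =>
      (f₂ x (htmp _ x hx) fun j _ => htmp _ x hx).trans (g₁ x hx)
    have e₂ : m.eval σ₁ = m.eval σ := All.eval_congr (p := fun x => blk x ≠ 99) g₁ h.2.1
    have e₃ : c.eval σ₂ = c.eval σ := All.eval_congr (p := fun x => blk x ≠ 99) g₂ h.2.2
    have w₁ : σ₃ (tmp k) = a.eval σ := by
      rw [f₃ _ (hne _ _ (by omega)) fun j hj => hne _ _ (by omega),
        f₂ _ (hne _ _ (by omega)) fun j hj => hne _ _ (by omega), v₁]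
    have w₂ : σ₃ (tmp (k + 1)) = m.eval σ := by
      rw [f₃ _ (hne _ _ (by omega)) fun j hj => hne _ _ (by omega), v₂, e₂]
    have hs : (root a m c).size = a.size + (m.size + (c.size + 1)) := by
      simp only [size]; omega
    rw [hs]
    refine ⟨_, .seq h₁ (.seq h₂ (.seq h₃ (.root _ _ _ _ _))), ?_, fun x hx hj => ?_⟩
    · rw [write_self, w₁, w₂, v₃, e₃]; rfl
    · rw [write_ne _ _ hx, f₃ x (hj _ (by omega)) fun j hkj => hj j (by omega),
        f₂ x (hj _ (by omega)) fun j hkj => hj j (by omega)]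
      exact f₁ x (hj k le_rfl) fun j hkj => hj j (by omega)

end Ex

/-! ### Reasoning about programs -/

/-- The program halts within `c` operations in a memory with the property `Q`. -/
def Runs (p : Prog v n) (σ : Reg v n → ℝ) (c : ℕ) (Q : (Reg v n → ℝ) → Prop) : Prop :=
  ∃ σ' k, Exec p σ σ' k ∧ k ≤ c ∧ Q σ'

theorem Runs.seq {p q : Prog v n} {σ : Reg v n → ℝ} {c₁ c₂ : ℕ} {Q R : (Reg v n → ℝ) → Prop}
    (h₁ : Runs p σ c₁ Q) (h₂ : ∀ σ', Q σ' → Runs q σ' c₂ R) : Runs (.seq p q) σ (c₁ + c₂) R := by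
  obtain ⟨σ₁, k₁, e₁, l₁, q₁⟩ := h₁
  obtain ⟨σ₂, k₂, e₂, l₂, q₂⟩ := h₂ σ₁ q₁
  exact ⟨σ₂, _, .seq e₁ e₂, by omega, q₂⟩

theorem Runs.mono {p : Prog v n} {σ : Reg v n → ℝ} {c c' : ℕ} {Q R : (Reg v n → ℝ) → Prop}
    (h : Runs p σ c Q) (hc : c ≤ c') (hQ : ∀ σ', Q σ' → R σ') : Runs p σ c' R := by
  obtain ⟨σ₁, k₁, e₁, l₁, q₁⟩ := h
  exact ⟨σ₁, k₁, e₁, l₁.trans hc, hQ _ q₁⟩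

theorem Runs.weaken {p : Prog v n} {σ : Reg v n → ℝ} {c c' : ℕ} {Q : (Reg v n → ℝ) → Prop}
    (hc : c ≤ c') (h : Runs p σ c Q) : Runs p σ c' Q := h.mono hc fun _ hq => hq

theorem Runs.skip {σ : Reg v n → ℝ} {Q : (Reg v n → ℝ) → Prop} (h : Q σ) :
    Runs .skip σ 0 Q := ⟨σ, 0, .skip σ, le_rfl, h⟩

theorem Runs.ite {a b : Reg v n} {p q : Prog v n} {σ : Reg v n → ℝ} {c : ℕ}
    {Q : (Reg v n → ℝ) → Prop} (h₁ : σ a < σ b → Runs p σ c Q)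
    (h₂ : ¬ σ a < σ b → Runs q σ c Q) : Runs (.ite a b p q) σ (c + 1) Q := by
  by_cases h : σ a < σ b
  · obtain ⟨σ₁, k₁, e₁, l₁, q₁⟩ := h₁ h
    exact ⟨σ₁, _, .ite_true h e₁, by omega, q₁⟩
  · obtain ⟨σ₁, k₁, e₁, l₁, q₁⟩ := h₂ h
    exact ⟨σ₁, _, .ite_false h e₁, by omega, q₁⟩

/-- The assignment `d := e`. -/
def asg (d : Reg v n) (e : Ex v n) : Prog v n := e.code d 0

theorem runs_asg (d : Reg v n) (e : Ex v n) (σ : Reg v n → ℝ)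
    (he : e.All fun x => blk x ≠ 99) :
    Runs (asg d e) σ e.size fun σ' => σ' d = e.eval σ ∧
      ∀ x, x ≠ d → blk x ≠ 99 → σ' x = σ x := by
  obtain ⟨σ', h, hv, hf⟩ := e.code_spec d 0 σ he
  refine ⟨σ', _, h, le_rfl, hv, fun x hx hb => hf x hx fun j _ => ?_⟩
  rintro rfl
  exact hb (blk_cell _ _ _)

theorem runs_asg_blk {b : ℕ} (d : Reg v n) (e : Ex v n) (σ : Reg v n → ℝ) (hd : blk d = b)
    (he : e.All fun x => blk x ≠ 99) :
    Runs (asg d e) σ e.size fun σ' => σ' d = e.eval σ ∧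
      ∀ x, blk x ≠ b → blk x ≠ 99 → σ' x = σ x := by
  refine (runs_asg d e σ he).mono le_rfl fun σ' h => ⟨h.1, fun x hx => h.2 x ?_⟩
  rintro rfl
  exact hx hd

/-- Assignments to a family of registers. -/
def arr {ι : Type*} (s : Finset ι) (d : ι → Reg v n) (f : ι → Ex v n) : Prog v n :=
  s.toList.foldr (fun i p => .seq (asg (d i) (f i)) p) .skip

/-- No right-hand side reads a target register, so consecutive assignments act like a simultaneous
one. -/
theorem runs_arr {ι : Type*} (s : Finset ι) (d : ι → Reg v n) (f : ι → Ex v n)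
    (σ : Reg v n → ℝ) (hinj : Set.InjOn d s)
    (hf : ∀ i ∈ s, (f i).All fun x => (∀ j ∈ s, x ≠ d j) ∧ blk x ≠ 99) (hd : ∀ i ∈ s, blk (d i) ≠ 99) :
    Runs (arr s d f) σ (∑ i ∈ s, (f i).size) fun σ' => (∀ i ∈ s, σ' (d i) = (f i).eval σ) ∧
      ∀ x, (∀ j ∈ s, x ≠ d j) → blk x ≠ 99 → σ' x = σ x := by
  rw [← Finset.sum_map_toList, arr]
  have key : ∀ (l : List ι), l.Nodup → (∀ i ∈ l, i ∈ s) → ∀ σ : Reg v n → ℝ,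
      Runs (l.foldr (fun i p => .seq (asg (d i) (f i)) p) .skip) σ
        ((l.map fun i => (f i).size).sum) fun σ' => (∀ i ∈ l, σ' (d i) = (f i).eval σ) ∧
          ∀ x, (∀ j ∈ l, x ≠ d j) → blk x ≠ 99 → σ' x = σ x := by
    intro l
    induction l with
    | nil => intro _ _ σ; exact Runs.skip ⟨by simp, fun _ _ _ => rfl⟩
    | cons i l ih =>
      intro hl hls σ
      rw [List.nodup_cons] at hl
      have his := hls i (by simp)
      rw [List.foldr_cons, List.map_cons, List.sum_cons]
      refine (runs_asg (d i) (f i) σ ((hf i his).mono fun x hx => hx.2)).seq ?_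
      rintro σ₁ ⟨v₁, f₁⟩
      refine (ih hl.2 (fun j hj => hls j (by simp [hj])) σ₁).mono le_rfl ?_
      rintro σ₂ ⟨v₂, f₂⟩
      refine ⟨fun j hj => ?_, fun x hx hb => ?_⟩
      · rcases List.mem_cons.mp hj with rfl | hj
        · rw [f₂ _ ?_ (hd _ his), v₁]
          intro k hk heq
          exact hl.1 (hinj his (hls k (by simp [hk])) heq ▸ hk)
        · rw [v₂ j hj]
          refine (hf j (hls j (by simp [hj]))).eval_congr fun x hx => ?_
          exact f₁ x (hx.1 i his) hx.2
      · rw [f₂ x (fun j hj => hx j (by simp [hj])) hb]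
        exact f₁ x (hx i (by simp)) hb
  simpa using key s.toList s.nodup_toList (by simp) σ

theorem runs_arr_blk {ι : Type*} {b : ℕ} (s : Finset ι) (d : ι → Reg v n) (f : ι → Ex v n)
    (σ : Reg v n → ℝ) (hb : b ≠ 99) (hinj : Set.InjOn d s) (hd : ∀ i, blk (d i) = b)
    (hf : ∀ i ∈ s, (f i).All fun x => blk x ≠ b ∧ blk x ≠ 99) :
    Runs (arr s d f) σ (∑ i ∈ s, (f i).size) fun σ' => (∀ i ∈ s, σ' (d i) = (f i).eval σ) ∧
      ∀ x, blk x ≠ b → blk x ≠ 99 → σ' x = σ x := by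
  have hne : ∀ x : Reg v n, blk x ≠ b → ∀ j ∈ s, x ≠ d j := by
    rintro x hx j - rfl; exact hx (hd j)
  refine (runs_arr s d f σ hinj
    (fun i hi => (hf i hi).mono fun x hx => ⟨hne x hx.1, hx.2⟩)
    fun i _ => by rw [hd i]; exact hb).mono le_rfl fun σ' h => ⟨h.1, fun x hx => h.2 x (hne x hx)⟩

/-- An array indexed by the edges. -/
def vec (b : ℕ) (f : Fin n → Ex v n) : Prog v n :=
  arr Finset.univ (fun e : Fin n => cell b 0 e) f

theorem runs_vec {b : ℕ} (f : Fin n → Ex v n) (σ : Reg v n → ℝ) (hb : b ≠ 99)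
    (hf : ∀ i, (f i).All fun x => blk x ≠ b ∧ blk x ≠ 99) :
    Runs (vec b f) σ (∑ i, (f i).size) fun σ' => (∀ e : Fin n, σ' (cell b 0 e) = (f e).eval σ) ∧
      ∀ x, blk x ≠ b → blk x ≠ 99 → σ' x = σ x := by
  refine (runs_arr_blk Finset.univ (fun e : Fin n => cell b 0 e) f σ hb ?_ (fun i => by simp)
    fun i _ => hf i).mono le_rfl fun σ' h => ⟨fun e => h.1 e (Finset.mem_univ e), h.2⟩
  intro i _ j _ hij
  simpa [Fin.ext_iff] using hij

end Traffic

namespace Traffic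

variable {v n : ℕ} {N : Network v n} {M : Model} {D : Data v n} {G : (Fin n → ℝ) → Fin n → ℝ}

/-! ### The program of the method, for a given program of the oracle -/

/-- The scalar in block `b`. -/
def sc (b : ℕ) : Ex v n := .reg (cell b 0 0)

/-- The entry at `e` of the array in block `b`. -/
def ar (b : ℕ) (e : Fin n) : Ex v n := .reg (cell b 0 e)

/-- The memory holds the data in the input registers. -/
def HasInput (D : Data v n) (σ : Reg v n → ℝ) : Prop := ∀ x, blk x = 0 → σ x = input D x

/-- A program which, for the point `t` stored in block `40`, computes `Φ(t)` into block `50` and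
`-G t` into block `51`, and leaves the blocks below `50` unchanged. -/
def IsOracleProg (N : Network v n) (D : Data v n) (G : (Fin n → ℝ) → Fin n → ℝ) (p : Prog v n)
    (c : ℕ) : Prop :=
  ∀ σ, HasInput D σ → ∀ t ∈ dualSet D, (∀ e : Fin n, σ (cell 40 0 e) = t e) →
    Runs p σ c fun σ' => (∀ x, blk x < 50 → σ' x = σ x) ∧
      σ' (cell 50 0 0) = potential N D t ∧ ∀ e : Fin n, σ' (cell 51 0 e) = -G t e

/-- The memory represents the state of the method. -/
structure Rep (N : Network v n) (D : Data v n) (G : (Fin n → ℝ) → Fin n → ℝ) (s : State n)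
    (σ : Reg v n → ℝ) : Prop where
  input : HasInput D σ
  L : σ (cell 1 0 0) = s.L
  A : σ (cell 2 0 0) = s.A
  u : ∀ e : Fin n, σ (cell 3 0 e) = s.u e
  t : ∀ e : Fin n, σ (cell 4 0 e) = s.t e
  F : ∀ e : Fin n, σ (cell 5 0 e) = -wsum s.hist fun y => G y e
  E : σ (cell 6 0 0) = -(D.gamma * wsum s.hist fun y => entropy N D (logitFlow N D y))
  avg : ∀ e : Fin n, σ (cell 7 0 e) = avgFlow G s.hist e
  one : σ (cell 9 0 0) = 1

/-- Memory layout: block 0 holds the data, blocks 1–9 what persists between trials (8 is the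
stopping flag, 9 the constant one), 11–22 the quantities of a trial, 40 the argument of the oracle,
50 and 51 its answers, 60–68 its scratch space, 99 temporaries. Frame conditions thus become
inequalities between block numbers. -/
theorem HasInput.congr {σ σ' : Reg v n → ℝ} (h : HasInput D σ)
    (hσ : ∀ x, blk x < 10 → σ' x = σ x) : HasInput D σ' :=
  fun x hx => (hσ x (by omega)).trans (h x hx)

theorem Rep.congr {s : State n} {σ σ' : Reg v n → ℝ} (h : Rep N D G s σ)
    (hσ : ∀ x, blk x < 10 → σ' x = σ x) : Rep N D G s σ' where
  input := h.input.congr hσ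
  L := (hσ _ (by simp)).trans h.L
  A := (hσ _ (by simp)).trans h.A
  u := fun e => (hσ _ (by simp)).trans (h.u e)
  t := fun e => (hσ _ (by simp)).trans (h.t e)
  F := fun e => (hσ _ (by simp)).trans (h.F e)
  E := (hσ _ (by simp)).trans h.E
  avg := fun e => (hσ _ (by simp)).trans (h.avg e)
  one := (hσ _ (by simp)).trans h.one

/-- `α`, `A` and `y` of the trial. -/
def prepProg (v n : ℕ) : Prog v n :=
  .seq (asg (cell 11 0 0) (.num 1 / (.num 2 * sc 1)
    + (.num 1 / (.num 4 * (sc 1 * sc 1)) + sc 2 / sc 1 : Ex v n).sqrt)) <|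
  .seq (asg (cell 12 0 0) (sc 2 + sc 11)) <|
  .seq (vec 13 fun e => (sc 11 * ar 3 e + sc 2 * ar 4 e) / sc 12) (vec 40 fun e => ar 13 e)

theorem runs_prep {s : State n} {σ : Reg v n → ℝ} (h : Rep N D G s σ) :
    Runs (prepProg v n) σ (25 + 10 * n) fun σ' => (∀ x, blk x < 10 → σ' x = σ x) ∧
      σ' (cell 11 0 0) = Composite.alpha s ∧ σ' (cell 12 0 0) = Composite.nextA s ∧
      (∀ e : Fin n, σ' (cell 13 0 e) = Composite.nextY s e) ∧
      ∀ e : Fin n, σ' (cell 40 0 e) = Composite.nextY s e := by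
  refine Runs.weaken (c := _ + (_ + (_ + _))) ?_ ((runs_asg_blk (b := 11) _ _ σ (by simp)
    (by simp [sc])).seq fun σ₁ h₁ => (runs_asg_blk (b := 12) _ _ σ₁ (by simp)
    (by simp [sc])).seq fun σ₂ h₂ => (runs_vec _ σ₂ (by norm_num)
    (by simp [sc, ar])).seq fun σ₃ h₃ =>
    (runs_vec (b := 40) (fun e => ar 13 e) σ₃ (by norm_num) (by simp [ar])).mono le_rfl ?_)
  · simp [sc, ar]; omega
  · rintro σ₄ ⟨v₄, f₄⟩
    obtain ⟨v₁, f₁⟩ := h₁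
    obtain ⟨v₂, f₂⟩ := h₂
    obtain ⟨v₃, f₃⟩ := h₃
    have a₁ : σ₁ (cell 11 0 0) = Composite.alpha s := by
      rw [v₁]; simp [sc, Composite.alpha, h.L, h.A, pow_two]
    have a₂ : σ₂ (cell 12 0 0) = Composite.nextA s := by
      rw [v₂]; simp [sc, Composite.nextA, a₁, f₁, h.A]
    have a₃ : ∀ e : Fin n, σ₃ (cell 13 0 e) = Composite.nextY s e := by
      intro e
      rw [v₃]; simp [sc, ar, Composite.nextY, a₁, a₂, f₁, f₂, h.A, h.u, h.t]
    refine ⟨fun x hx => ?_, ?_, ?_, ?_, ?_⟩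
    · rw [f₄ x (by omega) (by omega), f₃ x (by omega) (by omega), f₂ x (by omega) (by omega),
        f₁ x (by omega) (by omega)]
    · simp [f₄, f₃, f₂, a₁]
    · simp [f₄, f₃, a₂]
    · intro e; simp [f₄, a₃]
    · intro e; rw [v₄]; simp [ar, a₃]

/-- The expression for `t̄_e + s`, where `s` solves the one-dimensional subproblem. -/
def minEx (M : Model) (e : Fin n) : Ex v n :=
  match M with
  | .beckmann => .reg (.tbar e) + .root (sc 12 * .reg (.fbar e)
      / (.reg (.tbar e) * .reg .rho : Ex v n).pow (.reg .mu)) (.reg .mu) (ar 16 e)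
  | .stable => .reg (.tbar e) + ((ar 16 e - sc 12 * .reg (.fbar e))
      + ((ar 16 e - sc 12 * .reg (.fbar e)) * (ar 16 e - sc 12 * .reg (.fbar e)) : Ex v n).sqrt)
      / .num 2

/-- The positive part without a comparison, so that it may occur inside an expression. -/
theorem half_add_sqrt_mul_self (z : ℝ) : (z + Real.sqrt (z * z)) / 2 = max z 0 := by
  rw [Real.sqrt_mul_self_eq_abs]
  rcases le_total z 0 with h | h
  · rw [abs_of_nonpos h, max_eq_right h]; ring
  · rw [abs_of_nonneg h, max_eq_left h]; ring

theorem eval_minEx {σ : Reg v n → ℝ} (h : HasInput D σ) (e : Fin n) : (minEx M e).eval σ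
    = D.tbar e + shift M D e (σ (cell 12 0 0)) (σ (cell 16 0 e)) := by
  have h1 : σ (.tbar e) = D.tbar e := h _ rfl
  have h2 : σ (.fbar e) = D.fbar e := h _ rfl
  have h3 : σ .rho = D.rho := h _ rfl
  have h4 : σ .mu = D.mu := h _ rfl
  cases M <;> simp [minEx, shift, sc, ar, h1, h2, h3, h4, half_add_sqrt_mul_self]

/-- The updates after the first call of the oracle. -/
def midProg (M : Model) (v n : ℕ) : Prog v n :=
  .seq (asg (cell 14 0 0) (sc 50)) <|
  .seq (vec 15 fun e => ar 51 e) <|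
  .seq (vec 16 fun e => ar 5 e + sc 11 * ar 15 e) <|
  .seq (asg (cell 17 0 0) (sc 6 + sc 11 * (sc 14 + .sum Finset.univ fun e => ar 15 e * ar 13 e))) <|
  .seq (vec 18 fun e => minEx M e) <|
  .seq (vec 19 fun e => (sc 11 * ar 18 e + sc 2 * ar 4 e) / sc 12) (vec 40 fun e => ar 19 e)

/-- The first oracle call, at y, supplies what is needed to update the accumulated flow and entropy
and to compute u and t. The point t is left in block 40 for the second call. -/
theorem runs_mid (hD : Valid N M D) (hG : IsOracle N D G) {s : State n}
    (hs : (dualProblem N M D G).Inv s) {σ : Reg v n → ℝ} (h : Rep N D G s σ)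
    (h11 : σ (cell 11 0 0) = Composite.alpha s) (h12 : σ (cell 12 0 0) = Composite.nextA s)
    (h13 : ∀ e : Fin n, σ (cell 13 0 e) = Composite.nextY s e)
    (h50 : σ (cell 50 0 0) = potential N D (Composite.nextY s))
    (h51 : ∀ e : Fin n, σ (cell 51 0 e) = -G (Composite.nextY s) e) :
    Runs (midProg M v n) σ (10 + 50 * n) fun σ' => (∀ x, blk x < 14 → σ' x = σ x) ∧
      σ' (cell 14 0 0) = potential N D (Composite.nextY s) ∧
      (∀ e : Fin n, σ' (cell 15 0 e) = -G (Composite.nextY s) e) ∧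
      (∀ e : Fin n, σ' (cell 16 0 e)
        = -wsum ((Composite.alpha s, Composite.nextY s) :: s.hist) fun y => G y e) ∧
      σ' (cell 17 0 0) = -(D.gamma * wsum ((Composite.alpha s, Composite.nextY s) :: s.hist)
        fun y => entropy N D (logitFlow N D y)) ∧
      (∀ e : Fin n, σ' (cell 18 0 e) = (dualProblem N M D G).nextU s e) ∧
      (∀ e : Fin n, σ' (cell 19 0 e) = (dualProblem N M D G).nextT s e) ∧
      ∀ e : Fin n, σ' (cell 40 0 e) = (dualProblem N M D G).nextT s e := by
  refine Runs.weaken (c := _ + (_ + (_ + (_ + (_ + (_ + _)))))) ?_ ((runs_asg_blk (b := 14) _ _ σ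
    (by simp) (by simp [sc])).seq fun σ₁ h₁ => (runs_vec _ σ₁ (by norm_num)
    (by simp [ar])).seq fun σ₂ h₂ => (runs_vec _ σ₂ (by norm_num)
    (by simp [sc, ar])).seq fun σ₃ h₃ => (runs_asg_blk (b := 17) _ _ σ₃ (by simp)
    (by simp [sc, ar])).seq fun σ₄ h₄ => (runs_vec _ σ₄ (by norm_num)
    (by cases M <;> simp [minEx, sc, ar])).seq fun σ₅ h₅ => (runs_vec _ σ₅ (by norm_num)
    (by simp [sc, ar])).seq fun σ₆ h₆ =>
    (runs_vec (b := 40) (fun e => ar 19 e) σ₆ (by norm_num) (by simp [ar])).mono le_rfl ?_)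
  · cases M <;> simp [sc, ar, minEx] <;> omega
  · rintro σ₇ ⟨v₇, f₇⟩
    obtain ⟨v₁, f₁⟩ := h₁
    obtain ⟨v₂, f₂⟩ := h₂
    obtain ⟨v₃, f₃⟩ := h₃
    obtain ⟨v₄, f₄⟩ := h₄
    obtain ⟨v₅, f₅⟩ := h₅
    obtain ⟨v₆, f₆⟩ := h₆
    have hy := (regular_dualProblem hD hG).nextY_mem hs
    have a₁ : σ₁ (cell 14 0 0) = potential N D (Composite.nextY s) := by
      rw [v₁]; simp [sc, h50]
    have a₂ : ∀ e : Fin n, σ₂ (cell 15 0 e) = -G (Composite.nextY s) e := by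
      intro e; rw [v₂]; simp [ar, f₁, h51]
    have a₃ : ∀ e : Fin n, σ₃ (cell 16 0 e)
        = -wsum ((Composite.alpha s, Composite.nextY s) :: s.hist) fun y => G y e := by
      intro e; rw [v₃]; simp [ar, sc, f₁, f₂, a₂, h.F, h11]
    have a₄ : σ₄ (cell 17 0 0) = -(D.gamma * wsum ((Composite.alpha s, Composite.nextY s) :: s.hist)
        fun y => entropy N D (logitFlow N D y)) := by
      -- The entropy of the logit flow is never computed from route flows, of which there may be too
      -- many. Entropy duality gives −γ times it as Φ(y) + ⟨flow, y⟩, which is the linearization at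
      -- t = 0.
      have hl := lin_eq (M := M) hD hG hy 0
      simp only [Composite.lin, dualProblem, Pi.zero_apply, zero_sub, mul_zero,
        Finset.sum_const_zero, add_zero] at hl
      rw [v₄]
      simp [ar, sc, f₁, f₂, f₃, a₁, a₂, h.E, h11, h13]
      have : ∑ e, G (Composite.nextY s) e * Composite.nextY s e
          = -∑ e, G (Composite.nextY s) e * -Composite.nextY s e := by
        rw [← Finset.sum_neg_distrib]; exact Finset.sum_congr rfl fun e _ => by ring
      rw [this, neg_neg, hl]; ring
    have i₄ : HasInput D σ₄ := h.input.congr fun x hx => by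
      rw [f₄ x (by omega) (by omega), f₃ x (by omega) (by omega), f₂ x (by omega) (by omega),
        f₁ x (by omega) (by omega)]
    have a₅ : ∀ e : Fin n, σ₅ (cell 18 0 e) = (dualProblem N M D G).nextU s e := by
      intro e
      rw [v₅, eval_minEx i₄, nextU_eq hD hG hs, dualMin, f₄ _ (by simp) (by simp),
        f₃ _ (by simp) (by simp), f₂ _ (by simp) (by simp), f₁ _ (by simp) (by simp), h12,
        f₄ _ (by simp) (by simp), a₃, weight_cons, Composite.nextA]
      have : s.A = weight s.hist := hs.A_eq
      rw [this, add_comm (weight s.hist)]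
    have a₆ : ∀ e : Fin n, σ₆ (cell 19 0 e) = (dualProblem N M D G).nextT s e := by
      intro e
      rw [v₆]; simp [sc, ar, Composite.nextT, f₁, f₂, f₃, f₄, f₅, a₅, h.A, h.t, h11, h12]
    refine ⟨fun x hx => ?_, ?_, ?_, ?_, ?_, ?_, ?_, ?_⟩
    · rw [f₇ x (by omega) (by omega), f₆ x (by omega) (by omega), f₅ x (by omega) (by omega),
        f₄ x (by omega) (by omega), f₃ x (by omega) (by omega), f₂ x (by omega) (by omega),
        f₁ x (by omega) (by omega)]
    · simp [f₇, f₆, f₅, f₄, f₃, f₂, a₁]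
    · intro e; simp [f₇, f₆, f₅, f₄, f₃, a₂]
    · intro e; rw [f₇ _ (by simp) (by simp), f₆ _ (by simp) (by simp), f₅ _ (by simp) (by simp),
        f₄ _ (by simp) (by simp), a₃]
    · rw [f₇ _ (by simp) (by simp), f₆ _ (by simp) (by simp), f₅ _ (by simp) (by simp), a₄]
    · intro e; simp [f₇, f₆, a₅]
    · intro e; simp [f₇, a₆]
    · intro e; rw [v₇]; simp [ar, a₆]

/-- The test of acceptance. -/
def testProg (v n : ℕ) : Prog v n :=
  .seq (asg (cell 20 0 0) (sc 14 - (.sum Finset.univ fun e : Fin n => ar 15 e * (ar 19 e - ar 13 e))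
    + sc 1 / .num 2 * (.sum Finset.univ fun e : Fin n =>
        (ar 19 e - ar 13 e) * (ar 19 e - ar 13 e))
    + sc 11 / (.num 2 * sc 12) * .reg .eps)) (asg (cell 21 0 0) (sc 50))

theorem runs_test {s : State n} {σ : Reg v n → ℝ} (h : Rep N D G s σ)
    (h11 : σ (cell 11 0 0) = Composite.alpha s) (h12 : σ (cell 12 0 0) = Composite.nextA s)
    (h13 : ∀ e : Fin n, σ (cell 13 0 e) = Composite.nextY s e)
    (h14 : σ (cell 14 0 0) = potential N D (Composite.nextY s))
    (h15 : ∀ e : Fin n, σ (cell 15 0 e) = -G (Composite.nextY s) e)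
    (h19 : ∀ e : Fin n, σ (cell 19 0 e) = (dualProblem N M D G).nextT s e)
    (h50 : σ (cell 50 0 0) = potential N D ((dualProblem N M D G).nextT s)) :
    Runs (testProg v n) σ (20 + 20 * n) fun σ' => (∀ x, blk x < 20 → σ' x = σ x) ∧
      (σ' (cell 20 0 0) < σ' (cell 21 0 0) ↔ ¬ (dualProblem N M D G).Accepts s) ∧
      σ' (cell 21 0 0) = potential N D ((dualProblem N M D G).nextT s) := by
  refine Runs.weaken (c := _ + _) ?_ ((runs_asg_blk (b := 20) _ _ σ (by simp)
    (by simp [sc, ar])).seq fun σ₁ h₁ =>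
    (runs_asg_blk (b := 21) (cell 21 0 0) (sc 50) σ₁ (by simp) (by simp [sc])).mono le_rfl ?_)
  · simp [sc, ar]; omega
  · rintro σ₂ ⟨v₂, f₂⟩
    obtain ⟨v₁, f₁⟩ := h₁
    have he : σ .eps = D.eps := h.input _ rfl
    refine ⟨fun x hx => ?_, ?_, ?_⟩
    · rw [f₂ x (by omega) (by omega), f₁ x (by omega) (by omega)]
    · rw [f₂ (cell 20 0 0) (by simp) (by simp), v₁, v₂, Composite.Accepts, not_le]
      simp [sc, ar, f₁, h50, h11, h12, h13, h14, h15, h19, h.L, he, Composite.lin, dualProblem,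
        pow_two]
    · rw [v₂]; simp [sc, f₁, h50]

/-- The expression for `σ_e(f)`. -/
def sigmaEx (e : Fin n) (f : Ex v n) : Ex v n :=
  .reg (.tbar e) * f + .reg (.tbar e) * .reg .rho * (.reg (.fbar e)
    * ((f / .reg (.fbar e)).pow (.num 1 / .reg .mu + .num 1) / (.num 1 / .reg .mu + .num 1)))

theorem eval_sigmaEx {σ : Reg v n → ℝ} (h : HasInput D σ) {e : Fin n} (hf : 0 < D.fbar e)
    (hm : 0 < D.mu) (f : Ex v n) : (sigmaEx e f).eval σ = sigma D e (f.eval σ) := by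
  have h1 : σ (.tbar e) = D.tbar e := h _ rfl
  have h2 : σ (.fbar e) = D.fbar e := h _ rfl
  have h3 : σ .rho = D.rho := h _ rfl
  have h4 : σ .mu = D.mu := h _ rfl
  rw [sigma_eq hf hm]
  simp [sigmaEx, h1, h2, h3, h4]

/-- The expression for the flow at which the travel time is the one stored in block `4`. -/
def flowAtEx (e : Fin n) : Ex v n :=
  .reg (.fbar e) * ((ar 4 e - .reg (.tbar e))
    / (.reg (.tbar e) * .reg .rho) : Ex v n).pow (.reg .mu)

/-- The expression for the gap. -/
def gapEx (M : Model) (v n : ℕ) : Ex v n :=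
  match M with
  | .beckmann => sc 21 + (.sum Finset.univ fun e => ar 4 e * flowAtEx e - sigmaEx e (flowAtEx e))
      + (.sum Finset.univ fun e => sigmaEx e (ar 7 e)) - sc 6 / sc 2
  | .stable => sc 21 + (.sum Finset.univ fun e => .reg (.fbar e) * (ar 4 e - .reg (.tbar e)))
      + ((.sum Finset.univ fun e => ar 7 e * .reg (.tbar e)) + .num 3 * .reg .R
        * (Ex.sum Finset.univ fun e => (((ar 7 e - .reg (.fbar e))
            + ((ar 7 e - .reg (.fbar e)) * (ar 7 e - .reg (.fbar e)) : Ex v n).sqrt) / .num 2)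
          * (((ar 7 e - .reg (.fbar e))
            + ((ar 7 e - .reg (.fbar e)) * (ar 7 e - .reg (.fbar e)) : Ex v n).sqrt)
            / .num 2) : Ex v n).sqrt) - sc 6 / sc 2

/-- The conjugate σ* is evaluated through its maximizing flow, and the accumulated entropy is
divided by A, which is the total weight. -/
theorem eval_gapEx (hD : Valid N M D) {s : State n}
    (hs : (dualProblem N M D G).Inv s) {σ : Reg v n → ℝ} (h : Rep N D G s σ)
    (h21 : σ (cell 21 0 0) = potential N D s.t) : (gapEx M v n).eval σ = gap N M D G s := by
  have h1 : ∀ e, σ (.tbar e) = D.tbar e := fun e => h.input _ rfl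
  have h2 : ∀ e, σ (.fbar e) = D.fbar e := fun e => h.input _ rfl
  have h3 : σ .rho = D.rho := h.input _ rfl
  have h4 : σ .mu = D.mu := h.input _ rfl
  have h5 : σ .R = D.R := h.input _ rfl
  have hA : s.A = weight s.hist := hs.A_eq
  have hent : avgEntropy N D s.hist = -(σ (cell 6 0 0) / σ (cell 2 0 0)) := by
    rw [h.E, h.A, hA, avgEntropy, average_eq]; ring
  rw [gap_eq, hent, dual]
  cases M with
  | beckmann =>
    obtain ⟨hr, hm⟩ := hD.beckmann rfl
    have e1 : ∀ e : Fin n, (flowAtEx e : Ex v n).eval σ = flowAt D e (s.t e - D.tbar e) := by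
      intro e; simp [flowAtEx, flowAt, ar, h1, h2, h3, h4, h.t]
    have e2 : ∀ e : Fin n, sigmaStar D e (s.t e) = (ar 4 e * flowAtEx e
        - sigmaEx e (flowAtEx e) : Ex v n).eval σ := by
      intro e
      rw [sigmaStar_eq (hD.tbar_pos e) (hD.fbar_pos e) hr hm (hs.t_mem e), Ex.eval_sub,
        eval_sigmaEx h.input (hD.fbar_pos e) hm, Ex.eval_mul, e1]
      simp [ar, h.t]
    have e3 : ∀ e : Fin n, sigma D e (avgFlow G s.hist e) = (sigmaEx e (ar 7 e) : Ex v n).eval σ := by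
      intro e
      rw [eval_sigmaEx h.input (hD.fbar_pos e) hm]
      simp [ar, h.avg]
    simp only [composite, primalTerm, e2, e3, gapEx, Ex.eval_sub, Ex.eval_add, Ex.eval_sum, sc,
      Ex.eval_reg, h21, Ex.eval_div]
    ring
  | stable =>
    simp only [composite, primalTerm, gapEx, Ex.eval_sub, Ex.eval_add, Ex.eval_sum, sc, ar,
      Ex.eval_reg, h21, Ex.eval_div, Ex.eval_mul, Ex.eval_sqrt, Ex.eval_num, h1, h2, h5, h.t, h.avg,
      violation, pow_two]
    push_cast
    simp only [half_add_sqrt_mul_self]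
    ring

/-- The updates after an accepted trial. -/
def acceptProg (M : Model) (v n : ℕ) : Prog v n :=
  .seq (asg (cell 1 0 0) (sc 1 / .num 2)) <|
  .seq (asg (cell 2 0 0) (sc 12)) <|
  .seq (vec 3 fun e => ar 18 e) <|
  .seq (vec 4 fun e => ar 19 e) <|
  .seq (vec 5 fun e => ar 16 e) <|
  .seq (asg (cell 6 0 0) (sc 17)) <|
  .seq (vec 7 fun e => ar 5 e / sc 2) <|
  .seq (asg (cell 22 0 0) (gapEx M v n))
    (.ite (cell 22 0 0) .eps (asg (cell 8 0 0) (.num 1)) .skip)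

theorem runs_accept (hD : Valid N M D) {s : State n}
    (hs : (dualProblem N M D G).Inv ((dualProblem N M D G).step s))
    (hacc : (dualProblem N M D G).Accepts s)
    {σ : Reg v n → ℝ} (h : Rep N D G s σ)
    (h12 : σ (cell 12 0 0) = Composite.nextA s)
    (h16 : ∀ e : Fin n, σ (cell 16 0 e)
        = -wsum ((Composite.alpha s, Composite.nextY s) :: s.hist) fun y => G y e)
    (h17 : σ (cell 17 0 0) = -(D.gamma * wsum ((Composite.alpha s, Composite.nextY s) :: s.hist)
        fun y => entropy N D (logitFlow N D y)))
    (h18 : ∀ e : Fin n, σ (cell 18 0 e) = (dualProblem N M D G).nextU s e)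
    (h19 : ∀ e : Fin n, σ (cell 19 0 e) = (dualProblem N M D G).nextT s e)
    (h21 : σ (cell 21 0 0) = potential N D ((dualProblem N M D G).nextT s)) :
    Runs (acceptProg M v n) σ (30 + 100 * n) fun σ' =>
      Rep N D G ((dualProblem N M D G).step s) σ' ∧
      (gap N M D G ((dualProblem N M D G).step s) < D.eps → σ' (cell 8 0 0) = 1) ∧
      (¬ gap N M D G ((dualProblem N M D G).step s) < D.eps →
        σ' (cell 8 0 0) = σ (cell 8 0 0)) := by
  set s' := (dualProblem N M D G).step s with hs'
  have hst := Composite.step_of_accepts hacc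
  rw [← hs'] at hst
  refine Runs.mono (c := _ + (_ + (_ + (_ + (_ + (_ + (_ + (_ + (1 + 1))))))))) ((runs_asg_blk (b := 1) _ _ σ
    (by simp) (by simp [sc])).seq fun σ₁ h₁ => (runs_asg_blk (b := 2) _ _ σ₁
    (by simp) (by simp [sc])).seq fun σ₂ h₂ => (runs_vec _ σ₂ (by norm_num)
    (by simp [ar])).seq fun σ₃ h₃ => (runs_vec _ σ₃ (by norm_num)
    (by simp [ar])).seq fun σ₄ h₄ => (runs_vec _ σ₄ (by norm_num)
    (by simp [ar])).seq fun σ₅ h₅ => (runs_asg_blk (b := 6) _ _ σ₅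
    (by simp) (by simp [sc])).seq fun σ₆ h₆ => (runs_vec _ σ₆ (by norm_num)
    (by simp [sc, ar])).seq fun σ₇ h₇ => (runs_asg_blk (b := 22) _ _ σ₇
    (by simp) (by cases M <;> simp [gapEx, flowAtEx, sigmaEx, sc, ar])).seq
    (R := fun σ' => Rep N D G s' σ' ∧ (gap N M D G s' < D.eps → σ' (cell 8 0 0) = 1) ∧
      (¬ gap N M D G s' < D.eps → σ' (cell 8 0 0) = σ (cell 8 0 0))) fun σ₈ h₈ => ?_) ?_
    fun _ hq => hq
  · obtain ⟨v₁, f₁⟩ := h₁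
    obtain ⟨v₂, f₂⟩ := h₂
    obtain ⟨v₃, f₃⟩ := h₃
    obtain ⟨v₄, f₄⟩ := h₄
    obtain ⟨v₅, f₅⟩ := h₅
    obtain ⟨v₆, f₆⟩ := h₆
    obtain ⟨v₇, f₇⟩ := h₇
    obtain ⟨v₈, f₈⟩ := h₈
    have hA : s'.A = weight s'.hist := hs.A_eq
    have hr : Rep N D G s' σ₇ := by
      constructor
      · intro x hx
        rw [f₇ x (by omega) (by omega), f₆ x (by omega) (by omega), f₅ x (by omega) (by omega),
          f₄ x (by omega) (by omega), f₃ x (by omega) (by omega), f₂ x (by omega) (by omega),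
          f₁ x (by omega) (by omega), h.input x hx]
      · simp [f₇, f₆, f₅, f₄, f₃, f₂, v₁, sc, h.L, hst]
      · simp [f₇, f₆, f₅, f₄, f₃, v₂, f₁, sc, h12, hst]
      · intro e; simp [f₇, f₆, f₅, f₄, v₃, f₂, f₁, ar, h18, hst]
      · intro e; simp [f₇, f₆, f₅, v₄, f₃, f₂, f₁, ar, h19, hst]
      · intro e
        rw [f₇ _ (by simp) (by simp), f₆ _ (by simp) (by simp), v₅, ar, Ex.eval_reg,
          f₄ _ (by simp) (by simp), f₃ _ (by simp) (by simp), f₂ _ (by simp) (by simp),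
          f₁ _ (by simp) (by simp), h16, hst]
      · rw [f₇ _ (by simp) (by simp), v₆, sc, Ex.eval_reg, f₅ _ (by simp) (by simp),
          f₄ _ (by simp) (by simp), f₃ _ (by simp) (by simp), f₂ _ (by simp) (by simp),
          f₁ _ (by simp) (by simp), h17, hst]
      · intro e
        have e1 : σ₆ (cell 5 0 e) = -wsum s'.hist fun y => G y e := by
          rw [f₆ _ (by simp) (by simp), v₅, ar, Ex.eval_reg,
            f₄ _ (by simp) (by simp), f₃ _ (by simp) (by simp), f₂ _ (by simp) (by simp),
            f₁ _ (by simp) (by simp), h16, hst]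
        have e2 : σ₆ (cell 2 0 0) = weight s'.hist := by
          rw [← hA, hst]
          simp [f₆, f₅, f₄, f₃, v₂, f₁, sc, h12]
        rw [v₇, avgFlow, average_eq]
        have := wsum_mul s'.hist (-1) fun y => G y e
        simp only [neg_mul, one_mul] at this
        rw [this]
        simp [ar, sc, e1, e2]
      · simp [f₇, f₆, f₅, f₄, f₃, f₂, f₁, h.one]
    have hgap : σ₈ (cell 22 0 0) = gap N M D G s' := by
      rw [v₈]
      refine eval_gapEx hD hs hr ?_
      rw [hst]
      simp [f₇, f₆, f₅, f₄, f₃, f₂, f₁, h21]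
    have hr8 : Rep N D G s' σ₈ := hr.congr fun x hx => f₈ x (by omega) (by omega)
    have heps : σ₈ .eps = D.eps := hr8.input _ rfl
    have hflag : σ₈ (cell 8 0 0) = σ (cell 8 0 0) := by
      simp [f₈, f₇, f₆, f₅, f₄, f₃, f₂, f₁]
    refine Runs.ite (fun hlt => ?_) fun hlt => ?_
    · rw [hgap, heps] at hlt
      refine (runs_asg_blk (b := 8) _ _ σ₈ (by simp) (by simp)).mono (by simp) ?_
      rintro σ₉ ⟨v₉, f₉⟩
      refine ⟨?_, fun _ => by rw [v₉]; simp, fun hn => absurd hlt hn⟩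
      constructor
      · intro x hx; rw [f₉ x (by omega) (by omega)]; exact hr8.input x hx
      · simp [f₉, hr8.L]
      · simp [f₉, hr8.A]
      · simp [f₉, hr8.u]
      · simp [f₉, hr8.t]
      · intro e; rw [f₉ _ (by simp) (by simp), hr8.F]
      · rw [f₉ _ (by simp) (by simp), hr8.E]
      · intro e; rw [f₉ _ (by simp) (by simp), hr8.avg]
      · simp [f₉, hr8.one]
    · rw [hgap, heps] at hlt
      exact (Runs.skip ⟨hr8, fun hn => absurd hn hlt, fun _ => hflag⟩).mono (by omega)
        fun _ hq => hq
  · cases M <;> simp [sc, ar, gapEx, flowAtEx, sigmaEx] <;> omega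

/-- One trial. -/
def trialProg (M : Model) (p : Prog v n) : Prog v n :=
  .seq (prepProg v n) <| .seq p <| .seq (midProg M v n) <| .seq p <| .seq (testProg v n)
    (.ite (cell 20 0 0) (cell 21 0 0) (asg (cell 1 0 0) (.num 2 * sc 1)) (acceptProg M v n))

/-- Two oracle calls are made, at y and at t. The flag changes only if the trial is accepted and the
new gap is below ε, that is, only at an iteration that meets the stopping rule. -/
theorem runs_trial (hD : Valid N M D) (hG : IsOracle N D G) {p : Prog v n} {c : ℕ}
    (hp : IsOracleProg N D G p c) {s : State n} (hs : (dualProblem N M D G).Inv s)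
    {σ : Reg v n → ℝ} (h : Rep N D G s σ) :
    Runs (trialProg M p) σ (2 * c + (90 + 180 * n)) fun σ' =>
      Rep N D G ((dualProblem N M D G).step s) σ' ∧
      ((dualProblem N M D G).Accepts s ∧ gap N M D G ((dualProblem N M D G).step s) < D.eps →
        σ' (cell 8 0 0) = 1) ∧
      (¬ ((dualProblem N M D G).Accepts s ∧ gap N M D G ((dualProblem N M D G).step s) < D.eps) →
        σ' (cell 8 0 0) = σ (cell 8 0 0)) := by
  have hreg := regular_dualProblem hD hG
  suffices hrun : Runs (trialProg M p) σ ((25 + 10 * n) + (c + ((10 + 50 * n)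
      + (c + ((20 + 20 * n) + (30 + 100 * n + 1)))))) fun σ' =>
      Rep N D G ((dualProblem N M D G).step s) σ' ∧
      ((dualProblem N M D G).Accepts s ∧ gap N M D G ((dualProblem N M D G).step s) < D.eps →
        σ' (cell 8 0 0) = 1) ∧
      (¬ ((dualProblem N M D G).Accepts s ∧ gap N M D G ((dualProblem N M D G).step s) < D.eps) →
        σ' (cell 8 0 0) = σ (cell 8 0 0)) from hrun.mono (by omega) fun _ hq => hq
  refine (runs_prep h).seq ?_
  rintro σ₁ ⟨k₁, a₁, b₁, y₁, z₁⟩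
  have r₁ := h.congr k₁
  refine (hp σ₁ r₁.input _ (hreg.nextY_mem hs) z₁).seq ?_
  rintro σ₂ ⟨k₂, P₂, g₂⟩
  have r₂ := r₁.congr fun x hx => k₂ x (by omega)
  have a₂ := (k₂ (cell 11 0 0) (by simp)).trans a₁
  have b₂ := (k₂ (cell 12 0 0) (by simp)).trans b₁
  have y₂ := fun e : Fin n => (k₂ (cell 13 0 e) (by simp)).trans (y₁ e)
  refine (runs_mid hD hG hs r₂ a₂ b₂ y₂ P₂ g₂).seq ?_
  rintro σ₃ ⟨k₃, w14, w15, w16, w17, w18, w19, w40⟩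
  have r₃ := r₂.congr fun x hx => k₃ x (by omega)
  refine (hp σ₃ r₃.input _ (hreg.nextT_mem hs) w40).seq ?_
  rintro σ₄ ⟨k₄, P₄, -⟩
  have r₄ := r₃.congr fun x hx => k₄ x (by omega)
  refine (runs_test (M := M) r₄ (by rw [k₄ _ (by simp), k₃ _ (by simp), a₂])
    (by rw [k₄ _ (by simp), k₃ _ (by simp), b₂])
    (fun e => by rw [k₄ _ (by simp), k₃ _ (by simp), y₂])
    (by rw [k₄ _ (by simp), w14]) (fun e => by rw [k₄ _ (by simp), w15])
    (fun e => by rw [k₄ _ (by simp), w19]) P₄).seq ?_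
  rintro σ₅ ⟨k₅, t₅, P₅⟩
  have r₅ := r₄.congr fun x hx => k₅ x (by omega)
  have hflag : σ₅ (cell 8 0 0) = σ (cell 8 0 0) := by
    rw [k₅ _ (by simp), k₄ _ (by simp), k₃ _ (by simp), k₂ _ (by simp), k₁ _ (by simp)]
  refine Runs.ite (fun hlt => ?_) fun hlt => ?_
  · have hna := t₅.mp hlt
    have hst := Composite.step_of_not_accepts hna
    refine (runs_asg_blk (b := 1) _ _ σ₅ (by simp) (by simp [sc])).mono (by simp [sc]; omega) ?_
    rintro σ₆ ⟨v₆, f₆⟩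
    refine ⟨?_, fun hh => absurd hh.1 hna, fun _ => by rw [f₆ _ (by simp) (by simp), hflag]⟩
    rw [hst]
    constructor
    · intro x hx; rw [f₆ x (by omega) (by omega)]; exact r₅.input x hx
    · rw [v₆]; simp [sc, r₅.L]
    · simp [f₆, r₅.A]
    · simp [f₆, r₅.u]
    · simp [f₆, r₅.t]
    · intro e; rw [f₆ _ (by simp) (by simp), r₅.F]
    · rw [f₆ _ (by simp) (by simp), r₅.E]
    · intro e; rw [f₆ _ (by simp) (by simp), r₅.avg]
    · simp [f₆, r₅.one]
  · have hacc : (dualProblem N M D G).Accepts s := by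
      by_contra hn; exact hlt (t₅.mpr hn)
    refine (runs_accept hD (hreg.inv_step hs) hacc r₅
      (by rw [k₅ _ (by simp), k₄ _ (by simp), k₃ _ (by simp), b₂])
      (fun e => by rw [k₅ _ (by simp), k₄ _ (by simp), w16])
      (by rw [k₅ _ (by simp), k₄ _ (by simp), w17])
      (fun e => by rw [k₅ _ (by simp), k₄ _ (by simp), w18])
      (fun e => by rw [k₅ _ (by simp), k₄ _ (by simp), w19]) P₅).mono le_rfl ?_
    rintro σ₆ ⟨r₆, g₆, g₆'⟩
    exact ⟨r₆, fun hh => g₆ hh.2, fun hh => (g₆' fun hg => hh ⟨hacc, hg⟩).trans hflag⟩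

/-- The program of the method. -/
def methodProg (M : Model) (p : Prog v n) : Prog v n :=
  .seq (asg (cell 9 0 0) (.num 1)) <| .seq (asg (cell 1 0 0) (.reg .L0)) <|
  .seq (vec 3 fun e => .reg (.tbar e)) <| .seq (vec 4 fun e => .reg (.tbar e)) <|
  .loop (cell 8 0 0) (cell 9 0 0) (trialProg M p)

/-- Induction on the number j of trials left. The flag stays 0 as long as the stopping rule fails,
and a rejected trial cannot make it hold. Each pass costs one comparison more than a trial, and the
exit costs the final 1. -/
theorem runs_loop (hD : Valid N M D) (hG : IsOracle N D G) {p : Prog v n} {c : ℕ}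
    (hp : IsOracleProg N D G p c) {m : ℕ} (hm : StopsAfter N M D G m) :
    ∀ j k, k + j = m → ∀ σ : Reg v n → ℝ, Rep N D G ((dualProblem N M D G).state k) σ →
      (j = 0 → σ (cell 8 0 0) = 1) → (j ≠ 0 → σ (cell 8 0 0) = 0) →
      Runs (.loop (cell 8 0 0) (cell 9 0 0) (trialProg M p)) σ
        (j * (2 * c + (91 + 180 * n)) + 1) fun σ' =>
          Rep N D G ((dualProblem N M D G).state m) σ' := by
  intro j
  induction j with
  | zero =>
    intro k hk σ hr h1 _
    refine ⟨σ, 1, .loop_false ?_, by omega, ?_⟩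
    · rw [h1 rfl, hr.one]; exact lt_irrefl _
    · rwa [show m = k by omega]
  | succ j ih =>
    intro k hk σ hr _ h0
    have hkm : k < m := by omega
    have hs := (regular_dualProblem hD hG).inv_state k
    obtain ⟨σ₁, c₁, e₁, l₁, r₁, g₁, g₁'⟩ := runs_trial hD hG hp hs hr
    rw [← Composite.state_succ] at r₁ g₁ g₁'
    have hflag0 := h0 (by omega)
    have hterm : Stop N M D G ((dualProblem N M D G).state (k + 1)) ↔
        ((dualProblem N M D G).Accepts ((dualProblem N M D G).state k) ∧
          gap N M D G ((dualProblem N M D G).state (k + 1)) < D.eps) := by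
      constructor
      · intro hst
        refine ⟨?_, hst.2⟩
        by_contra hna
        rw [Composite.state_succ, stop_step_iff_of_not_accepts hna] at hst
        exact hm.2 k hkm hst
      · rintro ⟨hacc, hg⟩
        refine ⟨?_, hg⟩
        rw [Composite.state_succ, Composite.step_of_accepts hacc]
        simp
    obtain ⟨σ₂, c₂, e₂, l₂, r₂⟩ := ih (k + 1) (by omega) σ₁ r₁ (by
      intro hj
      apply g₁
      rw [← hterm, show k + 1 = m by omega]
      exact hm.1) (by
      intro hj
      rw [g₁', hflag0]
      rw [← hterm]
      exact hm.2 (k + 1) (by omega))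
    refine ⟨σ₂, _, .loop_true ?_ e₁ e₂, ?_, r₂⟩
    · rw [hflag0, hr.one]; exact one_pos
    · rw [Nat.succ_mul]; omega

theorem exec_method (hD : Valid N M D) (hG : IsOracle N D G) {p : Prog v n} {c : ℕ}
    (hp : IsOracleProg N D G p c) {m : ℕ} (hm : StopsAfter N M D G m) :
    ∃ σ k, Exec (methodProg M p) (input D) σ k ∧
      k ≤ (m + 1) * (2 * c + (91 + 180 * n)) ∧
      (∀ e : Fin n, σ (cell 4 0 e) = ((dualProblem N M D G).state m).t e) ∧
      ∀ e : Fin n, σ (cell 7 0 e) = avgFlow G ((dualProblem N M D G).state m).hist e := by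
  suffices h : Runs (methodProg M p) (input D) (1 + (1 + (n + (n
      + (m * (2 * c + (91 + 180 * n)) + 1))))) fun σ' =>
        Rep N D G ((dualProblem N M D G).state m) σ' by
    obtain ⟨σ, k, he, hk, hr⟩ := h
    refine ⟨σ, k, he, ?_, hr.t, hr.avg⟩
    rw [Nat.succ_mul]; omega
  have hm0 : m ≠ 0 := by
    obtain ⟨k, rfl⟩ := hm.exists_succ
    omega
  refine Runs.seq ((runs_asg_blk (b := 9) _ _ _ (by simp) (by simp)).mono (by simp)
    fun _ hq => hq) fun σ₁ h₁ => Runs.seq ((runs_asg_blk (b := 1) _ _ σ₁ (by simp)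
    (by simp)).mono (by simp) fun _ hq => hq) fun σ₂ h₂ => Runs.seq ((runs_vec _ σ₂ (by norm_num)
    (by simp)).mono (by simp) fun _ hq => hq) fun σ₃ h₃ => Runs.seq ((runs_vec _ σ₃ (by norm_num)
    (by simp)).mono (by simp) fun _ hq => hq) fun σ₄ h₄ => ?_
  obtain ⟨v₁, f₁⟩ := h₁
  obtain ⟨v₂, f₂⟩ := h₂
  obtain ⟨v₃, f₃⟩ := h₃
  obtain ⟨v₄, f₄⟩ := h₄
  have hz : ∀ b l j : ℕ, input D (cell b l j) = 0 := fun _ _ _ => rfl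
  refine runs_loop hD hG hp hm m 0 (by omega) σ₄ ?_ (fun h => absurd h hm0) fun _ => by
    simp [f₄, f₃, f₂, f₁, hz]
  constructor
  · intro x hx
    rw [f₄ x (by omega) (by omega), f₃ x (by omega) (by omega), f₂ x (by omega) (by omega),
      f₁ x (by omega) (by omega)]
  · rw [f₄ _ (by simp) (by simp), f₃ _ (by simp) (by simp), v₂, Ex.eval_reg,
      f₁ _ (by simp) (by simp)]; rfl
  · simp [f₄, f₃, f₂, f₁, hz, Composite.state, Composite.start, dualProblem]
  · intro e; rw [f₄ _ (by simp) (by simp), v₃, Ex.eval_reg, f₂ _ (by simp) (by simp),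
      f₁ _ (by simp) (by simp)]; rfl
  · intro e; rw [v₄, Ex.eval_reg, f₃ _ (by simp) (by simp), f₂ _ (by simp) (by simp),
      f₁ _ (by simp) (by simp)]; rfl
  · intro e; simp [f₄, f₃, f₂, f₁, hz, Composite.state, Composite.start, dualProblem]
  · simp [f₄, f₃, f₂, f₁, hz, Composite.state, Composite.start, dualProblem]
  · intro e
    simp [f₄, f₃, f₂, f₁, hz, Composite.state, Composite.start, avgFlow_nil]
  · simp [f₄, f₃, f₂, v₁]

end Traffic

namespace Traffic

variable {v n : ℕ} {N : Network v n} {M : Model} {D : Data v n} {G : (Fin n → ℝ) → Fin n → ℝ}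

/-! ### Sums over walks by dynamic programming -/

namespace Network

variable (N)

/-- The walks with `r` edges from `x` to `j`. -/
def walks : ℕ → Fin v → Fin v → Finset (List (Fin n))
  | 0, x, j => if x = j then {[]} else ∅
  | r + 1, x, j => (Finset.univ.filter fun e => N.src e = x).biUnion fun e =>
      (walks r (N.tgt e) j).image (List.cons e)

theorem mem_walks {r : ℕ} {x j : Fin v} {p : List (Fin n)} :
    p ∈ N.walks r x j ↔ IsWalk N.src N.tgt x j p ∧ p.length = r := by
  induction r generalizing x p with
  | zero =>
    rw [walks]
    split_ifs with h
    · cases p <;> simp [IsWalk, h]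
    · cases p <;> simp [IsWalk, h]
  | succ r ih =>
    cases p with
    | nil => simp [walks]
    | cons e p => simp [walks, IsWalk, ih, and_assoc]

theorem sum_walks_succ (r : ℕ) (x j : Fin v) (f : List (Fin n) → ℝ) :
    ∑ p ∈ N.walks (r + 1) x j, f p
      = ∑ e with N.src e = x, ∑ p ∈ N.walks r (N.tgt e) j, f (e :: p) := by
  rw [walks, Finset.sum_biUnion]
  · refine Finset.sum_congr rfl fun e _ => ?_
    rw [Finset.sum_image]
    intro a _ b _ h
    exact (List.cons.inj h).2
  · intro a _ b _ hab
    refine Finset.disjoint_left.mpr fun p hp hq => ?_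
    obtain ⟨q, -, rfl⟩ := Finset.mem_image.mp hp
    obtain ⟨q', -, h⟩ := Finset.mem_image.mp hq
    exact hab (List.cons.inj h).1.symm

theorem sum_walks_zero (x j : Fin v) (f : List (Fin n) → ℝ) :
    ∑ p ∈ N.walks 0 x j, f p = if x = j then f [] else 0 := by
  rw [walks]; split_ifs <;> simp

theorem sum_routes_of_allWalks (hN : N.AllWalks) {w : Fin v × Fin v} (hw : w ∈ N.od)
    (f : List (Fin n) → ℝ) :
    ∑ p ∈ N.routes w, f p = ∑ r ∈ Finset.range (N.maxLen + 1), ∑ p ∈ N.walks r w.1 w.2, f p := by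
  have h : N.routes w
      = (Finset.range (N.maxLen + 1)).biUnion fun r => N.walks r w.1 w.2 := by
    ext p
    simp only [Finset.mem_biUnion, Finset.mem_range, mem_walks]
    constructor
    · intro hp
      refine ⟨p.length, ?_, N.routes_walk w hw p hp, rfl⟩
      exact Nat.lt_succ_of_le ((Finset.le_sup (f := List.length) hp).trans
        (Finset.le_sup (f := fun w => (N.routes w).sup List.length) hw))
    · rintro ⟨r, hr, hp, rfl⟩
      exact hN w hw p hp (by omega)
  rw [h, Finset.sum_biUnion]
  intro a _ b _ hab
  refine Finset.disjoint_left.mpr fun p hp hq => hab ?_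
  rw [← ((N.mem_walks).mp hp).2, ((N.mem_walks).mp hq).2]

variable (W : Fin n → ℝ)

/-- The forward recursion for the weights of the walks from `i`. -/
def fwd (i : Fin v) : ℕ → Fin v → ℝ
  | 0, x => if x = i then 1 else 0
  | l + 1, x => ∑ e with N.tgt e = x, W e * fwd i l (N.src e)

/-- The backward recursion with terminal values `g`. -/
def bwd (g : Fin v → ℝ) : ℕ → Fin v → ℝ
  | 0, x => g x
  | r + 1, x => g x + ∑ e with N.src e = x, W e * bwd g r (N.tgt e)

/-- The weight of a walk. -/
def wt (p : List (Fin n)) : ℝ := (p.map W).prod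

theorem sum_fwd_mul (i : Fin v) (l : ℕ) (f : Fin n → ℝ) :
    ∑ x, N.fwd W i l x * ∑ e with N.src e = x, f e = ∑ e, N.fwd W i l (N.src e) * f e := by
  simp_rw [Finset.mul_sum, Finset.sum_filter]
  rw [Finset.sum_comm]
  simp

theorem sum_fwd_succ_mul (i : Fin v) (l : ℕ) (f : Fin v → ℝ) :
    ∑ x, N.fwd W i (l + 1) x * f x
      = ∑ e, N.fwd W i l (N.src e) * (W e * f (N.tgt e)) := by
  simp_rw [fwd, Finset.sum_mul, Finset.sum_filter]
  rw [Finset.sum_comm]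
  refine Finset.sum_congr rfl fun e _ => ?_
  rw [Finset.sum_ite_eq]
  simp only [Finset.mem_univ, if_true]; ring

/-- A walk with l + r edges is split after l edges at the vertex x. Moving the cut by one edge is
the induction step; l = 0 identifies the forward recursion with the sum over walks. -/
theorem sum_fwd_walks (i j : Fin v) (r : ℕ) : ∀ l,
    ∑ x, N.fwd W i l x * ∑ p ∈ N.walks r x j, wt W p = N.fwd W i (l + r) j := by
  induction r with
  | zero =>
    intro l
    simp [sum_walks_zero, wt]
  | succ r ih =>
    intro l
    simp_rw [sum_walks_succ]
    rw [sum_fwd_mul, ← Nat.succ_add_eq_add_succ, ← ih (l + 1), sum_fwd_succ_mul]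
    simp [wt, Finset.mul_sum]

theorem sum_walks_wt (i j : Fin v) (r : ℕ) :
    ∑ p ∈ N.walks r i j, wt W p = N.fwd W i r j := by
  have := N.sum_fwd_walks W i j r 0
  simpa [fwd] using this

/-- A single backward recursion handles all destinations at once: a walk with at most r edges ending
at j is weighted by the terminal value g j. -/
theorem bwd_eq (g : Fin v → ℝ) (r : ℕ) : ∀ x, N.bwd W g r x
    = ∑ j, g j * ∑ s ∈ Finset.range (r + 1), ∑ p ∈ N.walks s x j, wt W p := by
  induction r with
  | zero => intro x; simp [bwd, sum_walks_zero, wt]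
  | succ r ih =>
    intro x
    have h : ∀ j, ∑ s ∈ Finset.range (r + 1 + 1), ∑ p ∈ N.walks s x j, wt W p
        = (if x = j then 1 else 0) + ∑ e with N.src e = x, W e *
          ∑ s ∈ Finset.range (r + 1), ∑ p ∈ N.walks s (N.tgt e) j, wt W p := by
      intro j
      rw [Finset.sum_range_succ', sum_walks_zero, add_comm]
      congr 1
      simp_rw [sum_walks_succ, wt, List.map_cons, List.prod_cons, ← Finset.mul_sum]
      rw [Finset.sum_comm]
      simp_rw [Finset.mul_sum]
    simp_rw [h, mul_add, Finset.sum_add_distrib, bwd, ih]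
    congr 1
    · simp
    · simp_rw [Finset.mul_sum]
      rw [Finset.sum_comm]
      refine Finset.sum_congr rfl fun e _ => Finset.sum_congr rfl fun j _ => ?_
      refine Finset.sum_congr rfl fun s _ => Finset.sum_congr rfl fun p _ => by ring

/-- The total weight of the uses of `e` by the walks with at most `r` edges from `x`. -/
def uses (g : Fin v → ℝ) (e : Fin n) (r : ℕ) (x : Fin v) : ℝ :=
  ∑ j, g j * ∑ s ∈ Finset.range (r + 1), ∑ p ∈ N.walks s x j, theta e p * wt W p

theorem uses_zero (g : Fin v → ℝ) (e : Fin n) (x : Fin v) : N.uses W g e 0 x = 0 := by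
  simp [uses, sum_walks_zero, theta]

/-- Split off the first edge of the walk. If it is e, it contributes one use for every continuation,
which is the backward value; the uses further on are counted recursively. -/
theorem uses_succ (g : Fin v → ℝ) (e : Fin n) (r : ℕ) (x : Fin v) :
    N.uses W g e (r + 1) x = ∑ e' with N.src e' = x,
      W e' * ((if e' = e then N.bwd W g r (N.tgt e') else 0) + N.uses W g e r (N.tgt e')) := by
  have h : ∀ j, ∑ s ∈ Finset.range (r + 1 + 1), ∑ p ∈ N.walks s x j, theta e p * wt W p
      = ∑ e' with N.src e' = x, W e' *
        ((if e' = e then ∑ s ∈ Finset.range (r + 1), ∑ p ∈ N.walks s (N.tgt e') j, wt W p else 0)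
          + ∑ s ∈ Finset.range (r + 1), ∑ p ∈ N.walks s (N.tgt e') j, theta e p * wt W p) := by
    intro j
    rw [Finset.sum_range_succ', sum_walks_zero]
    simp only [theta, List.count_nil, Nat.cast_zero, zero_mul, ite_self, add_zero]
    simp_rw [sum_walks_succ]
    rw [Finset.sum_comm]
    refine Finset.sum_congr rfl fun e' _ => ?_
    have : (if e' = e then ∑ s ∈ Finset.range (r + 1), ∑ p ∈ N.walks s (N.tgt e') j, wt W p else 0)
        = ∑ s ∈ Finset.range (r + 1), ∑ p ∈ N.walks s (N.tgt e') j,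
          (if e' = e then (1 : ℝ) else 0) * wt W p := by
      split_ifs <;> simp
    rw [this, ← Finset.sum_add_distrib, Finset.mul_sum]
    refine Finset.sum_congr rfl fun s _ => ?_
    rw [← Finset.sum_add_distrib, Finset.mul_sum]
    refine Finset.sum_congr rfl fun p _ => ?_
    rw [List.count_cons, wt, List.map_cons, List.prod_cons, ← wt]
    by_cases he : e' = e <;> simp [he] <;> ring
  simp_rw [uses, h, Finset.mul_sum]
  rw [Finset.sum_comm]
  refine Finset.sum_congr rfl fun e' _ => ?_
  by_cases he : e' = e
  · simp only [he, if_true, mul_add, Finset.sum_add_distrib, bwd_eq, Finset.mul_sum]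
    congr 1 <;> refine Finset.sum_congr rfl fun j _ => Finset.sum_congr rfl fun s _ =>
      Finset.sum_congr rfl fun p _ => by ring
  · simp only [he, if_false, zero_add, Finset.mul_sum]
    refine Finset.sum_congr rfl fun j _ => Finset.sum_congr rfl fun s _ =>
      Finset.sum_congr rfl fun p _ => by ring

/-- A use of e at position k decomposes the walk into a prefix of l + k edges, the edge e, and a
suffix with at most m − 1 − k edges. Thus two tables suffice for the flows on all edges. -/
theorem sum_fwd_uses (i : Fin v) (g : Fin v → ℝ) (e : Fin n) (m : ℕ) : ∀ l,
    ∑ x, N.fwd W i l x * N.uses W g e m x = ∑ k ∈ Finset.range m,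
      N.fwd W i (l + k) (N.src e) * (W e * N.bwd W g (m - 1 - k) (N.tgt e)) := by
  induction m with
  | zero => intro l; simp [uses_zero]
  | succ m ih =>
    intro l
    simp_rw [uses_succ]
    rw [sum_fwd_mul, Finset.sum_range_succ']
    have hk : ∀ k ∈ Finset.range m,
        N.fwd W i (l + (k + 1)) (N.src e) * (W e * N.bwd W g (m + 1 - 1 - (k + 1)) (N.tgt e))
        = N.fwd W i (l + 1 + k) (N.src e) * (W e * N.bwd W g (m - 1 - k) (N.tgt e)) := by
      intro k _
      rw [show l + (k + 1) = l + 1 + k by ring, show m + 1 - 1 - (k + 1) = m - 1 - k by omega]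
    rw [Finset.sum_congr rfl hk, ← ih (l + 1), sum_fwd_succ_mul, add_comm]
    simp_rw [mul_add, Finset.sum_add_distrib]
    congr 1
    rw [Finset.sum_eq_single e]
    · simp
    · intro b _ hb; simp [hb]
    · simp

theorem uses_eq (i : Fin v) (g : Fin v → ℝ) (e : Fin n) (m : ℕ) :
    N.uses W g e m i = ∑ k ∈ Finset.range m,
      N.fwd W i k (N.src e) * (W e * N.bwd W g (m - 1 - k) (N.tgt e)) := by
  have := N.sum_fwd_uses W i g e m 0
  simpa [fwd] using this

/-- The vertices that are incident with an edge. -/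
def verts : Finset (Fin v) := Finset.univ.image N.src ∪ Finset.univ.image N.tgt

theorem src_mem_verts (e : Fin n) : N.src e ∈ N.verts := by simp [verts]

theorem tgt_mem_verts (e : Fin n) : N.tgt e ∈ N.verts := by simp [verts]

/-- Isolated vertices are left out, so that the cost of a layer is bounded by the number of edges
whatever v is. -/
theorem card_verts_le : N.verts.card ≤ 2 * n := by
  refine (Finset.card_union_le _ _).trans ?_
  have h₁ : (Finset.univ.image N.src).card ≤ n := Finset.card_image_le.trans (by simp)
  have h₂ : (Finset.univ.image N.tgt).card ≤ n := Finset.card_image_le.trans (by simp)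
  omega

theorem exists_walk {w : Fin v × Fin v} (hw : w ∈ N.od) :
    ∃ p ∈ N.routes w, IsWalk N.src N.tgt w.1 w.2 p ∧ p ≠ [] := by
  obtain ⟨p, hp⟩ := N.routes_nonempty w hw
  have h := N.routes_walk w hw p hp
  refine ⟨p, hp, h, ?_⟩
  rintro rfl
  exact N.od_ne w hw h

end Network

theorem IsWalk.tgt_mem {N : Network v n} {x j : Fin v} {p : List (Fin n)}
    (h : IsWalk N.src N.tgt x j p) (hp : p ≠ []) : j ∈ N.verts := by
  induction p generalizing x with
  | nil => exact absurd rfl hp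
  | cons e p ih =>
    cases p with
    | nil => rw [← h.2]; exact N.tgt_mem_verts e
    | cons e' p => exact ih h.2 (by simp)

namespace Network

variable (N)

theorem snd_mem_verts {w : Fin v × Fin v} (hw : w ∈ N.od) : w.2 ∈ N.verts := by
  obtain ⟨p, -, h, hp⟩ := N.exists_walk hw
  exact h.tgt_mem hp

/-- The origins. -/
def origins : Finset (Fin v) := N.od.image Prod.fst

/-- Grouping the pairs by origin is what makes the cost proportional to S and not to the number of
pairs. -/
theorem sum_od (f : Fin v × Fin v → ℝ) :
    ∑ w ∈ N.od, f w = ∑ i ∈ N.origins, ∑ j ∈ N.verts with (i, j) ∈ N.od, f (i, j) := by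
  rw [← Finset.sum_fiberwise_of_maps_to (g := Prod.fst) (t := N.origins)
    fun w hw => Finset.mem_image_of_mem _ hw]
  refine Finset.sum_congr rfl fun i _ => ?_
  refine Finset.sum_bij' (fun w _ => w.2) (fun j _ => (i, j)) ?_ ?_ ?_ ?_ ?_
  · rintro ⟨a, b⟩ hw
    obtain ⟨hab, rfl⟩ := Finset.mem_filter.mp hw
    exact Finset.mem_filter.mpr ⟨N.snd_mem_verts hab, hab⟩
  · intro j hj
    exact Finset.mem_filter.mpr ⟨(Finset.mem_filter.mp hj).2, rfl⟩
  · rintro ⟨a, b⟩ hw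
    obtain ⟨hab, rfl⟩ := Finset.mem_filter.mp hw
    rfl
  · intro j _; rfl
  · rintro ⟨a, b⟩ hw
    obtain ⟨hab, rfl⟩ := Finset.mem_filter.mp hw
    rfl

theorem S_pos : 0 < N.S := Finset.card_pos.mpr (N.od_nonempty.image _)

theorem length_eq_sum_count (p : List (Fin n)) : p.length = ∑ e : Fin n, p.count e := by
  induction p with
  | nil => simp
  | cons e p ih => simp [List.count_cons, Finset.sum_add_distrib, ih]

/-- The length is the sum of the multiplicities, and each natural number is at most its square. -/
theorem maxLen_le_H : N.maxLen ≤ N.H := by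
  refine Finset.sup_mono_fun fun w _ => Finset.sup_mono_fun fun p _ => ?_
  rw [length_eq_sum_count]
  exact Finset.sum_le_sum fun e _ => Nat.le_self_pow two_ne_zero _

theorem maxLen_pos : 0 < N.maxLen := by
  obtain ⟨w, hw⟩ := N.od_nonempty
  obtain ⟨p, hp, -, hne⟩ := N.exists_walk hw
  exact (List.length_pos_iff.mpr hne).trans_le ((Finset.le_sup (f := List.length) hp).trans
    (Finset.le_sup (f := fun w => (N.routes w).sup List.length) hw))

theorem card_edges_pos (N : Network v n) : 0 < n := by
  obtain ⟨w, hw⟩ := N.od_nonempty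
  obtain ⟨p, hp, -, hne⟩ := N.exists_walk hw
  obtain ⟨e, -⟩ := List.exists_mem_of_ne_nil p hne
  exact e.pos

end Network

/-! ### Potential and flows by dynamic programming -/

/-- The weights `exp (-t_e / γ)`. -/
def expWeight (D : Data v n) (t : Fin n → ℝ) (e : Fin n) : ℝ := Real.exp (-(t e) / D.gamma)

/-- The terminal values of the backward recursion. -/
def terminal (N : Network v n) (D : Data v n) (t : Fin n → ℝ) (i x : Fin v) : ℝ :=
  if (i, x) ∈ N.od then D.dem (i, x) /
    ∑ l ∈ Finset.range (N.maxLen + 1), N.fwd (expWeight D t) i l x else 0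

theorem routeCost_eq_sum (t : Fin n → ℝ) (p : List (Fin n)) : routeCost t p = (p.map t).sum := by
  induction p with
  | nil => simp [routeCost, theta]
  | cons e p ih =>
    rw [List.map_cons, List.sum_cons, ← ih]
    simp [routeCost, theta, List.count_cons, add_mul, Finset.sum_add_distrib, add_comm]

theorem exp_routeCost (t : Fin n → ℝ) (p : List (Fin n)) :
    Real.exp (-routeCost t p / D.gamma) = Network.wt (expWeight D t) p := by
  rw [routeCost_eq_sum, Network.wt]
  induction p with
  | nil => simp
  | cons e p ih =>
    rw [List.map_cons, List.sum_cons, List.map_cons, List.prod_cons, ← ih, expWeight, ← Real.exp_add]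
    congr 1; ring

theorem partition_eq (hN : N.AllWalks) (t : Fin n → ℝ) {w : Fin v × Fin v} (hw : w ∈ N.od) :
    partition N D t w
      = ∑ l ∈ Finset.range (N.maxLen + 1), N.fwd (expWeight D t) w.1 l w.2 := by
  rw [partition, N.sum_routes_of_allWalks hN hw]
  simp_rw [exp_routeCost, N.sum_walks_wt]

theorem potential_eq_sum (hN : N.AllWalks) (hg : 0 < D.gamma) (t : Fin n → ℝ) :
    potential N D t = ∑ i ∈ N.origins, ∑ j ∈ N.verts with (i, j) ∈ N.od,
      D.gamma * (D.dem (i, j) * Real.log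
        (∑ l ∈ Finset.range (N.maxLen + 1), N.fwd (expWeight D t) i l j)) := by
  rw [potential_of_pos N hg, Finset.mul_sum, N.sum_od]
  refine Finset.sum_congr rfl fun i _ => Finset.sum_congr rfl fun j hj => ?_
  rw [partition_eq hN t (Finset.mem_filter.mp hj).2]

/-- With terminal values d_w/Z_w the weight of a walk times its terminal value is its logit flow.
All destinations of one origin are then served by one forward and one backward pass. -/
theorem edgeFlow_logit_eq (hN : N.AllWalks) (t : Fin n → ℝ) (e : Fin n) :
    edgeFlow N (logitFlow N D t) e = ∑ i ∈ N.origins, ∑ k ∈ Finset.range N.maxLen,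
      N.fwd (expWeight D t) i k (N.src e) * (expWeight D t e *
        N.bwd (expWeight D t) (terminal N D t i) (N.maxLen - 1 - k) (N.tgt e)) := by
  simp_rw [← N.uses_eq, edgeFlow]
  rw [N.sum_od]
  refine Finset.sum_congr rfl fun i _ => ?_
  rw [Network.uses]
  have hsub : ∑ j ∈ N.verts with (i, j) ∈ N.od, terminal N D t i j *
      ∑ s ∈ Finset.range (N.maxLen + 1), ∑ p ∈ N.walks s i j,
        theta e p * Network.wt (expWeight D t) p
      = ∑ j, terminal N D t i j * ∑ s ∈ Finset.range (N.maxLen + 1), ∑ p ∈ N.walks s i j,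
        theta e p * Network.wt (expWeight D t) p := by
    refine Finset.sum_subset (Finset.subset_univ _) fun j _ hj => ?_
    rw [terminal, if_neg, zero_mul]
    intro h
    exact hj (Finset.mem_filter.mpr ⟨N.snd_mem_verts h, h⟩)
  rw [← hsub]
  refine Finset.sum_congr rfl fun j hj => ?_
  have hw := (Finset.mem_filter.mp hj).2
  rw [terminal, if_pos hw, ← N.sum_routes_of_allWalks hN hw, ← partition_eq hN t hw,
    Finset.mul_sum]
  refine Finset.sum_congr rfl fun p _ => ?_
  rw [logitFlow, exp_routeCost, ← partition]
  ring

end Traffic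

namespace Traffic

variable {v n : ℕ} {N : Network v n} {M : Model} {D : Data v n} {G : (Fin n → ℝ) → Fin n → ℝ}

/-! ### The program of the oracle in the stochastic case -/

/-- Running a program for each element of a list. -/
def each {ι : Type*} (l : List ι) (p : ι → Prog v n) : Prog v n :=
  l.foldr (fun i q => .seq (p i) q) .skip

/-- P is an invariant of all the runs, and Q i the result of run i, which the other runs must not
destroy. -/
theorem runs_each {ι : Type*} (P : (Reg v n → ℝ) → Prop) (Q : ι → (Reg v n → ℝ) → Prop)
    (p : ι → Prog v n) (c : ℕ) (l : List ι) (hl : l.Nodup)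
    (h : ∀ i ∈ l, ∀ σ, P σ → Runs (p i) σ c fun σ' =>
      P σ' ∧ Q i σ' ∧ ∀ j, j ≠ i → Q j σ → Q j σ') {σ : Reg v n → ℝ} (hσ : P σ) :
    Runs (each l p) σ (l.length * c) fun σ' => P σ' ∧ ∀ i ∈ l, Q i σ' := by
  suffices hs : ∀ (l : List ι), l.Nodup → (∀ i ∈ l, ∀ σ, P σ → Runs (p i) σ c fun σ' =>
      P σ' ∧ Q i σ' ∧ ∀ j, j ≠ i → Q j σ → Q j σ') → ∀ σ, P σ →
      Runs (each l p) σ (l.length * c) fun σ' => P σ' ∧ (∀ i ∈ l, Q i σ') ∧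
        ∀ j, j ∉ l → Q j σ → Q j σ' from
    (hs l hl h σ hσ).mono le_rfl fun σ' h => ⟨h.1, h.2.1⟩
  intro l
  induction l with
  | nil =>
    intro _ _ σ hσ
    exact (Runs.skip ⟨hσ, by simp, fun _ _ h => h⟩).weaken (by simp)
  | cons i l ih =>
    intro hl h σ hσ
    rw [List.nodup_cons] at hl
    refine Runs.weaken (c := c + l.length * c) (by rw [List.length_cons, Nat.succ_mul]; omega) ?_
    refine (h i (by simp) σ hσ).seq fun σ₁ h₁ =>
      (ih hl.2 (fun j hj => h j (by simp [hj])) σ₁ h₁.1).mono le_rfl fun σ₂ h₂ =>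
      ⟨h₂.1, fun j hj => ?_, fun j hj hq => ?_⟩
    · rcases List.mem_cons.mp hj with rfl | hj
      · exact h₂.2.2 _ hl.1 h₁.2.1
      · exact h₂.2.1 j hj
    · rw [List.mem_cons, not_or] at hj
      exact h₂.2.2 j hj.2 (h₁.2.2 j hj.1 hq)

namespace Network

variable (N)

/-- The layer `l` of the forward recursion. -/
def fwdEx (i : Fin v) : ℕ → Fin v → Ex v n
  | 0, x => .num (if x = i then 1 else 0)
  | l + 1, x => .sum (Finset.univ.filter fun e => N.tgt e = x) fun e =>
      ar 60 e * .reg (cell 61 l (N.src e))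

/-- The layer `r` of the backward recursion. -/
def bwdEx : ℕ → Fin v → Ex v n
  | 0, x => .reg (cell 63 0 x)
  | r + 1, x => .reg (cell 63 0 x) + .sum (Finset.univ.filter fun e => N.src e = x) fun e =>
      ar 60 e * .reg (cell 64 r (N.tgt e))

/-- The layers of a recursion. -/
def layers (b : ℕ) (E : ℕ → Fin v → Ex v n) : ℕ → Prog v n
  | 0 => arr N.verts (fun x => cell b 0 x) (E 0)
  | l + 1 => .seq (layers b E l) (arr N.verts (fun x => cell b (l + 1) x) (E (l + 1)))

/-- Layer l reads only earlier layers of block b and registers outside it. All layers are kept,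
because the flow of an edge combines different forward and backward layers. -/
theorem runs_layers {b : ℕ} (hb : b ≠ 99) (E : ℕ → Fin v → Ex v n) (c : ℕ)
    (hc : ∀ l, ∑ x ∈ N.verts, (E l x).size ≤ c)
    (hE : ∀ l x, x ∈ N.verts → (E l x).All fun y =>
      (blk y ≠ b ∨ ∃ k x, k < l ∧ y = cell b k x) ∧ blk y ≠ 99)
    (a : ℕ → Fin v → ℝ) (m : ℕ) (σ : Reg v n → ℝ)
    (ha : ∀ l, ∀ x ∈ N.verts, ∀ σ' : Reg v n → ℝ,
      (∀ y, blk y ≠ b → blk y ≠ 99 → σ' y = σ y) →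
      (∀ k < l, ∀ x ∈ N.verts, σ' (cell b k x) = a k x) → (E l x).eval σ' = a l x) :
    Runs (N.layers b E m) σ ((m + 1) * c) fun σ' =>
      (∀ y, blk y ≠ b → blk y ≠ 99 → σ' y = σ y) ∧
      ∀ k ≤ m, ∀ x ∈ N.verts, σ' (cell b k x) = a k x := by
  have hinj : ∀ l : ℕ, Set.InjOn (fun x : Fin v => (cell b l x : Reg v n)) N.verts := by
    intro l x _ y _ hxy
    simpa [Fin.ext_iff] using hxy
  have hrun : ∀ (l : ℕ) (σ' : Reg v n → ℝ), (∀ y, blk y ≠ b → blk y ≠ 99 → σ' y = σ y) →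
      (∀ k < l, ∀ x ∈ N.verts, σ' (cell b k x) = a k x) →
      Runs (arr N.verts (fun x => cell b l x) (E l)) σ' c fun σ'' =>
        (∀ y, blk y ≠ b → blk y ≠ 99 → σ'' y = σ y) ∧
        ∀ k < l + 1, ∀ x ∈ N.verts, σ'' (cell b k x) = a k x := by
    intro l σ' h₁ h₂
    refine (runs_arr N.verts (fun x : Fin v => (cell b l x : Reg v n)) (E l) σ' (hinj l) ?_
      (fun i _ => by simpa using hb)).mono (hc l) ?_
    · intro x hx
      refine (hE l x hx).mono fun y hy => ⟨fun z _ hyz => ?_, hy.2⟩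
      subst hyz
      rcases hy.1 with h | ⟨k, x, hk, h⟩
      · exact h (by simp)
      · rw [cell_inj] at h; omega
    · rintro σ'' ⟨hv, hf⟩
      refine ⟨fun y hy hy' => ?_, fun k hk x hx => ?_⟩
      · rw [hf y (fun j _ h => hy (by rw [h]; simp)) hy', h₁ y hy hy']
      · rcases Nat.lt_succ_iff_lt_or_eq.mp hk with hk | rfl
        · rw [hf _ (fun j _ h => ?_) (by simpa using hb), h₂ k hk x hx]
          rw [cell_inj] at h; omega
        · rw [hv x hx]
          exact ha k x hx σ' h₁ h₂
  induction m with
  | zero =>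
    refine (hrun 0 σ (fun _ _ _ => rfl) (by simp)).mono (by simp) fun σ' h => ⟨h.1, fun k hk => ?_⟩
    exact h.2 k (by omega)
  | succ m ih =>
    refine Runs.weaken (c := (m + 1) * c + c) (by rw [Nat.succ_mul (m + 1)]) ?_
    refine ih.seq fun σ₁ h₁ => (hrun (m + 1) σ₁ h₁.1 fun k hk => h₁.2 k (by omega)).mono le_rfl
      fun σ₂ h₂ => ⟨h₂.1, fun k hk => h₂.2 k (by omega)⟩

/-- The contribution of the origin `i`: the flows into layer `i` of block `65`, the potential
into layer `i` of block `66`. -/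
def logitOriginProg (i : Fin v) : Prog v n :=
  .seq (N.layers 61 (N.fwdEx i) N.maxLen)
  (.seq (arr N.verts (fun x => cell 62 0 x) fun x =>
    .sum (Finset.range (N.maxLen + 1)) fun l => .reg (cell 61 l x))
  (.seq (arr N.verts (fun x => cell 63 0 x) fun x =>
    if (i, x) ∈ N.od then .reg (.dem (i, x)) / .reg (cell 62 0 x) else .num 0)
  (.seq (N.layers 64 N.bwdEx N.maxLen)
  (.seq (arr Finset.univ (fun e : Fin n => cell 65 i e) fun e =>
    .sum (Finset.range N.maxLen) fun k => .reg (cell 61 k (N.src e)) *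
      (ar 60 e * .reg (cell 64 (N.maxLen - 1 - k) (N.tgt e))))
  (asg (cell 66 i 0) (.sum (N.verts.filter fun j => (i, j) ∈ N.od) fun j =>
    .reg .gamma * (.reg (.dem (i, j)) * Ex.log (.reg (cell 62 0 j)))))))))

theorem sum_card_tgt : ∑ x ∈ N.verts, (Finset.univ.filter fun e => N.tgt e = x).card = n := by
  rw [← Finset.card_eq_sum_card_fiberwise fun e _ => N.tgt_mem_verts e]; simp

theorem sum_card_src : ∑ x ∈ N.verts, (Finset.univ.filter fun e => N.src e = x).card = n := by
  rw [← Finset.card_eq_sum_card_fiberwise fun e _ => N.src_mem_verts e]; simp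

theorem sum_size_fwdEx (i : Fin v) (l : ℕ) : ∑ x ∈ N.verts, (N.fwdEx i l x).size ≤ 6 * n := by
  have hV := N.card_verts_le
  cases l with
  | zero => simp [fwdEx]; omega
  | succ l =>
    simp only [fwdEx, Ex.size_sum, Ex.size_mul, ar, Ex.size_reg, Finset.sum_const, smul_eq_mul,
      Finset.sum_add_distrib, mul_one, ← Finset.sum_mul]
    rw [N.sum_card_tgt]; omega

theorem sum_size_bwdEx (r : ℕ) : ∑ x ∈ N.verts, (N.bwdEx r x).size ≤ 10 * n := by
  have hV := N.card_verts_le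
  cases r with
  | zero => simp [bwdEx]; omega
  | succ l =>
    simp only [bwdEx, Ex.size_sum, Ex.size_add, Ex.size_mul, ar, Ex.size_reg, Finset.sum_const,
      smul_eq_mul, Finset.sum_add_distrib, mul_one, ← Finset.sum_mul]
    rw [N.sum_card_src]; omega

/-- There are at most H layers per pass and O(n) work per layer, since the in- and out-degrees sum
to n. Results of different origins are kept in different layers of blocks 65 and 66, hence the
second frame condition. -/
theorem runs_logitOrigin (t : Fin n → ℝ) (i : Fin v) (σ : Reg v n → ℝ) (hin : HasInput D σ)
    (hW : ∀ e : Fin n, σ (cell 60 0 e) = expWeight D t e) :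
    Runs (N.logitOriginProg i) σ (100 * (N.maxLen * n)) fun σ' =>
      (∀ y, blk y ≤ 60 → σ' y = σ y) ∧
      (∀ y, (blk y = 65 ∨ blk y = 66) → (∀ e : Fin n, y ≠ cell 65 i e) → y ≠ cell 66 i 0 →
        σ' y = σ y) ∧
      (∀ e : Fin n, σ' (cell 65 i e) = ∑ k ∈ Finset.range N.maxLen,
        N.fwd (expWeight D t) i k (N.src e) * (expWeight D t e *
          N.bwd (expWeight D t) (terminal N D t i) (N.maxLen - 1 - k) (N.tgt e))) ∧
      σ' (cell 66 i 0) = ∑ j ∈ N.verts with (i, j) ∈ N.od, D.gamma * (D.dem (i, j) *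
        Real.log (∑ l ∈ Finset.range (N.maxLen + 1), N.fwd (expWeight D t) i l j)) := by
  have hV := N.card_verts_le
  have hK := N.maxLen_pos
  have hinj : ∀ b : ℕ, Set.InjOn (fun x : Fin v => (cell b 0 x : Reg v n)) N.verts := by
    intro b x _ y _ hxy
    simpa [Fin.ext_iff] using hxy
  have h₁ := N.runs_layers (b := 61) (by norm_num) (N.fwdEx i) (6 * n) (N.sum_size_fwdEx i)
    (by
      intro l x _
      cases l with
      | zero => simp [fwdEx]
      | succ l =>
        simp only [fwdEx, Ex.all_sum, Ex.all_mul, ar, Ex.all_reg, blk_cell]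
        intro e _
        exact ⟨⟨Or.inl (by norm_num), by norm_num⟩, Or.inr ⟨l, _, by omega, rfl⟩, by norm_num⟩)
    (N.fwd (expWeight D t) i) N.maxLen σ (by
      intro l x _ σ' hf hl
      cases l with
      | zero => simp only [fwdEx, fwd, Ex.eval_num]; split_ifs <;> simp
      | succ l =>
        simp only [fwdEx, fwd, Ex.eval_sum, Ex.eval_mul, ar, Ex.eval_reg]
        refine Finset.sum_congr rfl fun e _ => ?_
        rw [hf _ (by simp) (by simp), hW, hl l (by omega) _ (N.src_mem_verts e)])
  refine Runs.weaken (c := _ + (_ + (_ + (_ + (_ + _))))) ?_ (h₁.seq fun σ₁ h₁ =>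
    (runs_arr_blk (b := 62) N.verts _ _ σ₁ (by norm_num) (hinj 62) (by simp) (by simp)).seq
      fun σ₂ h₂ =>
    (runs_arr_blk (b := 63) N.verts _ _ σ₂ (by norm_num) (hinj 63) (by simp)
      (by intro x _; split_ifs <;> simp)).seq fun σ₃ h₃ =>
    ((N.runs_layers (b := 64) (by norm_num) N.bwdEx (10 * n) N.sum_size_bwdEx
      (by
        intro l x _
        cases l with
        | zero => simp [bwdEx]
        | succ l =>
          simp only [bwdEx, Ex.all_sum, Ex.all_add, Ex.all_mul, ar, Ex.all_reg, blk_cell]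
          refine ⟨⟨Or.inl (by norm_num), by norm_num⟩, fun e _ => ?_⟩
          exact ⟨⟨Or.inl (by norm_num), by norm_num⟩, Or.inr ⟨l, _, by omega, rfl⟩, by norm_num⟩)
      (N.bwd (expWeight D t) (terminal N D t i)) N.maxLen σ₃ (by
        have hg : ∀ x ∈ N.verts, σ₃ (cell 63 0 x) = terminal N D t i x := by
          intro x hx
          rw [h₃.1 x hx, terminal]
          split_ifs with hod
          · rw [Ex.eval_div, Ex.eval_reg, Ex.eval_reg, h₂.1 x hx, Ex.eval_sum]
            congr 1
            · rw [h₂.2 _ (by simp) (by simp), h₁.1 _ (by simp) (by simp), hin _ (by simp)]; rfl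
            · refine Finset.sum_congr rfl fun l hl => ?_
              exact h₁.2 l (by rw [Finset.mem_range] at hl; omega) x hx
          · simp
        intro r x hx σ' hf hr
        cases r with
        | zero => simp only [bwdEx, bwd, Ex.eval_reg]; rw [hf _ (by simp) (by simp), hg x hx]
        | succ r =>
          simp only [bwdEx, bwd, Ex.eval_add, Ex.eval_sum, Ex.eval_mul, ar, Ex.eval_reg]
          rw [hf _ (by simp) (by simp), hg x hx]
          congr 1
          refine Finset.sum_congr rfl fun e _ => ?_
          rw [hf _ (by simp) (by simp), h₃.2 _ (by simp) (by simp), h₂.2 _ (by simp) (by simp),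
            h₁.1 _ (by simp) (by simp), hW, hr r (by omega) _ (N.tgt_mem_verts e)]))).seq
      fun σ₄ h₄ =>
    (runs_arr Finset.univ (fun e : Fin n => (cell 65 i e : Reg v n)) _ σ₄
      (by intro a _ b _ hab; simpa [Fin.ext_iff] using hab) (by simp [ar]) (by simp)).seq
      fun σ₅ h₅ =>
    (runs_asg (cell 66 i 0) _ σ₅ (by simp)).mono le_rfl ?_)
  -- The cost uses |verts| ≤ 2n and maxLen ≥ 1; the latter absorbs the terms linear in n and the
  -- extra layer 0.
  · have e₁ : ∑ x ∈ N.verts, (if (i, x) ∈ N.od then Ex.reg (.dem (i, x)) / Ex.reg (cell 62 0 x)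
        else Ex.num 0 : Ex v n).size ≤ 6 * n := by
      refine (Finset.sum_le_card_nsmul _ _ 3 fun x _ => ?_).trans (by rw [smul_eq_mul]; omega)
      split_ifs <;> simp
    have e₂ : (N.verts.filter fun j => (i, j) ∈ N.od).card ≤ 2 * n :=
      (Finset.card_filter_le _ _).trans hV
    have e₃ := Nat.mul_le_mul_right (N.maxLen + 1) hV
    have e₄ : n ≤ N.maxLen * n := Nat.le_mul_of_pos_left _ hK
    have e₅ := N.card_edges_pos
    simp only [Ex.size_sum, Ex.size_mul, Ex.size_log, ar, Ex.size_reg, Finset.sum_const,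
      smul_eq_mul, Finset.card_range, Finset.card_univ, Fintype.card_fin]
    nlinarith
  · rintro σ₆ ⟨v₆, f₆⟩
    obtain ⟨f₁, v₁⟩ := h₁
    obtain ⟨v₂, f₂⟩ := h₂
    obtain ⟨v₃, f₃⟩ := h₃
    obtain ⟨f₄, v₄⟩ := h₄
    obtain ⟨v₅, f₅⟩ := h₅
    refine ⟨fun y hy => ?_, fun y hy hy₁ hy₂ => ?_, fun e => ?_, ?_⟩
    · rw [f₆ y (by rintro rfl; simp at hy) (by omega),
        f₅ y (by rintro j - rfl; simp at hy) (by omega), f₄ y (by omega) (by omega),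
        f₃ y (by omega) (by omega), f₂ y (by omega) (by omega), f₁ y (by omega) (by omega)]
    · rw [f₆ y hy₂ (by omega), f₅ y (fun j _ => hy₁ j) (by omega), f₄ y (by omega) (by omega),
        f₃ y (by omega) (by omega), f₂ y (by omega) (by omega), f₁ y (by omega) (by omega)]
    · rw [f₆ _ (by simp) (by simp), v₅ e (Finset.mem_univ e)]
      simp only [Ex.eval_sum, Ex.eval_mul, ar, Ex.eval_reg]
      refine Finset.sum_congr rfl fun k hk => ?_
      rw [Finset.mem_range] at hk
      rw [v₄ _ (by omega) _ (N.tgt_mem_verts e)]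
      congr 1
      · rw [f₄ _ (by simp) (by simp), f₃ _ (by simp) (by simp), f₂ _ (by simp) (by simp),
          v₁ _ (by omega) _ (N.src_mem_verts e)]
      · rw [f₄ _ (by simp) (by simp), f₃ _ (by simp) (by simp), f₂ _ (by simp) (by simp),
          f₁ _ (by simp) (by simp), hW]
    · rw [v₆]
      simp only [Ex.eval_sum, Ex.eval_mul, Ex.eval_log, Ex.eval_reg]
      refine Finset.sum_congr rfl fun j hj => ?_
      have hj' := (Finset.mem_filter.mp hj).1
      have h0 : ∀ y, blk y = 0 → σ₅ y = input D y := by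
        intro y hy
        rw [f₅ y (by rintro j - rfl; simp at hy) (by omega), f₄ y (by omega) (by omega),
          f₃ y (by omega) (by omega), f₂ y (by omega) (by omega), f₁ y (by omega) (by omega),
          hin y hy]
      rw [h0 _ (by simp), h0 _ (by simp), f₅ _ (by simp) (by simp), f₄ _ (by simp) (by simp),
        f₃ _ (by simp) (by simp), v₂ j hj', Ex.eval_sum]
      congr 3
      refine Finset.sum_congr rfl fun l hl => ?_
      exact v₁ l (by rw [Finset.mem_range] at hl; omega) j hj'

/-- The oracle of the stochastic case. -/
def logitProg : Prog v n :=
  .seq (vec 60 fun e => Ex.exp ((.num 0 - ar 40 e) / .reg .gamma))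
  (.seq (each N.origins.toList N.logitOriginProg)
  (.seq (asg (cell 50 0 0) (.sum N.origins fun i => .reg (cell 66 i 0)))
  (vec 51 fun e => .sum N.origins fun i => .reg (cell 65 i e))))

theorem isOracleProg_logit (hN : N.AllWalks) (hg : 0 < D.gamma) :
    IsOracleProg N D (fun t e => -edgeFlow N (logitFlow N D t) e) N.logitProg
      (120 * (N.S * N.maxLen * n)) := by
  intro σ hin t _ ht
  have hS := N.S_pos
  have hK := N.maxLen_pos
  have hn := N.card_edges_pos
  have hcard : N.origins.toList.length = N.S := Finset.length_toList _
  refine Runs.weaken (c := _ + (_ + (_ + _))) ?_ ((runs_vec (b := 60) _ σ (by norm_num)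
    (by simp [ar])).seq fun σ₁ h₁ =>
    (runs_each (fun σ' => ∀ y, blk y ≤ 60 → σ' y = σ₁ y)
      (fun (i : Fin v) σ' => (∀ e : Fin n, σ' (cell 65 i e) = ∑ k ∈ Finset.range N.maxLen,
        N.fwd (expWeight D t) i k (N.src e) * (expWeight D t e *
          N.bwd (expWeight D t) (terminal N D t i) (N.maxLen - 1 - k) (N.tgt e))) ∧
        σ' (cell 66 i 0) = ∑ j ∈ N.verts with (i, j) ∈ N.od, D.gamma * (D.dem (i, j) *
          Real.log (∑ l ∈ Finset.range (N.maxLen + 1), N.fwd (expWeight D t) i l j)))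
      N.logitOriginProg (100 * (N.maxLen * n)) N.origins.toList N.origins.nodup_toList (by
        intro i _ σ' hσ'
        refine (N.runs_logitOrigin (D := D) t i σ' (fun y hy => ?_) fun e => ?_).mono le_rfl ?_
        · rw [hσ' y (by omega), h₁.2 y (by omega) (by omega), hin y hy]
        · rw [hσ' _ (by simp), h₁.1]
          simp [ar, ht, hin .gamma rfl, expWeight, input]
        · rintro σ'' ⟨k₁, k₂, k₃, k₄⟩
          refine ⟨fun y hy => (k₁ y hy).trans (hσ' y hy), ⟨k₃, k₄⟩, fun j hj hq => ⟨fun e => ?_, ?_⟩⟩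
          · rw [k₂ _ (by simp) _ (by simp), hq.1]
            intro e'; rw [ne_eq, cell_inj, Fin.val_inj]; tauto
          · rw [k₂ _ (by simp) (by simp), hq.2]
            rw [ne_eq, cell_inj, Fin.val_inj]; tauto) (σ := σ₁) fun _ _ => rfl).seq fun σ₂ h₂ =>
    (runs_asg_blk (b := 50) _ _ σ₂ (by simp) (by simp)).seq fun σ₃ h₃ =>
    (runs_vec (b := 51) _ σ₃ (by norm_num) (by simp)).mono le_rfl ?_)
  · have e₁ : n ≤ N.S * N.maxLen * n := Nat.le_mul_of_pos_left _ (Nat.mul_pos hS hK)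
    have e₂ : N.S * n ≤ N.S * N.maxLen * n :=
      Nat.mul_le_mul_right _ (Nat.le_mul_of_pos_right _ hK)
    have e₃ : N.S ≤ N.S * n := Nat.le_mul_of_pos_right _ hn
    have e₄ : N.origins.card = N.S := rfl
    rw [hcard]
    simp only [Ex.size_sum, Ex.size_div, Ex.size_sub, Ex.size_exp, ar, Ex.size_reg, Ex.size_num,
      Finset.sum_const, smul_eq_mul, Finset.card_univ, Fintype.card_fin, e₄]
    nlinarith
  · rintro σ₄ ⟨v₄, f₄⟩
    obtain ⟨v₁, f₁⟩ := h₁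
    obtain ⟨f₂, v₂⟩ := h₂
    obtain ⟨v₃, f₃⟩ := h₃
    refine ⟨fun y hy => ?_, ?_, fun e => ?_⟩
    · rw [f₄ y (by omega) (by omega), f₃ y (by omega) (by omega), f₂ y (by omega),
        f₁ y (by omega) (by omega)]
    · rw [f₄ _ (by simp) (by simp), v₃, potential_eq_sum hN hg, Ex.eval_sum]
      refine Finset.sum_congr rfl fun i hi => ?_
      exact (v₂ i (Finset.mem_toList.mpr hi)).2
    · rw [v₄, neg_neg, edgeFlow_logit_eq hN, Ex.eval_sum]
      refine Finset.sum_congr rfl fun i hi => ?_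
      rw [Ex.eval_reg, f₃ _ (by simp) (by simp)]
      exact (v₂ i (Finset.mem_toList.mpr hi)).1 e

end Network

end Traffic

namespace Traffic

variable {v n : ℕ} {N : Network v n} {M : Model} {D : Data v n} {G : (Fin n → ℝ) → Fin n → ℝ}

/-! ### Shortest paths -/

/-- Insertion into a list sorted by `key`. -/
def ins {α : Type*} (key : α → ℝ) (a : α) (l : List α) : List α :=
  l.filter (fun b => key b ≤ key a) ++ a :: l.filter fun b => key a < key b

section ins

variable {α : Type*} {key : α → ℝ} {a b : α} {l s q : List α}

theorem mem_ins : b ∈ ins key a l ↔ b = a ∨ b ∈ l := by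
  simp only [ins, List.mem_append, List.mem_filter, List.mem_cons, decide_eq_true_eq]
  have := le_or_gt (key b) (key a)
  tauto

theorem length_ins : (ins key a l).length = l.length + 1 := by
  have h := List.length_eq_length_filter_add (l := l) fun b => decide (key b ≤ key a)
  have h' : (fun b => decide (key a < key b)) = fun b => !decide (key b ≤ key a) := by
    funext b; rw [Bool.eq_iff_iff]; simp
  rw [ins, List.length_append, List.length_cons, h, h', ← add_assoc]

theorem pairwise_ins (h : l.Pairwise fun a b => key a ≤ key b) :
    (ins key a l).Pairwise fun a b => key a ≤ key b := by
  rw [ins, List.pairwise_append, List.pairwise_cons]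
  refine ⟨h.filter _, ⟨fun b hb => ?_, h.filter _⟩, fun b hb c hc => ?_⟩
  · exact (of_decide_eq_true (List.mem_filter.mp hb).2).le
  · have hb' := of_decide_eq_true (List.mem_filter.mp hb).2
    rcases List.mem_cons.mp hc with rfl | hc
    · exact hb'
    · exact hb'.trans (of_decide_eq_true (List.mem_filter.mp hc).2).le

theorem mem_foldr_ins : b ∈ s.foldr (ins key) q ↔ b ∈ s ∨ b ∈ q := by
  induction s with
  | nil => simp
  | cons a s ih => rw [List.foldr_cons, mem_ins, ih, List.mem_cons, or_assoc]

theorem length_foldr_ins : (s.foldr (ins key) q).length = s.length + q.length := by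
  induction s with
  | nil => simp
  | cons a s ih => rw [List.foldr_cons, length_ins, ih, List.length_cons]; omega

theorem pairwise_foldr_ins (h : q.Pairwise fun a b => key a ≤ key b) :
    (s.foldr (ins key) q).Pairwise fun a b => key a ≤ key b := by
  induction s with
  | nil => exact h
  | cons a s ih => exact pairwise_ins ih

end ins

theorem IsWalk.concat {src tgt : Fin n → Fin v} {x y : Fin v} {p : List (Fin n)}
    (h : IsWalk src tgt x y p) {e : Fin n} (he : src e = y) :
    IsWalk src tgt x (tgt e) (p ++ [e]) := by
  induction p generalizing x with
  | nil => exact ⟨he.trans (Eq.symm h), rfl⟩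
  | cons a p ih => exact ⟨h.1, ih h.2⟩

namespace Network

variable (N) (t : Fin n → ℝ) (i : Fin v)

/-- The distances in a tree, given by the list of its edges, latest first. -/
def dist : List (Fin n) → Fin v → ℝ
  | [], _ => 0
  | e :: T, x => if x = N.tgt e then dist T (N.src e) + t e else dist T x

/-- The length of a path that ends with the given edge. -/
def key (T : List (Fin n)) (e : Fin n) : ℝ := N.dist t T (N.src e) + t e

/-- The path in a tree to a vertex. -/
def path : List (Fin n) → Fin v → List (Fin n)
  | [], _ => []
  | e :: T, x => if x = N.tgt e then path T (N.src e) ++ [e] else path T x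

/-- The vertices of a tree. -/
def reached (T : List (Fin n)) : List (Fin v) := i :: T.map N.tgt

/-- A tree with the root `i`. -/
def IsTree : List (Fin n) → Prop
  | [] => True
  | e :: T => N.src e ∈ N.reached i T ∧ N.tgt e ∉ N.reached i T ∧ IsTree T

/-- The edges that leave a vertex. -/
def outs (x : Fin v) : List (Fin n) := (Finset.univ.filter fun e => N.src e = x).toList

theorem mem_outs {x : Fin v} {e : Fin n} : e ∈ N.outs x ↔ N.src e = x := by simp [outs]

/-- Dijkstra's algorithm, started with a tree and a queue of edges sorted by their keys. -/
def dijkstra : ℕ → List (Fin n) → List (Fin n) → List (Fin n)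
  | 0, T, _ => T
  | _ + 1, T, [] => T
  | f + 1, T, e :: q => if N.tgt e ∈ N.reached i T then dijkstra f T q
      else dijkstra f (e :: T) ((N.outs (N.tgt e)).foldr (ins (N.key t (e :: T))) q)

/-- The tree of shortest paths from `i`. -/
def tree : List (Fin n) := N.dijkstra t i n [] ((N.outs i).foldr (ins (N.key t [])) [])

/-- The invariant of Dijkstra's algorithm. -/
structure QueueInv (T q : List (Fin n)) : Prop where
  tree : N.IsTree i T
  sorted : q.Pairwise fun a b => N.key t T a ≤ N.key t T b
  src_mem : ∀ e ∈ q, N.src e ∈ N.reached i T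
  dist_le : ∀ x ∈ N.reached i T, ∀ e ∈ q, N.dist t T x ≤ N.key t T e
  relaxed : ∀ e, N.src e ∈ N.reached i T →
    e ∈ q ∨ N.tgt e ∈ N.reached i T ∧ N.dist t T (N.tgt e) ≤ N.key t T e

variable {N t i} {T q : List (Fin n)} {e : Fin n} {x : Fin v}

theorem mem_reached_cons : x ∈ N.reached i (e :: T) ↔ x = N.tgt e ∨ x ∈ N.reached i T := by
  simp only [reached, List.map_cons, List.mem_cons]; tauto

theorem root_mem_reached : i ∈ N.reached i T := by simp [reached]

theorem dist_cons_of_mem (he : N.tgt e ∉ N.reached i T) (hx : x ∈ N.reached i T) :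
    N.dist t (e :: T) x = N.dist t T x := by
  rw [dist, if_neg]; rintro rfl; exact he hx

theorem dist_cons_self : N.dist t (e :: T) (N.tgt e) = N.key t T e := by
  rw [dist, if_pos rfl, key]

theorem key_cons_of_mem (he : N.tgt e ∉ N.reached i T) {a : Fin n}
    (ha : N.src a ∈ N.reached i T) : N.key t (e :: T) a = N.key t T a := by
  rw [key, dist_cons_of_mem he ha, key]

theorem key_cons_of_src {a : Fin n} (ha : N.src a = N.tgt e) :
    N.key t (e :: T) a = N.key t T e + t a := by
  rw [key, ha, dist_cons_self]

theorem IsTree.dist_root (h : N.IsTree i T) : N.dist t T i = 0 := by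
  induction T with
  | nil => rfl
  | cons e T ih => rw [dist_cons_of_mem h.2.1 root_mem_reached, ih h.2.2]

theorem QueueInv.start (ht : ∀ e, 0 ≤ t e) :
    N.QueueInv t i [] ((N.outs i).foldr (ins (N.key t [])) []) where
  tree := trivial
  sorted := pairwise_foldr_ins List.Pairwise.nil
  src_mem e he := by
    rcases mem_foldr_ins.mp he with h | h
    · simp [reached, N.mem_outs.mp h]
    · simp at h
  dist_le x _ e _ := by simpa [key, dist] using ht e
  relaxed e he := Or.inl (mem_foldr_ins.mpr (Or.inl (N.mem_outs.mpr (by simpa [reached] using he))))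

theorem QueueInv.discard (h : N.QueueInv t i T (e :: q)) (he : N.tgt e ∈ N.reached i T) :
    N.QueueInv t i T q where
  tree := h.tree
  sorted := (List.pairwise_cons.mp h.sorted).2
  src_mem a ha := h.src_mem a (by simp [ha])
  dist_le x hx a ha := h.dist_le x hx a (by simp [ha])
  relaxed a ha := by
    rcases h.relaxed a ha with h' | h'
    · rcases List.mem_cons.mp h' with rfl | h'
      · exact Or.inr ⟨he, h.dist_le _ he _ (by simp)⟩
      · exact Or.inl h'
    · exact Or.inr h'

/-- The popped edge has the smallest key. Costs are nonnegative, so the keys of the new edges are no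
smaller, and they dominate all distances already fixed. Old distances and keys are unchanged, since
the new vertex was not in the tree. -/
theorem QueueInv.visit (ht : ∀ e, 0 ≤ t e) (h : N.QueueInv t i T (e :: q))
    (he : N.tgt e ∉ N.reached i T) :
    N.QueueInv t i (e :: T) ((N.outs (N.tgt e)).foldr (ins (N.key t (e :: T))) q) where
  tree := ⟨h.src_mem e (by simp), he, h.tree⟩
  sorted := by
    refine pairwise_foldr_ins ((List.pairwise_cons.mp h.sorted).2.imp_of_mem fun {a b} ha hb hab => ?_)
    rwa [key_cons_of_mem he (h.src_mem a (by simp [ha])),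
      key_cons_of_mem he (h.src_mem b (by simp [hb]))]
  src_mem a ha := by
    rw [mem_reached_cons]
    rcases mem_foldr_ins.mp ha with h' | h'
    · exact Or.inl (N.mem_outs.mp h')
    · exact Or.inr (h.src_mem a (by simp [h']))
  dist_le x hx a ha := by
    have hxe : N.dist t (e :: T) x ≤ N.key t T e := by
      rcases mem_reached_cons.mp hx with rfl | hx
      · rw [dist_cons_self]
      · rw [dist_cons_of_mem he hx]; exact h.dist_le x hx e (by simp)
    rcases mem_foldr_ins.mp ha with h' | h'
    · rw [key_cons_of_src (N.mem_outs.mp h')]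
      linarith [ht a]
    · rw [key_cons_of_mem he (h.src_mem a (by simp [h']))]
      exact hxe.trans ((List.pairwise_cons.mp h.sorted).1 a h')
  relaxed a ha := by
    rcases mem_reached_cons.mp ha with ha' | ha'
    · exact Or.inl (mem_foldr_ins.mpr (Or.inl (N.mem_outs.mpr ha')))
    · rcases h.relaxed a ha' with h' | ⟨h₁, h₂⟩
      · rcases List.mem_cons.mp h' with rfl | h'
        · refine Or.inr ⟨mem_reached_cons.mpr (Or.inl rfl), ?_⟩
          rw [dist_cons_self, key_cons_of_mem he ha']
        · exact Or.inl (mem_foldr_ins.mpr (Or.inr h'))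
      · refine Or.inr ⟨mem_reached_cons.mpr (Or.inr h₁), ?_⟩
        rwa [dist_cons_of_mem he h₁, key_cons_of_mem he ha']

variable (N i) in
/-- The number of the edges that leave a vertex outside a tree. -/
def unseen (T : List (Fin n)) : ℕ := (Finset.univ.filter fun e => N.src e ∉ N.reached i T).card

theorem unseen_nil : (N.outs i).length + N.unseen i [] = n := by
  rw [outs, Finset.length_toList, unseen]
  have := Finset.card_filter_add_card_filter_not (s := (Finset.univ : Finset (Fin n)))
    fun e => N.src e = i
  simpa [reached] using this

/-- Every edge enters the queue exactly when its source enters the tree. So queue length plus unseen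
edges does not grow, and it bounds both the number of steps and the total number of insertions. -/
theorem unseen_cons (he : N.tgt e ∉ N.reached i T) :
    (N.outs (N.tgt e)).length + N.unseen i (e :: T) = N.unseen i T := by
  rw [outs, Finset.length_toList, unseen, unseen,
    ← Finset.card_filter_add_card_filter_not (s := Finset.univ.filter fun a => N.src a ∉ N.reached i T)
      fun a => N.src a = N.tgt e, Finset.filter_filter, Finset.filter_filter]
  congr 2
  · ext a
    simp only [Finset.mem_filter, Finset.mem_univ, true_and]
    exact ⟨fun h => ⟨h ▸ he, h⟩, fun h => h.2⟩
  · ext a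
    simp only [Finset.mem_filter, Finset.mem_univ, true_and, mem_reached_cons]
    tauto

theorem QueueInv.dijkstra (ht : ∀ e, 0 ≤ t e) : ∀ (f : ℕ) (T q : List (Fin n)),
    q.length + N.unseen i T ≤ f → N.QueueInv t i T q → N.QueueInv t i (N.dijkstra t i f T q) []
  | 0, T, q, hf, h => by
    obtain rfl : q = [] := List.length_eq_zero_iff.mp (by omega)
    exact h
  | f + 1, T, [], _, h => h
  | f + 1, T, e :: q, hf, h => by
    rw [List.length_cons] at hf
    rw [Network.dijkstra]
    split_ifs with he
    · exact QueueInv.dijkstra ht f T q (by omega) (h.discard he)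
    · refine QueueInv.dijkstra ht f _ _ ?_ (h.visit ht he)
      rw [length_foldr_ins]
      have := unseen_cons he
      omega

theorem QueueInv.tree_inv (ht : ∀ e, 0 ≤ t e) : N.QueueInv t i (N.tree t i) [] := by
  refine QueueInv.dijkstra ht n _ _ ?_ (QueueInv.start ht)
  rw [length_foldr_ins]
  have := unseen_nil (N := N) (i := i)
  simp only [List.length_nil]
  omega

/-- With an empty queue all edges leaving the tree vertices are relaxed; the inequalities telescope
along any walk, and the walk never leaves the tree. -/
theorem QueueInv.walk (h : N.QueueInv t i T []) {j : Fin v} {p : List (Fin n)}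
    (hp : IsWalk N.src N.tgt x j p) (hx : x ∈ N.reached i T) :
    j ∈ N.reached i T ∧ N.dist t T j ≤ N.dist t T x + (p.map t).sum := by
  induction p generalizing x with
  | nil => rw [← (show x = j from hp)]; simpa using hx
  | cons e p ih =>
    obtain ⟨rfl, hp⟩ := hp
    rcases h.relaxed e hx with h' | ⟨h₁, h₂⟩
    · simp at h'
    · obtain ⟨h₃, h₄⟩ := ih hp h₁
      refine ⟨h₃, ?_⟩
      rw [List.map_cons, List.sum_cons]
      rw [key] at h₂
      linarith

theorem path_of_notMem (hx : x ∉ N.reached i T) : N.path T x = [] := by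
  induction T with
  | nil => rfl
  | cons e T ih =>
    rw [mem_reached_cons, not_or] at hx
    rw [path, if_neg hx.1, ih hx.2]

/-- A new edge always ends at a vertex outside the tree, hence paths have no repeated vertices. This
is what `AllSimplePaths` requires of them. -/
theorem IsTree.path_spec (h : N.IsTree i T) : ∀ {x : Fin v}, x ∈ N.reached i T →
    IsWalk N.src N.tgt i x (N.path T x) ∧ (i :: (N.path T x).map N.tgt).Nodup ∧
    (∀ y ∈ (N.path T x).map N.tgt, y ∈ N.reached i T) ∧
    ((N.path T x).map t).sum = N.dist t T x := by
  induction T with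
  | nil =>
    intro x hx
    have : i = x := by simpa [reached, eq_comm] using hx
    simp [path, dist, IsWalk, this]
  | cons e T ih =>
    intro x hx
    by_cases hxe : x = N.tgt e
    · subst hxe
      obtain ⟨h₁, h₂, h₃, h₄⟩ := ih h.2.2 h.1
      rw [path, if_pos rfl, dist_cons_self]
      refine ⟨h₁.concat rfl, ?_, ?_, ?_⟩
      · rw [List.map_append, ← List.cons_append, List.nodup_append]
        refine ⟨h₂, by simp, fun a ha b hb hab => h.2.1 ?_⟩
        obtain rfl : b = N.tgt e := by simpa using hb
        subst hab
        rcases List.mem_cons.mp ha with ha | ha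
        · rw [ha]; exact root_mem_reached
        · exact h₃ _ ha
      · intro y hy
        rw [mem_reached_cons]
        simp only [List.map_append, List.mem_append, List.map_cons, List.map_nil,
          List.mem_singleton] at hy
        exact hy.symm.imp_right fun h => h₃ y h
      · rw [List.map_append, List.sum_append, h₄]; simp [key]
    · obtain ⟨h₁, h₂, h₃, h₄⟩ := ih h.2.2 ((mem_reached_cons.mp hx).resolve_left hxe)
      rw [path, if_neg hxe, dist, if_neg hxe]
      exact ⟨h₁, h₂, fun y hy => mem_reached_cons.mpr (Or.inr (h₃ y hy)), h₄⟩

variable (N t) in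
/-- The shortest route. -/
def shortest (w : Fin v × Fin v) : List (Fin n) := N.path (N.tree t w.1) w.2

/-- The tree path is simple and therefore a route. Any route is a walk, so it is no cheaper than the
distance in the tree. -/
theorem shortest_spec (hN : N.AllSimplePaths) (ht : ∀ e, 0 ≤ t e) {w : Fin v × Fin v}
    (hw : w ∈ N.od) : N.shortest t w ∈ N.routes w ∧
      ∀ p ∈ N.routes w, routeCost t (N.shortest t w) ≤ routeCost t p := by
  have hI := QueueInv.tree_inv (N := N) (i := w.1) ht
  obtain ⟨p₀, hp₀, h₀, -⟩ := N.exists_walk hw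
  have hr := (hI.walk h₀ root_mem_reached).1
  obtain ⟨h₁, h₂, -, h₄⟩ := hI.tree.path_spec (t := t) hr
  refine ⟨hN w hw _ h₁ h₂, fun p hp => ?_⟩
  rw [routeCost_eq_sum, routeCost_eq_sum, shortest, h₄]
  have := (hI.walk (N.routes_walk w hw p hp) root_mem_reached).2
  rwa [hI.tree.dist_root, zero_add] at this

end Network

/-- The subgradient that assigns the demands to the shortest routes. -/
def shortestGrad (N : Network v n) (D : Data v n) (t : Fin n → ℝ) (e : Fin n) : ℝ :=
  -∑ w ∈ N.od, D.dem w * theta e (N.shortest t w)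

theorem potential_eq_shortestGrad (hN : N.AllSimplePaths) (hg : D.gamma = 0)
    {t : Fin n → ℝ} (ht : ∀ e, 0 ≤ t e) :
    potential N D t = ∑ e, shortestGrad N D t e * t e := by
  have hc : ∀ w ∈ N.od, minCost N t w = routeCost t (N.shortest t w) := by
    intro w hw
    obtain ⟨h₁, h₂⟩ := N.shortest_spec hN ht hw
    obtain ⟨p, hp, hpe⟩ := exists_minCost N t hw
    exact le_antisymm (minCost_le N t h₁) (by rw [← hpe]; exact h₂ p hp)
  rw [potential_of_zero N hg]
  simp_rw [shortestGrad, neg_mul, Finset.sum_neg_distrib, Finset.sum_mul]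
  rw [Finset.sum_comm]
  congr 1
  refine Finset.sum_congr rfl fun w hw => ?_
  rw [hc w hw, routeCost, Finset.mul_sum]
  exact Finset.sum_congr rfl fun e _ => by ring

theorem isOracle_shortestGrad (hN : N.AllSimplePaths) (hg : D.gamma = 0)
    (hd : ∀ w ∈ N.od, 0 < D.dem w) (htb : ∀ e, 0 < D.tbar e) :
    IsOracle N D (shortestGrad N D) := by
  intro t ht s
  have ht0 : ∀ e, 0 ≤ t e := fun e => (htb e).le.trans (ht e)
  have hc : ∀ w ∈ N.od, N.shortest t w ∈ N.routes w := fun w hw => (N.shortest_spec hN ht0 hw).1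
  have h := neg_edgeFlow_le_potential_of_zero N hg (choiceFlow_mem N hd hc) s
  simp_rw [edgeFlow_choiceFlow N hc] at h
  rw [potential_eq_shortestGrad hN hg ht0, ← Finset.sum_add_distrib]
  refine le_trans (le_of_eq ?_) h
  rw [← Finset.sum_neg_distrib]
  exact Finset.sum_congr rfl fun e _ => by rw [shortestGrad]; ring

end Traffic

namespace Traffic

variable {v n : ℕ} {N : Network v n} {M : Model} {D : Data v n} {G : (Fin n → ℝ) → Fin n → ℝ}

/-! ### The program of the oracle in the non-stochastic case -/

/-- Binary insertion of `a` into the list `pre ++ mid ++ post`, sorted by the keys in block `68`,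
at a place within `mid`. -/
def binsProg (a : Fin n) (k : List (Fin n) → Prog v n) :
    ℕ → List (Fin n) → List (Fin n) → List (Fin n) → Prog v n
  | 0, pre, _, post => k (pre ++ a :: post)
  | d + 1, pre, mid, post =>
    match mid.drop (mid.length / 2) with
    | [] => k (pre ++ a :: post)
    | x :: r => .ite (cell 68 0 a) (cell 68 0 x)
        (binsProg a k d pre (mid.take (mid.length / 2)) (x :: (r ++ post)))
        (binsProg a k d (pre ++ mid.take (mid.length / 2) ++ [x]) r post)

theorem ins_append {α : Type*} {key : α → ℝ} {a : α} {pre post : List α}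
    (h₁ : ∀ b ∈ pre, key b ≤ key a) (h₂ : ∀ b ∈ post, key a < key b) :
    ins key a (pre ++ post) = pre ++ a :: post := by
  have e₁ : pre.filter (fun b => key b ≤ key a) = pre :=
    List.filter_eq_self.mpr (by simpa using h₁)
  have e₂ : post.filter (fun b => key b ≤ key a) = [] :=
    List.filter_eq_nil_iff.mpr (by simpa using h₂)
  have e₃ : pre.filter (fun b => key a < key b) = [] :=
    List.filter_eq_nil_iff.mpr (by simpa using h₁)
  have e₄ : post.filter (fun b => key a < key b) = post :=
    List.filter_eq_self.mpr (by simpa using h₂)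
  rw [ins, List.filter_append, List.filter_append, e₁, e₂, e₃, e₄]
  simp

/-- Invariant of bisection: keys in the left part are at most the key of a, keys in the right part
exceed it. The length of the middle part drops below the next lower power of 2 with each comparison,
so d comparisons suffice. -/
theorem runs_bins {key : Fin n → ℝ} {a : Fin n} {k : List (Fin n) → Prog v n}
    {σ : Reg v n → ℝ} {c : ℕ} {Q : (Reg v n → ℝ) → Prop} (ha : σ (cell 68 0 a) = key a) :
    ∀ (d : ℕ) (pre mid post : List (Fin n)), mid.length < 2 ^ d →
      (∀ b ∈ mid, σ (cell 68 0 b) = key b) → mid.Pairwise (fun b c => key b ≤ key c) →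
      (∀ b ∈ pre, key b ≤ key a) → (∀ b ∈ post, key a < key b) →
      Runs (k (ins key a (pre ++ mid ++ post))) σ c Q →
      Runs (binsProg a k d pre mid post) σ (c + d) Q
  | 0, pre, mid, post, hl, _, _, h₁, h₂, h => by
    obtain rfl : mid = [] := List.length_eq_zero_iff.mp (by simpa using hl)
    rw [List.append_nil, ins_append h₁ h₂] at h
    exact h
  | d + 1, pre, mid, post, hl, hm, hs, h₁, h₂, h => by
    rw [binsProg]
    have hmid := List.take_append_drop (mid.length / 2) mid
    have hlen : (mid.drop (mid.length / 2)).length = mid.length - mid.length / 2 :=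
      List.length_drop
    split
    · rename_i hd
      rw [hd, List.length_nil] at hlen
      obtain rfl : mid = [] := List.length_eq_zero_iff.mp (by omega)
      rw [List.append_nil, ins_append h₁ h₂] at h
      exact h.weaken (by omega)
    · rename_i x r hd
      rw [hd] at hmid hlen
      rw [List.length_cons] at hlen
      rw [pow_succ] at hl
      have hx : x ∈ mid := by rw [← hmid]; simp
      have htl : (mid.take (mid.length / 2)).length < 2 ^ d := by rw [List.length_take]; omega
      have hs' := hs
      rw [← hmid, List.pairwise_append, List.pairwise_cons] at hs'
      have hin₁ : ∀ b ∈ mid.take (mid.length / 2), b ∈ mid := fun b hb => List.mem_of_mem_take hb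
      have hin₂ : ∀ b ∈ r, b ∈ mid := fun b hb => by rw [← hmid]; simp [hb]
      rw [← add_assoc]
      refine Runs.ite (fun hlt => ?_) fun hlt => ?_
      · rw [ha, hm x hx] at hlt
        refine runs_bins ha d _ _ _ htl (fun b hb => hm b (hin₁ b hb)) hs'.1 h₁ ?_ ?_
        · intro b hb
          rcases List.mem_cons.mp hb with rfl | hb
          · exact hlt
          · rcases List.mem_append.mp hb with hb | hb
            · exact hlt.trans_le (hs'.2.1.1 b hb)
            · exact h₂ b hb
        · rw [← hmid] at h
          simpa only [List.append_assoc, List.cons_append] using h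
      · rw [ha, hm x hx, not_lt] at hlt
        refine runs_bins ha d _ _ _ (by omega) (fun b hb => hm b (hin₂ b hb)) hs'.2.1.2 ?_ h₂ ?_
        · intro b hb
          rcases List.mem_append.mp hb with hb | hb
          · rcases List.mem_append.mp hb with hb | hb
            · exact h₁ b hb
            · exact (hs'.2.2 b hb x (by simp)).trans hlt
          · obtain rfl : b = x := by simpa using hb
            exact hlt
        · rw [← hmid] at h
          simpa only [List.append_assoc, List.cons_append, List.nil_append] using h

/-- Insertion of a list of edges. -/
def insProg (d : ℕ) : List (Fin n) → List (Fin n) → (List (Fin n) → Prog v n) → Prog v n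
  | [], q, k => k q
  | a :: l, q, k => insProg d l q fun q' => binsProg a k d [] q' []

/-- The queue is a compile-time list handed to a continuation; it is never stored in memory. The
recursion mirrors `foldr`, which inserts the last element first. -/
theorem runs_insProg {key : Fin n → ℝ} {d : ℕ} {σ : Reg v n → ℝ} {q : List (Fin n)}
    {Q : (Reg v n → ℝ) → Prop} (hq : q.Pairwise fun b c => key b ≤ key c) :
    ∀ (l : List (Fin n)) (k : List (Fin n) → Prog v n) (c : ℕ),
      (∀ b, b ∈ l ∨ b ∈ q → σ (cell 68 0 b) = key b) → l.length + q.length ≤ 2 ^ d →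
      Runs (k (l.foldr (ins key) q)) σ c Q → Runs (insProg d l q k) σ (c + l.length * d) Q
  | [], k, c, _, _, h => h.weaken (by simp)
  | a :: l, k, c, hk, hl, h => by
    rw [List.length_cons] at hl
    refine Runs.weaken (c := c + d + l.length * d) (by rw [List.length_cons, Nat.succ_mul]; omega) ?_
    refine runs_insProg hq l _ _ (fun b hb => hk b (hb.imp_left fun h => by simp [h])) (by omega) ?_
    refine runs_bins (key := key) (hk a (Or.inl (by simp))) d _ _ _ ?_ ?_ ?_ (by simp) (by simp) ?_
    · rw [length_foldr_ins]; omega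
    · intro b hb
      exact hk b ((mem_foldr_ins.mp hb).imp_left fun h => by simp [h])
    · exact pairwise_foldr_ins hq
    · simpa using h

namespace Network

variable (N)

/-- Dijkstra's algorithm with the keys in block `68`, followed by the program `k` for the tree. -/
def dijkstraProg (d : ℕ) (i : Fin v) (k : List (Fin n) → Prog v n) :
    ℕ → List (Fin n) → List (Fin n) → Prog v n
  | 0, T, _ => k T
  | _ + 1, T, [] => k T
  | f + 1, T, e :: q => if N.tgt e ∈ N.reached i T then dijkstraProg d i k f T q else
      .seq (arr (Finset.univ.filter fun a => N.src a = N.tgt e) (fun a : Fin n => cell 68 0 a)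
        fun a => ar 68 e + ar 40 a)
      (insProg d (N.outs (N.tgt e)) q fun q' => dijkstraProg d i k f (e :: T) q')

theorem injOn_cell (b : ℕ) (s : Set (Fin n)) :
    Set.InjOn (fun a : Fin n => (cell b 0 a : Reg v n)) s := by
  intro a _ a' _ h
  simpa [Fin.ext_iff] using h

theorem card_outs (x : Fin v) :
    (Finset.univ.filter fun a => N.src a = x).card = (N.outs x).length :=
  (Finset.length_toList _).symm

variable {N}

/-- Tree membership and access to the queue are resolved when the program is built. What is executed
is 3 operations for the key of each newly seen edge and at most d comparisons for its insertion,
which are charged to the unseen edges. -/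
theorem runs_dijkstra {d : ℕ} {i : Fin v} {t : Fin n → ℝ} (ht : ∀ e, 0 ≤ t e)
    {k : List (Fin n) → Prog v n} {c : ℕ} {Q : (Reg v n → ℝ) → Prop} :
    ∀ (f : ℕ) (T q : List (Fin n)) (σ : Reg v n → ℝ), q.length + N.unseen i T ≤ f → f ≤ 2 ^ d →
      N.QueueInv t i T q → (∀ a, N.src a ∈ N.reached i T → σ (cell 68 0 a) = N.key t T a) →
      (∀ e : Fin n, σ (cell 40 0 e) = t e) →
      (∀ σ' : Reg v n → ℝ, (∀ y, blk y ≠ 68 → blk y ≠ 99 → σ' y = σ y) →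
        Runs (k (N.dijkstra t i f T q)) σ' c Q) →
      Runs (N.dijkstraProg d i k f T q) σ (c + (d + 3) * N.unseen i T) Q
  | 0, T, q, σ, _, _, _, _, _, h => (h σ fun _ _ _ => rfl).weaken (by omega)
  | f + 1, T, [], σ, _, _, _, _, _, h => (h σ fun _ _ _ => rfl).weaken (by omega)
  | f + 1, T, e :: q, σ, hf, hd, hI, hk, h40, h => by
    rw [List.length_cons] at hf
    rw [dijkstraProg]
    rw [Network.dijkstra] at h
    split_ifs with he
    · simp only [if_pos he] at h
      exact runs_dijkstra ht f T q σ (by omega) (by omega) (hI.discard he) hk h40 h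
    · simp only [if_neg he] at h
      have hu := unseen_cons he
      have hse := hI.src_mem e (by simp)
      -- The source of e is in the tree and its target is not, so e is not among the edges whose
      -- keys are being written and its own key can be read throughout.
      have hne : N.src e ≠ N.tgt e := fun h => he (h ▸ hse)
      refine Runs.weaken (c := (N.outs (N.tgt e)).length * 3 +
          ((c + (d + 3) * N.unseen i (e :: T)) + (N.outs (N.tgt e)).length * d))
        (by rw [← hu, mul_add]; linarith) ?_
      have harr := runs_arr (Finset.univ.filter fun a => N.src a = N.tgt e)
        (fun a : Fin n => (cell 68 0 a : Reg v n)) (fun a => ar 68 e + ar 40 a) σ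
        (injOn_cell 68 _) (by
          simp only [Ex.all_add, ar, Ex.all_reg, blk_cell, Finset.mem_filter, Finset.mem_univ,
            true_and, ne_eq, cell_inj, Fin.val_inj]
          refine fun a _ => ⟨⟨fun b hb h => hne ?_, by norm_num⟩, fun b _ h => by omega, by norm_num⟩
          exact (congrArg N.src h).trans hb) (by simp)
      refine Runs.seq (Q := fun σ' =>
          (∀ a, N.src a ∈ N.reached i (e :: T) → σ' (cell 68 0 a) = N.key t (e :: T) a) ∧
          ∀ y, blk y ≠ 68 → blk y ≠ 99 → σ' y = σ y) (harr.mono ?_ ?_) ?_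
      · simp [ar, N.card_outs]
      · rintro σ₁ ⟨v₁, f₁⟩
        refine ⟨fun a ha => ?_, fun y hy hy' => f₁ y ?_ hy'⟩
        · by_cases hae : N.src a = N.tgt e
          · rw [v₁ a (by simp [hae]), key_cons_of_src hae]
            simp only [Ex.eval_add, ar, Ex.eval_reg]
            rw [h40, hk e hse]
          · have ha' := (mem_reached_cons.mp ha).resolve_left hae
            rw [f₁ _ ?_ (by simp), hk a ha', key_cons_of_mem he ha']
            intro b hb h
            rw [cell_inj, Fin.val_inj] at h
            exact hae (h.2.2 ▸ (Finset.mem_filter.mp hb).2)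
        · rintro b - rfl
          simp at hy
      · rintro σ₁ ⟨v₁, f₁⟩
        have hI' := hI.visit ht he
        refine runs_insProg (key := N.key t (e :: T)) ?_ _ _ _ ?_ (by omega) ?_
        · refine (List.pairwise_cons.mp hI.sorted).2.imp_of_mem fun {a b} ha hb hab => ?_
          rwa [key_cons_of_mem he (hI.src_mem a (by simp [ha])),
            key_cons_of_mem he (hI.src_mem b (by simp [hb]))]
        · intro a ha
          exact v₁ a (hI'.src_mem a (mem_foldr_ins.mpr ha))
        · refine runs_dijkstra ht f _ _ σ₁ ?_ (by omega) hI' v₁ ?_ ?_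
          · rw [length_foldr_ins]; omega
          · intro a; rw [f₁ _ (by simp) (by simp), h40]
          · exact fun σ' hσ' => h σ' fun y hy hy' => (hσ' y hy hy').trans (f₁ y hy hy')

theorem length_dijkstra_le {t : Fin n → ℝ} {i : Fin v} : ∀ (f : ℕ) (T q : List (Fin n)),
    (N.dijkstra t i f T q).length ≤ T.length + f
  | 0, T, q => le_rfl
  | f + 1, T, [] => by rw [dijkstra]; omega
  | f + 1, T, e :: q => by
    rw [dijkstra]
    split_ifs
    · exact (length_dijkstra_le f T q).trans (by omega)
    · exact (length_dijkstra_le f _ _).trans (by rw [List.length_cons]; omega)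

variable (N) in
/-- The flows in the tree, from the demands in block `67`, added to layer `i` of block `65`. -/
def flowProg (i : Fin v) : List (Fin n) → Prog v n
  | [] => .skip
  | e :: T => .seq (asg (cell 65 i e) (.reg (cell 65 i e) + .reg (cell 67 0 (N.tgt e))))
      (.seq (asg (cell 67 0 (N.src e)) (.reg (cell 67 0 (N.src e)) + .reg (cell 67 0 (N.tgt e))))
        (flowProg i T))

theorem theta_append (a : Fin n) (p q : List (Fin n)) : theta a (p ++ q) = theta a p + theta a q := by
  simp [theta]

/-- The latest edge e leads to a leaf. The mass at the leaf uses e and then continues from the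
source of e as if it had started there, so one addition per vertex accumulates the flows of all
destinations. -/
theorem sum_mul_theta_path {i : Fin v} {e : Fin n} {T : List (Fin n)}
    (he : N.tgt e ∉ N.reached i T) (m : Fin v → ℝ) (a : Fin n) :
    ∑ x ∈ N.verts, m x * theta a (N.path (e :: T) x)
      = (if a = e then m (N.tgt e) else 0) + ∑ x ∈ N.verts,
        (m x + if x = N.src e then m (N.tgt e) else 0) * theta a (N.path T x) := by
  have h₁ : ∀ x, m x * theta a (N.path (e :: T) x) = m x * theta a (N.path T x)
      + if x = N.tgt e then m x * (theta a (N.path T (N.src e)) + theta a [e]) else 0 := by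
    intro x
    rw [path]
    split_ifs with hx
    · rw [theta_append, hx, path_of_notMem he, theta, theta, theta]; simp
    · rw [add_zero]
  have h₂ : ∀ x, (m x + if x = N.src e then m (N.tgt e) else 0) * theta a (N.path T x)
      = m x * theta a (N.path T x)
        + if x = N.src e then m (N.tgt e) * theta a (N.path T x) else 0 := by
    intro x; split_ifs <;> ring
  have h₃ : theta a [e] = if a = e then 1 else 0 := by
    by_cases h : a = e <;> simp [theta, h, Ne.symm]
  simp_rw [h₁, h₂, Finset.sum_add_distrib, Finset.sum_ite_eq', N.src_mem_verts, N.tgt_mem_verts,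
    if_true, h₃]
  split_ifs <;> ring

theorem runs_flowProg {i : Fin v} : ∀ (T : List (Fin n)) (σ : Reg v n → ℝ), N.IsTree i T →
    Runs (N.flowProg i T) σ (6 * T.length) fun σ' =>
      (∀ y, blk y ≠ 67 → blk y ≠ 99 → (∀ e : Fin n, y ≠ cell 65 i e) → σ' y = σ y) ∧
      ∀ a : Fin n, σ' (cell 65 i a) = σ (cell 65 i a)
        + ∑ x ∈ N.verts, σ (cell 67 0 x) * theta a (N.path T x)
  | [], σ, _ => (Runs.skip ⟨fun _ _ _ _ => rfl, fun a => by simp [path, theta]⟩).weaken (by simp)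
  | e :: T, σ, h => by
    refine Runs.weaken (c := 3 + (3 + 6 * T.length)) (by rw [List.length_cons]; omega) ?_
    refine Runs.seq ((runs_asg _ _ σ (by simp)).weaken (by simp)) fun σ₁ h₁ =>
      Runs.seq ((runs_asg _ _ σ₁ (by simp)).weaken (by simp)) fun σ₂ h₂ =>
      (runs_flowProg T σ₂ h.2.2).mono le_rfl ?_
    rintro σ₃ ⟨f₃, v₃⟩
    obtain ⟨v₁, f₁⟩ := h₁
    obtain ⟨v₂, f₂⟩ := h₂
    refine ⟨fun y hy hy' hy'' => ?_, fun a => ?_⟩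
    · rw [f₃ y hy hy' hy'', f₂ y (by rintro rfl; simp at hy) hy', f₁ y (hy'' e) hy']
    · have g : ∀ x : Fin v, σ₂ (cell 67 0 x)
          = σ (cell 67 0 x) + if x = N.src e then σ (cell 67 0 (N.tgt e)) else 0 := by
        intro x
        split_ifs with hx
        · rw [hx, v₂, Ex.eval_add, Ex.eval_reg, Ex.eval_reg, f₁ _ (by simp) (by simp),
            f₁ _ (by simp) (by simp)]
        · rw [f₂ _ (by simpa [Fin.val_inj] using hx) (by simp), f₁ _ (by simp) (by simp), add_zero]
      rw [v₃, sum_mul_theta_path h.2.1, ← add_assoc, f₂ _ (by simp) (by simp)]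
      simp_rw [g]
      congr 1
      split_ifs with hae
      · rw [hae, v₁]; rfl
      · rw [f₁ _ (by simpa [Fin.val_inj] using hae) (by simp), add_zero]

variable (N)

/-- The flows from the origin `i` along the shortest routes, into layer `i` of block `65`. -/
def shortestOriginProg (i : Fin v) : Prog v n :=
  .seq (arr Finset.univ (fun e : Fin n => cell 65 i e) fun _ => .num 0)
  (.seq (arr N.verts (fun x => cell 67 0 x) fun x =>
    if (i, x) ∈ N.od then .reg (.dem (i, x)) else .num 0)
  (.seq (arr (Finset.univ.filter fun a => N.src a = i) (fun a : Fin n => cell 68 0 a) (ar 40))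
  (insProg (Nat.size n) (N.outs i) [] fun q =>
    N.dijkstraProg (Nat.size n) i (N.flowProg i) n [] q)))

theorem runs_shortestOrigin {t : Fin n → ℝ} (ht : ∀ e, 0 ≤ t e) (i : Fin v) (σ : Reg v n → ℝ)
    (hin : HasInput D σ) (h40 : ∀ e : Fin n, σ (cell 40 0 e) = t e) :
    Runs (N.shortestOriginProg i) σ ((Nat.size n + 13) * n) fun σ' =>
      (∀ y, blk y < 65 → σ' y = σ y) ∧
      (∀ y, blk y = 65 → (∀ e : Fin n, y ≠ cell 65 i e) → σ' y = σ y) ∧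
      ∀ a : Fin n, σ' (cell 65 i a)
        = ∑ x ∈ N.verts with (i, x) ∈ N.od, D.dem (i, x) * theta a (N.shortest t (i, x)) := by
  have hV := N.card_verts_le
  have hU := unseen_nil (N := N) (i := i)
  have hn := (Nat.lt_size_self n).le
  refine Runs.weaken (c := n + (2 * n + ((N.outs i).length +
    ((6 * n + (Nat.size n + 3) * N.unseen i []) + (N.outs i).length * Nat.size n)))) ?_ ?_
  -- Each edge is inserted once, either at the root or later, so the insertions cost `Nat.size n`
  -- per edge in total.
  · have : (Nat.size n + 13) * n = Nat.size n * ((N.outs i).length + N.unseen i []) + 13 * n := by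
      rw [hU]; ring
    rw [this]
    nlinarith
  refine Runs.seq ((runs_arr Finset.univ (fun e : Fin n => (cell 65 i e : Reg v n)) _ σ
    (by intro a _ b _ hab; simpa [Fin.ext_iff] using hab) (by simp) (by simp)).weaken (by simp))
    fun σ₁ h₁ =>
    Runs.seq ((runs_arr_blk (b := 67) N.verts (fun x : Fin v => (cell 67 0 x : Reg v n)) _ σ₁
    (by norm_num) (by intro a _ b _ hab; simpa [Fin.ext_iff] using hab) (by simp)
    (by intro x _; split_ifs <;> simp)).weaken ?_) fun σ₂ h₂ =>
    Runs.seq ((runs_arr_blk (b := 68) _ (fun a : Fin n => (cell 68 0 a : Reg v n)) _ σ₂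
    (by norm_num) (injOn_cell 68 _) (by simp) (by simp [ar])).weaken ?_) fun σ₃ h₃ => ?_
  · refine (Finset.sum_le_card_nsmul _ _ 1 fun x _ => ?_).trans (by simpa using hV)
    split_ifs <;> simp
  · simp [ar, N.card_outs]
  · obtain ⟨v₁, f₁⟩ := h₁
    obtain ⟨v₂, f₂⟩ := h₂
    obtain ⟨v₃, f₃⟩ := h₃
    have g40 : ∀ e : Fin n, σ₂ (cell 40 0 e) = t e := by
      intro e; rw [f₂ _ (by simp) (by simp), f₁ _ (by simp) (by simp), h40]
    have hI : N.QueueInv t i [] ((N.outs i).foldr (ins (N.key t [])) []) := QueueInv.start ht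
    have hk : ∀ a, N.src a = i → σ₃ (cell 68 0 a) = N.key t [] a := by
      intro a ha
      rw [v₃ a (by simp [ha])]
      simp [ar, key, dist, g40]
    refine runs_insProg (key := N.key t []) List.Pairwise.nil _ _ _ (fun a ha => hk a ?_)
      (by simp only [List.length_nil]; omega) (runs_dijkstra ht n [] _ σ₃ ?_ hn hI (fun a ha => hk a ?_) ?_
        fun σ₄ f₄ => ?_)
    · simpa [N.mem_outs] using ha
    · rw [length_foldr_ins, List.length_nil]; omega
    · simpa [reached] using ha
    · intro e; rw [f₃ _ (by simp) (by simp), g40]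
    · change Runs (N.flowProg i (N.tree t i)) _ _ _
      have hlen : (N.tree t i).length ≤ n :=
        (length_dijkstra_le n [] _).trans (by simp)
      refine (runs_flowProg (N.tree t i) σ₄ (QueueInv.tree_inv ht).tree).mono
        (Nat.mul_le_mul_left 6 hlen) ?_
      rintro σ₅ ⟨f₅, v₅⟩
      refine ⟨fun y hy => ?_, fun y hy hy' => ?_, fun a => ?_⟩
      · rw [f₅ y (by omega) (by omega) (by rintro e rfl; simp at hy), f₄ y (by omega) (by omega),
          f₃ y (by omega) (by omega), f₂ y (by omega) (by omega),
          f₁ y (by rintro e - rfl; simp at hy) (by omega)]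
      · rw [f₅ y (by omega) (by omega) hy', f₄ y (by omega) (by omega),
          f₃ y (by omega) (by omega), f₂ y (by omega) (by omega), f₁ y (fun e _ => hy' e) (by omega)]
      · rw [v₅, f₄ _ (by simp) (by simp), f₃ _ (by simp) (by simp), f₂ _ (by simp) (by simp),
          v₁ a (Finset.mem_univ a), Finset.sum_filter]
        simp only [Ex.eval_num, Rat.cast_zero, zero_add]
        refine Finset.sum_congr rfl fun x hx => ?_
        rw [f₄ _ (by simp) (by simp), f₃ _ (by simp) (by simp), v₂ x hx]
        split_ifs with hod
        · rw [Ex.eval_reg, f₁ _ (by intro e _ h; cases h) (by simp), hin _ (by simp)]; rfl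
        · simp

/-- The oracle of the non-stochastic case. -/
def shortestProg : Prog v n :=
  .seq (each N.origins.toList N.shortestOriginProg)
  (.seq (vec 51 fun e => .sum N.origins fun i => .reg (cell 65 i e))
  (asg (cell 50 0 0) (.num 0 - .sum Finset.univ fun e => ar 51 e * ar 40 e)))

/-- The potential needs no separate minimization: by `potential_eq_shortestGrad` it is minus the
scalar product of the computed flow with t. -/
theorem isOracleProg_shortest (hN : N.AllSimplePaths) (hg : D.gamma = 0)
    (htb : ∀ e, 0 < D.tbar e) :
    IsOracleProg N D (shortestGrad N D) N.shortestProg (30 * (N.S * n * Nat.size n)) := by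
  intro σ hin t htQ ht
  have ht0 : ∀ e, 0 ≤ t e := fun e => (htb e).le.trans (htQ e)
  have hS := N.S_pos
  have hn := N.card_edges_pos
  have hL : 0 < Nat.size n := Nat.size_pos.mpr hn
  have hcard : N.origins.toList.length = N.S := Finset.length_toList _
  refine Runs.weaken (c := _ + (_ + _)) ?_ (
    (runs_each (fun σ' => ∀ y, blk y < 65 → σ' y = σ y)
      (fun (i : Fin v) σ' => ∀ a : Fin n, σ' (cell 65 i a)
        = ∑ x ∈ N.verts with (i, x) ∈ N.od, D.dem (i, x) * theta a (N.shortest t (i, x)))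
      N.shortestOriginProg ((Nat.size n + 13) * n) N.origins.toList N.origins.nodup_toList (by
        intro i _ σ' hσ'
        refine (N.runs_shortestOrigin (D := D) ht0 i σ' (fun y hy => ?_) fun e => ?_).mono le_rfl ?_
        · rw [hσ' y (by omega), hin y hy]
        · rw [hσ' _ (by simp), ht]
        · rintro σ'' ⟨k₁, k₂, k₃⟩
          refine ⟨fun y hy => (k₁ y hy).trans (hσ' y hy), k₃, fun j hj hq a => ?_⟩
          rw [k₂ _ (by simp), hq a]
          intro e'; rw [ne_eq, cell_inj, Fin.val_inj]; tauto) (σ := σ) fun _ _ => rfl).seq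
      fun σ₂ h₂ =>
    (runs_vec (b := 51) _ σ₂ (by norm_num) (by simp)).seq fun σ₃ h₃ =>
    (runs_asg_blk (b := 50) _ _ σ₃ (by simp) (by simp [ar])).mono le_rfl ?_)
  · have e₁ : N.S * n ≤ N.S * n * Nat.size n := Nat.le_mul_of_pos_right _ hL
    have e₂ : n ≤ N.S * n := Nat.le_mul_of_pos_left _ hS
    have e₄ : N.origins.card = N.S := rfl
    rw [hcard]
    simp only [Ex.size_sum, Ex.size_sub, Ex.size_mul, ar, Ex.size_reg, Ex.size_num,
      Finset.sum_const, smul_eq_mul, Finset.card_univ, Fintype.card_fin, e₄]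
    nlinarith
  · rintro σ₄ ⟨v₄, f₄⟩
    obtain ⟨f₂, v₂⟩ := h₂
    obtain ⟨v₃, f₃⟩ := h₃
    have hG : ∀ e : Fin n, σ₃ (cell 51 0 e) = -shortestGrad N D t e := by
      intro e
      rw [v₃, shortestGrad, neg_neg, N.sum_od, Ex.eval_sum]
      exact Finset.sum_congr rfl fun i hi => v₂ i (Finset.mem_toList.mpr hi) e
    refine ⟨fun y hy => ?_, ?_, fun e => ?_⟩
    · rw [f₄ y (by omega) (by omega), f₃ y (by omega) (by omega), f₂ y (by omega)]
    · rw [v₄, potential_eq_shortestGrad hN hg ht0]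
      simp only [Ex.eval_sub, Ex.eval_num, Ex.eval_sum, Ex.eval_mul, ar, Ex.eval_reg, hG]
      rw [Rat.cast_zero, zero_sub, ← Finset.sum_neg_distrib]
      refine Finset.sum_congr rfl fun e _ => ?_
      rw [f₃ _ (by simp) (by simp), f₂ _ (by simp), ht]; ring
    · rw [f₄ _ (by simp) (by simp), hG]

end Network

end Traffic

namespace Traffic

variable {v n : ℕ} {N : Network v n} {M : Model} {D : Data v n} {G : (Fin n → ℝ) → Fin n → ℝ}

/-! ### The guarantees -/

theorem guarantee_of_oracleProg (hD : Valid N M D) {p : Prog v n} {c : ℕ} (hG : IsOracle N D G)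
    (hp : IsOracleProg N D G p c) {A B C cost : ℝ} {rate : ℝ → ℝ} (hrate : ∀ x, 0 ≤ rate x)
    (hc : 2 * (c : ℝ) + (91 + 180 * n) ≤ A * cost) (hcost : 0 ≤ cost)
    (hA : 0 ≤ A) (hBC : B ≤ C) (hABC : 2 * A * B ≤ C)
    (hterm : ∀ G, IsOracle N D G → ∃ m, StopsAfter N M D G m)
    (htrials : ∀ G, IsOracle N D G → ∀ m, StopsAfter N M D G m →
      (m : ℝ) ≤ B * rate (Rbar M D G ((dualProblem N M D G).state m))) :
    Guarantee C N M D (methodProg M p) (fun e => cell 4 0 e) (fun e => cell 7 0 e) cost rate := by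
  refine ⟨fun G hG => ?_, G, hG, ?_⟩
  · obtain ⟨m, hm⟩ := hterm G hG
    obtain ⟨h₁, h₂⟩ := accurate_of_stop hD hG ((regular_dualProblem hD hG).inv_state m) hm.1
    exact ⟨m, hm, (htrials G hG m hm).trans (mul_le_mul_of_nonneg_right hBC (hrate _)), h₁, h₂⟩
  · obtain ⟨m, hm⟩ := hterm G hG
    obtain ⟨σ, k, he, hk, ht, hf⟩ := exec_method hD hG hp hm
    refine ⟨m, hm, σ, k, he, ?_, ht, hf⟩
    have hk' : (k : ℝ) ≤ (m + 1) * (2 * c + (91 + 180 * n)) := by exact_mod_cast hk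
    have hm1 : (1 : ℝ) ≤ m := by
      obtain ⟨j, rfl⟩ := hm.exists_succ
      push_cast
      linarith [Nat.cast_nonneg (α := ℝ) j]
    have hm2 := htrials G hG m hm
    set r := rate (Rbar M D G ((dualProblem N M D G).state m))
    have hr : 0 ≤ r := hrate _
    calc (k : ℝ) ≤ (m + 1) * (2 * c + (91 + 180 * n)) := hk'
      _ ≤ (m + 1) * (A * cost) := mul_le_mul_of_nonneg_left hc (by linarith)
      _ ≤ (2 * (B * r)) * (A * cost) :=
        mul_le_mul_of_nonneg_right (by linarith) (mul_nonneg hA hcost)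
      _ = 2 * A * B * (cost * r) := by ring
      _ ≤ C * (cost * r) := mul_le_mul_of_nonneg_right hABC (mul_nonneg hcost hr)

theorem logit_cost_le (N : Network v n) :
    2 * ((120 * (N.S * N.maxLen * n) : ℕ) : ℝ) + (91 + 180 * n) ≤ 520 * ((N.S : ℝ) * N.H * n) := by
  have h₁ : N.S * N.maxLen * n ≤ N.S * N.H * n :=
    Nat.mul_le_mul_right _ (Nat.mul_le_mul_left _ N.maxLen_le_H)
  have h₂ : n ≤ N.S * N.H * n := Nat.le_mul_of_pos_left _ (Nat.mul_pos N.S_pos N.H_pos)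
  have h₃ := N.card_edges_pos
  have h : 2 * (120 * (N.S * N.maxLen * n)) + (91 + 180 * n) ≤ 520 * (N.S * N.H * n) := by omega
  exact_mod_cast h

/-- For n ≥ 2 the binary length s + 1 has s ≥ 1 and is at most 2s ≤ 2·ln n/ln 2, with 2/ln 2 < 3. -/
theorem size_le_log {n : ℕ} (hn : 2 ≤ n) : (Nat.size n : ℝ) ≤ 3 * Real.log n := by
  have hs : 1 < Nat.size n := Nat.lt_size.mpr (by simpa using hn)
  obtain ⟨s, hs'⟩ : ∃ s, Nat.size n = s + 1 := ⟨Nat.size n - 1, by omega⟩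
  have hpow : 2 ^ s ≤ n := Nat.lt_size.mp (by omega)
  have hpow' : (2 : ℝ) ^ s ≤ n := by exact_mod_cast hpow
  have hlog := Real.log_le_log (by positivity) hpow'
  rw [Real.log_pow] at hlog
  have h2 := Real.log_two_gt_d9
  have hs1 : (1 : ℝ) ≤ s := by
    have : 1 ≤ s := by omega
    exact_mod_cast this
  rw [hs']
  push_cast
  nlinarith

theorem shortest_cost_le (N : Network v n) (hn : 2 ≤ n) :
    2 * ((30 * (N.S * n * Nat.size n) : ℕ) : ℝ) + (91 + 180 * n)
      ≤ 1000 * ((N.S : ℝ) * n * Real.log n) := by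
  have h₁ : n ≤ N.S * n * Nat.size n := by
    have h : n ≤ N.S * n := Nat.le_mul_of_pos_left _ N.S_pos
    exact h.trans (Nat.le_mul_of_pos_right _ (Nat.size_pos.mpr (by omega)))
  have h : 2 * (30 * (N.S * n * Nat.size n)) + (91 + 180 * n) ≤ 333 * (N.S * n * Nat.size n) := by
    omega
  have h' : 2 * ((30 * (N.S * n * Nat.size n) : ℕ) : ℝ) + (91 + 180 * n)
      ≤ 333 * ((N.S : ℝ) * n * Nat.size n) := by exact_mod_cast h
  have h₂ := mul_le_mul_of_nonneg_left (size_le_log hn) (by positivity : (0 : ℝ) ≤ N.S * n)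
  have h₃ : (0 : ℝ) ≤ N.S * n * Nat.size n := by positivity
  linarith

theorem guarantee_logit (hN : N.AllWalks) (hD : Valid N M D) (hg : 0 < D.gamma) :
    Guarantee 400000 N M D (methodProg M N.logitProg) (fun e => cell 4 0 e) (fun e => cell 7 0 e)
      ((N.S : ℝ) * N.H * n) fun Rb =>
        1 + |Real.log (D.L0 * D.gamma / (N.H * totalDemand N D))|
          + Real.sqrt (N.H * totalDemand N D * Rb ^ 2 / (D.gamma * D.eps)) :=
  guarantee_of_oracleProg (A := 520) (B := 160) hD (isOracle_logit N hg hD.dem_pos)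
    (N.isOracleProg_logit hN hg) (fun _ => by positivity) (logit_cost_le N) (by positivity)
    (by norm_num) (by norm_num) (by norm_num) (fun _ hG => exists_stopsAfter_of_pos hD hg hG)
    fun _ hG _ hm => hm.trials_le_smooth hD hg hG

/-- The program is that of the stochastic case; the constant B doubles to 320 because of the factor
2 in `entropic_rate_le`. -/
theorem guarantee_entropic (hN : N.AllWalks) (hD : Valid N M D) {ε : ℝ} (he : D.eps = ε / 2)
    (hE : 0 < ∑ w ∈ N.od, D.dem w * Real.log ((N.routes w).card : ℝ))
    (hg : D.gamma = ε / (2 * ∑ w ∈ N.od, D.dem w * Real.log ((N.routes w).card : ℝ))) :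
    Guarantee 400000 N M D (methodProg M N.logitProg) (fun e => cell 4 0 e) (fun e => cell 7 0 e)
      ((N.S : ℝ) * N.H * n) fun Rb =>
        1 + |Real.log (D.L0 * D.gamma / (N.H * totalDemand N D))|
          + totalDemand N D / ε * Real.sqrt (N.H * Rb ^ 2 * N.omega) := by
  have hε : 0 < ε := by have := hD.eps_pos; linarith
  have hg0 : 0 < D.gamma := by rw [hg]; positivity
  have hd := hD.demand_pos
  refine guarantee_of_oracleProg (A := 520) (B := 320) hD (isOracle_logit N hg0 hD.dem_pos)
    (N.isOracleProg_logit hN hg0) (fun _ => by positivity) (logit_cost_le N) (by positivity)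
    (by norm_num) (by norm_num) (by norm_num) (fun _ hG => exists_stopsAfter_of_pos hD hg0 hG)
    fun G hG m hm => (hm.trials_le_smooth hD hg0 hG).trans ?_
  have h := entropic_rate_le hD he hE hg (Rbar M D G ((dualProblem N M D G).state m))
  have h' := abs_nonneg (Real.log (D.L0 * D.gamma / (N.H * totalDemand N D)))
  linarith

theorem guarantee_shortest (hN : N.AllSimplePaths) (hn : 2 ≤ n) (hD : Valid N M D)
    (hg : D.gamma = 0) :
    Guarantee 400000 N M D (methodProg M N.shortestProg) (fun e => cell 4 0 e)
      (fun e => cell 7 0 e) ((N.S : ℝ) * n * Real.log n) fun Rb =>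
        1 + |Real.log (D.L0 * D.eps / (N.H * totalDemand N D ^ 2))|
          + N.H * totalDemand N D ^ 2 * Rb ^ 2 / D.eps ^ 2 :=
  guarantee_of_oracleProg (A := 1000) (B := 160) hD
    (isOracle_shortestGrad hN hg hD.dem_pos hD.tbar_pos)
    (N.isOracleProg_shortest hN hg hD.tbar_pos) (fun _ => by positivity) (shortest_cost_le N hn)
    (by positivity) (by norm_num) (by norm_num) (by norm_num)
    (fun _ hG => exists_stopsAfter_of_zero hD hG) fun _ hG _ hm => hm.trials_le_nonsmooth hD hG

end Traffic

end

theorem mainTheorem1 :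
    ∃ C : ℝ, 0 < C ∧ ∀ (v n : ℕ) (N : Traffic.Network v n) (M : Traffic.Model),
      -- stochastic case, and entropic regularization of the non-stochastic case
      (N.AllWalks →
        ∃ (prog : Traffic.Prog v n) (tOut fOut : Fin n → Traffic.Reg v n),
          (∀ D : Traffic.Data v n, Traffic.Valid N M D → 0 < D.gamma →
            Traffic.Guarantee C N M D prog tOut fOut ((N.S : ℝ) * N.H * n) (fun Rb =>
              1 + |Real.log (D.L0 * D.gamma / (N.H * Traffic.totalDemand N D))|
                + Real.sqrt (N.H * Traffic.totalDemand N D * Rb ^ 2 / (D.gamma * D.eps)))) ∧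
          (∀ (D : Traffic.Data v n) (ε : ℝ), Traffic.Valid N M D → D.eps = ε / 2 →
            0 < ∑ w ∈ N.od, D.dem w * Real.log ((N.routes w).card : ℝ) →
            D.gamma = ε / (2 * ∑ w ∈ N.od, D.dem w * Real.log ((N.routes w).card : ℝ)) →
            Traffic.Guarantee C N M D prog tOut fOut ((N.S : ℝ) * N.H * n) (fun Rb =>
              1 + |Real.log (D.L0 * D.gamma / (N.H * Traffic.totalDemand N D))|
                + Traffic.totalDemand N D / ε * Real.sqrt (N.H * Rb ^ 2 * N.omega)) ∧
            ∀ G, Traffic.IsOracle N D G → ∀ m, Traffic.StopsAfter N M D G m →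
              Traffic.PrimalAccurate N M D G 0 ε ((Traffic.dualProblem N M D G).state m))) ∧
      -- non-stochastic case
      (2 ≤ n → N.AllSimplePaths →
        ∃ (prog : Traffic.Prog v n) (tOut fOut : Fin n → Traffic.Reg v n),
          ∀ D : Traffic.Data v n, Traffic.Valid N M D → D.gamma = 0 →
            Traffic.Guarantee C N M D prog tOut fOut ((N.S : ℝ) * n * Real.log n) (fun Rb =>
              1 + |Real.log (D.L0 * D.eps / (N.H * Traffic.totalDemand N D ^ 2))|
                + N.H * Traffic.totalDemand N D ^ 2 * Rb ^ 2 / D.eps ^ 2)) := by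
  -- The constant exceeds 2·A·B in all three cases: 2·520·160, 2·520·320 and 2·1000·160.
  refine ⟨400000, by norm_num, fun v n N M => ⟨fun hN => ?_, fun hn hN => ?_⟩⟩
  · refine ⟨Traffic.methodProg M N.logitProg, fun e => Traffic.cell 4 0 e,
      fun e => Traffic.cell 7 0 e, fun D hD hg => Traffic.guarantee_logit hN hD hg,
      fun D ε hD he hE hg => ⟨Traffic.guarantee_entropic hN hD he hE hg, fun G hG m hm => ?_⟩⟩
    exact Traffic.primalAccurate_zero hD he hE hg (Traffic.accurate_of_stop hD hG
      ((Traffic.regular_dualProblem hD hG).inv_state m) hm.1).1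
  · exact ⟨Traffic.methodProg M N.shortestProg, fun e => Traffic.cell 4 0 e,
      fun e => Traffic.cell 7 0 e, fun D hD hg => Traffic.guarantee_shortest hN hn hD hg⟩
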